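/- **Conventions.** All 2-categories are small and strict, all 2-functors are strict, and $\underline{\mathbf{2Cat}}$ is the 2-category of small 2-categories, 2-functors and 2-natural transformations. Horizontal composition is written $\circ$, vertical composition of 2-cells is written $\cdot$, and $C^{\mathrm{op}}$ is obtained from $C$ by reversing the 1-cells only. For a 2-functor $\mathcal D:C\to\underline{\mathbf{2Cat}}$ write $\mathcal D_c$, $f_*$, $\alpha_*$ for its values on objects, 1-cells and 2-cells; for $\mathcal D:C^{\mathrm{op}}\to\underline{\mathbf{2Cat}}$ write $\mathcal D_c$, $f^*$, $\alpha^*$. A 2-transformation is a (strict) 2-natural transformation. **Grothendieck construction, covariant case.** For $\mathcal D:C\to\underline{\mathbf{2Cat}}$, the 2-category $\int_C\mathcal D$ has objects $(a,x)$ with $a\in C$ and $x\in\mathcal D_a$; 1-cells $(f,u):(a,x)\to(b,y)$ with $f:a\to b$ in $C$ and $u:f_*x\to y$ in $\mathcal D_b$; 2-cells $(\alpha,\phi):(f,u)\Rightarrow(g,v)$ with $\alpha:f\Rightarrow g$ in $C$ and $\phi:u\Rightarrow v\circ\alpha_*x$ in $\mathcal D_b$. The vertical composite of $(\alpha,\phi):(f,u)\Rightarrow(g,v)$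 and $(\beta,\psi):(g,v)\Rightarrow(h,w)$ is $(\beta\cdot\alpha,\ (\psi\circ 1_{\alpha_*x})\cdot\phi)$. The composite of $(f,u):(a,x)\to(b,y)$ and $(f',u'):(b,y)\to(c,z)$ is $(f'\circ f,\ u'\circ f'_*u)$, and the horizontal composite of 2-cells $(\alpha,\phi):(f,u)\Rightarrow(g,v)$ and $(\alpha',\phi'):(f',u')\Rightarrow(g',v')$ between such 1-cells is $(\alpha'\circ\alpha,\ \phi'\circ f'_*\phi)$ (the naturality of $\alpha'_*$ identifies the target of the second component with $(v'\circ g'_*v)\circ(\alpha'\circ\alpha)_*x$). The identities are $1_{(a,x)}=(1_a,1_x)$ and $1_{(f,u)}=(1_f,1_u)$. A 2-transformation $\Gamma:\mathcal D\Rightarrow\mathcal E$ induces the 2-functor $\int_C\Gamma:\int_C\mathcal D\to\int_C\mathcal E$ with $(a,x)\mapsto(a,\Gamma_ax)$, $(f,u)\mapsto(f,\Gamma_bu)$, $(\alpha,\phi)\mapsto(\alpha,\Gamma_b\phi)$. **Grothendieck construction, contravariant case.** For $\mathcal D:C^{\mathrm{op}}\to\underline{\mathbf{2Cat}}$, the 2-category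 $\int_C\mathcal D$ has objects $(a,x)$ with $a\in C$ and $x\in\mathcal D_a$; 1-cells $(f,u):(a,x)\to(b,y)$ with $f:a\to b$ in $C$ and $u:x\to f^*y$ in $\mathcal D_a$; 2-cells $(\alpha,\phi):(f,u)\Rightarrow(g,v)$ with $\alpha:f\Rightarrow g$ in $C$ and $\phi:\alpha^*y\circ u\Rightarrow v$ in $\mathcal D_a$. The vertical composite of $(\alpha,\phi):(f,u)\Rightarrow(g,v)$ and $(\beta,\psi):(g,v)\Rightarrow(h,w)$ is $(\beta\cdot\alpha,\ \psi\cdot(1_{\beta^*y}\circ\phi))$. The composite of $(f,u):(a,x)\to(b,y)$ and $(f',u'):(b,y)\to(c,z)$ is $(f'\circ f,\ f^*u'\circ u)$, and the horizontal composite of $(\alpha,\phi):(f,u)\Rightarrow(g,v)$ and $(\alpha',\phi'):(f',u')\Rightarrow(g',v')$ is $(\alpha'\circ\alpha,\ g^*\phi'\circ\phi)$ (the naturality of $\alpha^*$ identifies the source of the second component with $(\alpha'\circ\alpha)^*z\circ(f^*u'\circ u)$). The identities are $(1_a,1_x)$ and $(1_f,1_u)$. A 2-transformation $\Gamma:\mathcal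 D\Rightarrow\mathcal E$ induces the 2-functor $\int_C\Gamma:\int_C\mathcal D\to\int_C\mathcal E$ with $(a,x)\mapsto(a,\Gamma_ax)$, $(f,u)\mapsto(f,\Gamma_au)$, $(\alpha,\phi)\mapsto(\alpha,\Gamma_a\phi)$. **Homotopy fibres.** Let $F:A\to B$ be a 2-functor and $b\in B$. The 2-category $F\!\downarrow\! b$ has objects $(a,p)$ with $a\in A$ and $p:Fa\to b$; 1-cells $(u,\phi):(a,p)\to(a',p')$ with $u:a\to a'$ and $\phi:p\Rightarrow p'\circ Fu$; its 2-cells $(u,\phi)\Rightarrow(u',\phi')$ are the 2-cells $\alpha:u\Rightarrow u'$ of $A$ with $(1_{p'}\circ F\alpha)\cdot\phi=\phi'$. The composite of $(u,\phi):(a,p)\to(a',p')$ and $(v,\psi):(a',p')\to(a'',p'')$ is $(v\circ u,\ (\psi\circ 1_{Fu})\cdot\phi)$. The 2-category $b\!\downarrow\! F$ has objects $(a,p)$ with $a\in A$ and $p:b\to Fa$; 1-cells $(u,\phi):(a,p)\to(a',p')$ with $u:a\to a'$ and $\phi:Fu\circ p\Rightarrow p'$; its 2-cells $(u,\phi)\Rightarrow(u',\phi')$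 are the 2-cells $\alpha:u\Rightarrow u'$ of $A$ with $\phi'\cdot(F\alpha\circ1_p)=\phi$. The composite of $(u,\phi):(a,p)\to(a',p')$ and $(v,\psi):(a',p')\to(a'',p'')$ is $(v\circ u,\ \psi\cdot(1_{Fv}\circ\phi))$. In both cases the remaining compositions and the identities are those of $A$. **Cofinality.** The classifying space of a 2-category $B$ is $|B|=|\mathrm{Diag}\,\mathrm{N}\mathrm{N}B|$, the geometric realization of the diagonal of its double nerve, the bisimplicial set $$([p],[q])\mapsto \mathrm{N}_q\Big(\coprod_{b_0,\dots,b_p}B(b_0,b_1)\times\cdots\times B(b_{p-1},b_p)\Big).$$ A 2-category is *weakly contractible* if its classifying space is contractible. A 2-functor $F:A\to B$ is *homotopy left cofinal* if $F\!\downarrow\! b$ is weakly contractible for every object $b\in B$, and *homotopy right cofinal* if $b\!\downarrow\! F$ is weakly contractible for every object $b\in B$. **Corollary (Theorem A for 2-diagrams).** Let $C$ be a 2-category and let $\Gamma:\mathcal D\Rightarrow\mathcal E$ be a 2-transformation, where $\mathcal D,\mathcal E:C\to\underline{\mathbf{2Cat}}$ (resp. $\mathcal D,\mathcal E:C^{\mathrm{op}}\to\underline{\mathbf{2Cat}}$)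 are 2-functors. The following statements are equivalent: (a) the 2-functor $\int_C\Gamma:\int_C\mathcal D\to\int_C\mathcal E$ is homotopy left (resp. right) cofinal; (b) for every object $c\in C$, the 2-functor $\Gamma_c:\mathcal D_c\to\mathcal E_c$ is homotopy left (resp. right) cofinal. -/

import Mathlib

open CategoryTheory Bicategory

universe w v u w₁ v₁ u₁ w₂ v₂ u₂ w₃ v₃ u₃

namespace TwoDiag

/-! ### Strict 2-categories -/

/-- The data and laws of a strict 2-category, with the strict unit and associativity laws of
whiskering stated as heterogeneous equalities. -/
structure StrictCore (B : Type u) [CategoryStruct.{v} B] where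
  homCategory : ∀ a b : B, Category.{w} (a ⟶ b)
  id_comp : ∀ {a b : B} (f : a ⟶ b), 𝟙 a ≫ f = f
  comp_id : ∀ {a b : B} (f : a ⟶ b), f ≫ 𝟙 b = f
  assoc : ∀ {a b c d : B} (f : a ⟶ b) (g : b ⟶ c) (h : c ⟶ d), (f ≫ g) ≫ h = f ≫ g ≫ h
  whiskerLeft : ∀ {a b c : B} (f : a ⟶ b) {g h : b ⟶ c} (_ : g ⟶ h), f ≫ g ⟶ f ≫ h
  whiskerRight : ∀ {a b c : B} {f g : a ⟶ b} (_ : f ⟶ g) (h : b ⟶ c), f ≫ h ⟶ g ≫ h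
  whiskerLeft_id : ∀ {a b c : B} (f : a ⟶ b) (g : b ⟶ c),
    whiskerLeft f (𝟙 g) = 𝟙 (f ≫ g)
  whiskerLeft_comp : ∀ {a b c : B} (f : a ⟶ b) {g h i : b ⟶ c} (η : g ⟶ h) (θ : h ⟶ i),
    whiskerLeft f (η ≫ θ) = whiskerLeft f η ≫ whiskerLeft f θ
  id_whiskerRight : ∀ {a b c : B} (f : a ⟶ b) (g : b ⟶ c),
    whiskerRight (𝟙 f) g = 𝟙 (f ≫ g)
  comp_whiskerRight : ∀ {a b c : B} {f g h : a ⟶ b} (η : f ⟶ g) (θ : g ⟶ h) (i : b ⟶ c),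
    whiskerRight (η ≫ θ) i = whiskerRight η i ≫ whiskerRight θ i
  whisker_exchange : ∀ {a b c : B} {f g : a ⟶ b} {h i : b ⟶ c} (η : f ⟶ g) (θ : h ⟶ i),
    whiskerLeft f θ ≫ whiskerRight η i = whiskerRight η h ≫ whiskerLeft g θ
  id_whiskerLeft : ∀ {a b : B} {f g : a ⟶ b} (η : f ⟶ g), whiskerLeft (𝟙 a) η ≍ η
  whiskerRight_id : ∀ {a b : B} {f g : a ⟶ b} (η : f ⟶ g), whiskerRight η (𝟙 b) ≍ η
  comp_whiskerLeft : ∀ {a b c d : B} (f : a ⟶ b) (g : b ⟶ c) {h h' : c ⟶ d} (η : h ⟶ h'),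
    whiskerLeft (f ≫ g) η ≍ whiskerLeft f (whiskerLeft g η)
  whiskerRight_comp : ∀ {a b c d : B} {f f' : a ⟶ b} (η : f ⟶ f') (g : b ⟶ c) (h : c ⟶ d),
    whiskerRight η (g ≫ h) ≍ whiskerRight (whiskerRight η g) h
  whisker_assoc : ∀ {a b c d : B} (f : a ⟶ b) {g g' : b ⟶ c} (η : g ⟶ g') (h : c ⟶ d),
    whiskerRight (whiskerLeft f η) h ≍ whiskerLeft f (whiskerRight η h)

namespace StrictCore
variable {B : Type u} [CategoryStruct.{v} B] (S : StrictCore.{w} B)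

theorem whiskerLeft_eqToHom {a b c : B} (f : a ⟶ b) {g h : b ⟶ c} (e : g = h) :
    letI := S.homCategory
    S.whiskerLeft f (eqToHom e) = eqToHom (by rw [e]) := by
  subst e; exact S.whiskerLeft_id _ _

theorem eqToHom_whiskerRight {a b c : B} {f g : a ⟶ b} (e : f = g) (h : b ⟶ c) :
    letI := S.homCategory
    S.whiskerRight (eqToHom e) h = eqToHom (by rw [e]) := by
  subst e; exact S.id_whiskerRight _ _

/-- The bicategory of a strict core; all structure isomorphisms come from equalities. -/
@[reducible] def toBicategory : Bicategory.{w, v} B where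
  homCategory := S.homCategory
  whiskerLeft := S.whiskerLeft
  whiskerRight := S.whiskerRight
  associator f g h := letI := S.homCategory; eqToIso (S.assoc f g h)
  leftUnitor f := letI := S.homCategory; eqToIso (S.id_comp f)
  rightUnitor f := letI := S.homCategory; eqToIso (S.comp_id f)
  whiskerLeft_id := S.whiskerLeft_id
  whiskerLeft_comp := S.whiskerLeft_comp
  id_whiskerRight := S.id_whiskerRight
  comp_whiskerRight := S.comp_whiskerRight
  whisker_exchange := S.whisker_exchange
  id_whiskerLeft η := by
    let := S.homCategory
    simp [← heq_eq_eq, S.id_whiskerLeft]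
  whiskerRight_id η := by
    let := S.homCategory
    simp [← heq_eq_eq, S.whiskerRight_id]
  comp_whiskerLeft f g _ _ η := by
    let := S.homCategory
    simp [← heq_eq_eq, S.comp_whiskerLeft]
  whiskerRight_comp η g h := by
    let := S.homCategory
    simp [← heq_eq_eq, S.whiskerRight_comp]
  whisker_assoc f _ _ η h := by
    let := S.homCategory
    simp [← heq_eq_eq, S.whisker_assoc]
  pentagon f g h i := by
    let := S.homCategory
    simp [S.whiskerLeft_eqToHom, S.eqToHom_whiskerRight]
  triangle f g := by
    let := S.homCategory
    simp [S.whiskerLeft_eqToHom, S.eqToHom_whiskerRight]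

theorem strict : letI := S.toBicategory; Bicategory.Strict B :=
  letI := S.toBicategory
  { id_comp := S.id_comp
    comp_id := S.comp_id
    assoc := S.assoc
    leftUnitor_eqToIso := fun _ => rfl
    rightUnitor_eqToIso := fun _ => rfl
    associator_eqToIso := fun _ _ _ => rfl }

end StrictCore

section HEqCalculus
variable {B : Type u} [Bicategory.{w, v} B] [Strict B]

theorem whiskerLeft_hcongr {a a' b b' c c' : B} (ha : a = a') (hb : b = b') (hc : c = c')
    {f : a ⟶ b} {f' : a' ⟶ b'} (hf : f ≍ f') {g h : b ⟶ c} {g' h' : b' ⟶ c'}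
    (hg : g ≍ g') (hh : h ≍ h') {η : g ⟶ h} {η' : g' ⟶ h'} (hη : η ≍ η') :
    f ◁ η ≍ f' ◁ η' := by
  subst ha hb hc; cases hf; cases hg; cases hh; cases hη; rfl

theorem whiskerRight_hcongr {a a' b b' c c' : B} (ha : a = a') (hb : b = b') (hc : c = c')
    {f g : a ⟶ b} {f' g' : a' ⟶ b'} (hf : f ≍ f') (hg : g ≍ g')
    {η : f ⟶ g} {η' : f' ⟶ g'} (hη : η ≍ η') {h : b ⟶ c} {h' : b' ⟶ c'} (hh : h ≍ h') :
    η ▷ h ≍ η' ▷ h' := by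
  subst ha hb hc; cases hf; cases hg; cases hh; cases hη; rfl

theorem id_whiskerLeft_heq {a b : B} {f g : a ⟶ b} (η : f ⟶ g) : 𝟙 a ◁ η ≍ η := by
  simp [id_whiskerLeft, Strict.leftUnitor_eqToIso]

theorem whiskerRight_id_heq {a b : B} {f g : a ⟶ b} (η : f ⟶ g) : η ▷ 𝟙 b ≍ η := by
  simp [whiskerRight_id, Strict.rightUnitor_eqToIso]

theorem comp_whiskerLeft_heq {a b c d : B} (f : a ⟶ b) (g : b ⟶ c) {h h' : c ⟶ d} (η : h ⟶ h') :
    (f ≫ g) ◁ η ≍ f ◁ g ◁ η := by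
  simp [comp_whiskerLeft, Strict.associator_eqToIso]

theorem whiskerRight_comp_heq {a b c d : B} {f f' : a ⟶ b} (η : f ⟶ f') (g : b ⟶ c) (h : c ⟶ d) :
    η ▷ (g ≫ h) ≍ η ▷ g ▷ h := by
  simp [whiskerRight_comp, Strict.associator_eqToIso]

theorem whisker_assoc_heq {a b c d : B} (f : a ⟶ b) {g g' : b ⟶ c} (η : g ⟶ g') (h : c ⟶ d) :
    (f ◁ η) ▷ h ≍ f ◁ η ▷ h := by
  simp [whisker_assoc, Strict.associator_eqToIso]

end HEqCalculus

section
variable {A : Type u₁} [Bicategory.{w₁, v₁} A] {B : Type u₂} [Bicategory.{w₂, v₂} B]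

theorem strictPseudofunctor_ext {F G : StrictPseudofunctor A B}
    (h : F.toPrelaxFunctor = G.toPrelaxFunctor) : F = G := by
  obtain ⟨⟨⟨F, _, _, _, _, _, _, _⟩, _, hF⟩, _, hF'⟩ := F
  obtain ⟨⟨⟨G, _, _, _, _, _, _, _⟩, _, hG⟩, _, hG'⟩ := G
  dsimp at h hF hG hF' hG'
  subst h
  congr
  · funext x; rw [hF, hG]
  · funext _ _ _ f g; rw [hF', hG']

end

/-! ### 2-natural transformations and the 2-category of 2-categories -/

section
variable {A : Type u₁} [Bicategory.{w₁, v₁} A] {B : Type u₂} [Bicategory.{w₂, v₂} B]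
  {E : Type u₃} [Bicategory.{w₃, v₃} E]

/-- A 2-natural transformation between 2-functors: natural on 1-cells and on 2-cells, strictly. -/
structure TwoNatTrans (F G : StrictPseudofunctor A B) where
  app : ∀ a : A, F.obj a ⟶ G.obj a
  naturality : ∀ {a b : A} (f : a ⟶ b), F.map f ≫ app b = app a ≫ G.map f
  naturality₂ : ∀ {a b : A} {f g : a ⟶ b} (η : f ⟶ g),
    F.map₂ η ▷ app b ≫ eqToHom (naturality g) = eqToHom (naturality f) ≫ app a ◁ G.map₂ η

namespace TwoNatTrans

theorem naturality₂_heq {F G : StrictPseudofunctor A B} (θ : TwoNatTrans F G) {a b : A}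
    {f g : a ⟶ b} (η : f ⟶ g) : F.map₂ η ▷ θ.app b ≍ θ.app a ◁ G.map₂ η := by
  have h := heq_of_eq (θ.naturality₂ η)
  rwa [comp_eqToHom_heq_iff, heq_eqToHom_comp_iff] at h

theorem eq_of_app {F G : StrictPseudofunctor A B} {θ θ' : TwoNatTrans F G}
    (h : ∀ a, θ.app a = θ'.app a) : θ = θ' := by
  obtain ⟨t, _, _⟩ := θ
  obtain ⟨t', _, _⟩ := θ'
  obtain rfl : t = t' := funext h
  rfl

/-- Constructor with the naturality on 2-cells given as a heterogeneous equality. -/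
def ofHEq {F G : StrictPseudofunctor A B} (app : ∀ a : A, F.obj a ⟶ G.obj a)
    (naturality : ∀ {a b : A} (f : a ⟶ b), F.map f ≫ app b = app a ≫ G.map f)
    (naturality₂ : ∀ {a b : A} {f g : a ⟶ b} (η : f ⟶ g),
      F.map₂ η ▷ app b ≍ app a ◁ G.map₂ η) : TwoNatTrans F G where
  app := app
  naturality := naturality
  naturality₂ η := by simpa [← heq_eq_eq] using naturality₂ η

theorem map₂_whiskerLeft_heq (F : StrictPseudofunctor A B) {a b c : A} (f : a ⟶ b) {g g' : b ⟶ c}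
    (η : g ⟶ g') : F.map₂ (f ◁ η) ≍ F.map f ◁ F.map₂ η := by
  simp [F.map₂_whisker_left, F.mapComp_eq_eqToIso]

theorem map₂_whiskerRight_heq (F : StrictPseudofunctor A B) {a b c : A} {f f' : a ⟶ b}
    (η : f ⟶ f') (g : b ⟶ c) : F.map₂ (η ▷ g) ≍ F.map₂ η ▷ F.map g := by
  simp [F.map₂_whisker_right, F.mapComp_eq_eqToIso]

theorem map₂_hcongr (F : StrictPseudofunctor A B) {a a' b b' : A} (ha : a = a') (hb : b = b')
    {f g : a ⟶ b} {f' g' : a' ⟶ b'} (hf : f ≍ f') (hg : g ≍ g') {η : f ⟶ g} {η' : f' ⟶ g'}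
    (hη : η ≍ η') : F.map₂ η ≍ F.map₂ η' := by
  subst ha hb; cases hf; cases hg; cases hη; rfl

variable [Strict B]

/-- The identity 2-natural transformation. -/
def id (F : StrictPseudofunctor A B) : TwoNatTrans F F :=
  ofHEq (fun a => 𝟙 (F.obj a))
    (fun f => (Strict.comp_id (F.map f)).trans (Strict.id_comp (F.map f)).symm)
    (fun _ => (whiskerRight_id_heq _).trans (id_whiskerLeft_heq _).symm)

/-- Vertical composition of 2-natural transformations. -/
def vcomp {F G H : StrictPseudofunctor A B} (θ : TwoNatTrans F G) (κ : TwoNatTrans G H) :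
    TwoNatTrans F H :=
  ofHEq (fun a => θ.app a ≫ κ.app a)
    (fun {a b} f => by
      rw [← Strict.assoc, θ.naturality, Strict.assoc, κ.naturality, Strict.assoc])
    (fun {a b f g} η => by
      refine (whiskerRight_comp_heq _ _ _).trans ?_
      refine (whiskerRight_hcongr rfl rfl rfl (heq_of_eq (θ.naturality f))
        (heq_of_eq (θ.naturality g)) (θ.naturality₂_heq η) HEq.rfl).trans ?_
      refine (whisker_assoc_heq _ _ _).trans ?_
      refine (whiskerLeft_hcongr rfl rfl rfl HEq.rfl (heq_of_eq (κ.naturality f))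
        (heq_of_eq (κ.naturality g)) (κ.naturality₂_heq η)).trans ?_
      exact (comp_whiskerLeft_heq _ _ _).symm)

/-- Whiskering of a 2-natural transformation with a 2-functor on the source side. -/
def whiskerL (F : StrictPseudofunctor A B) {G H : StrictPseudofunctor B E}
    (θ : TwoNatTrans G H) : TwoNatTrans (F.comp G) (F.comp H) :=
  ofHEq (fun a => θ.app (F.obj a)) (fun f => θ.naturality (F.map f))
    (fun η => θ.naturality₂_heq (F.map₂ η))

/-- Whiskering of a 2-natural transformation with a 2-functor on the target side. -/
def whiskerR {F G : StrictPseudofunctor A B} (θ : TwoNatTrans F G)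
    (H : StrictPseudofunctor B E) : TwoNatTrans (F.comp H) (G.comp H) :=
  ofHEq (fun a => H.map (θ.app a))
    (fun {a b} f => by
      change H.map (F.map f) ≫ H.map (θ.app b) = H.map (θ.app a) ≫ H.map (G.map f)
      rw [← H.map_comp, ← H.map_comp, θ.naturality])
    (fun {a b f g} η => by
      change H.map₂ (F.map₂ η) ▷ H.map (θ.app b) ≍ H.map (θ.app a) ◁ H.map₂ (G.map₂ η)
      refine (map₂_whiskerRight_heq H _ _).symm.trans ?_
      refine (map₂_hcongr H rfl rfl (heq_of_eq (θ.naturality f))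
        (heq_of_eq (θ.naturality g)) (θ.naturality₂_heq η)).trans ?_
      exact map₂_whiskerLeft_heq H _ _)

end TwoNatTrans
end

/-- Bundled strict 2-categories. -/
structure TwoCat where
  carrier : Type u
  [bicategory : Bicategory.{w, v} carrier]
  [strict : Strict carrier]

namespace TwoCat

instance : CoeSort TwoCat.{w, v, u} (Type u) := ⟨carrier⟩

attribute [instance] bicategory strict

/-- 1-cells of `TwoCat` are 2-functors. -/
structure Hom (A B : TwoCat.{w, v, u}) where
  toFunctor : StrictPseudofunctor A B

instance : CategoryStruct TwoCat.{w, v, u} where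
  Hom := Hom
  id A := ⟨StrictPseudofunctor.id A⟩
  comp F G := ⟨F.toFunctor.comp G.toFunctor⟩

theorem hom_ext {A B : TwoCat.{w, v, u}} {F G : A ⟶ B} (h : F.toFunctor = G.toFunctor) :
    F = G :=
  congrArg Hom.mk h

/-- 2-cells of `TwoCat` are 2-natural transformations. -/
structure Hom₂ {A B : TwoCat.{w, v, u}} (F G : A ⟶ B) where
  toNatTrans : TwoNatTrans F.toFunctor G.toFunctor

theorem hom₂_ext {A B : TwoCat.{w, v, u}} {F G : A ⟶ B} {θ κ : Hom₂ F G}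
    (h : ∀ x, θ.toNatTrans.app x = κ.toNatTrans.app x) : θ = κ := by
  obtain ⟨θ⟩ := θ
  obtain ⟨κ⟩ := κ
  exact congrArg Hom₂.mk (TwoNatTrans.eq_of_app h)

theorem hom₂_hext {A B : TwoCat.{w, v, u}} {F G F' G' : A ⟶ B} (hF : F = F') (hG : G = G')
    {θ : Hom₂ F G} {κ : Hom₂ F' G'}
    (h : ∀ x, θ.toNatTrans.app x ≍ κ.toNatTrans.app x) : θ ≍ κ := by
  subst hF hG
  exact heq_of_eq (hom₂_ext fun x => eq_of_heq (h x))

instance homCategory (A B : TwoCat.{w, v, u}) : Category (A ⟶ B) where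
  Hom F G := Hom₂ F G
  id F := ⟨TwoNatTrans.id F.toFunctor⟩
  comp θ κ := ⟨θ.toNatTrans.vcomp κ.toNatTrans⟩
  id_comp _ := hom₂_ext fun _ => Strict.id_comp _
  comp_id _ := hom₂_ext fun _ => Strict.comp_id _
  assoc _ _ _ := hom₂_ext fun _ => Strict.assoc _ _ _

/-- The strict 2-category of 2-categories, 2-functors and 2-natural transformations. -/
@[reducible] def core : StrictCore TwoCat.{w, v, u} where
  homCategory := homCategory
  id_comp _ := hom_ext (strictPseudofunctor_ext rfl)
  comp_id _ := hom_ext (strictPseudofunctor_ext rfl)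
  assoc _ _ _ := hom_ext (strictPseudofunctor_ext rfl)
  whiskerLeft F _ _ θ := ⟨TwoNatTrans.whiskerL F.toFunctor θ.toNatTrans⟩
  whiskerRight θ H := ⟨θ.toNatTrans.whiskerR H.toFunctor⟩
  whiskerLeft_id _ _ := rfl
  whiskerLeft_comp _ _ _ _ _ _ := rfl
  id_whiskerRight _ g := hom₂_ext fun _ => g.toFunctor.map_id _
  comp_whiskerRight _ _ i := hom₂_ext fun _ => i.toFunctor.map_comp _ _
  whisker_exchange η θ := hom₂_ext fun x => (θ.toNatTrans.naturality (η.toNatTrans.app x)).symm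
  id_whiskerLeft {_ _ f g} _ :=
    hom₂_hext (F := 𝟙 _ ≫ f) (G := 𝟙 _ ≫ g) (F' := f) (G' := g)
      (hom_ext (strictPseudofunctor_ext rfl)) (hom_ext (strictPseudofunctor_ext rfl))
      fun _ => HEq.rfl
  whiskerRight_id {_ _ f g} _ :=
    hom₂_hext (F := f ≫ 𝟙 _) (G := g ≫ 𝟙 _) (F' := f) (G' := g)
      (hom_ext (strictPseudofunctor_ext rfl)) (hom_ext (strictPseudofunctor_ext rfl))
      fun _ => HEq.rfl
  comp_whiskerLeft f g h h' _ :=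
    hom₂_hext (F := (f ≫ g) ≫ h) (G := (f ≫ g) ≫ h') (F' := f ≫ g ≫ h) (G' := f ≫ g ≫ h')
      (hom_ext (strictPseudofunctor_ext rfl)) (hom_ext (strictPseudofunctor_ext rfl))
      fun _ => HEq.rfl
  whiskerRight_comp {_ _ _ _ f f'} _ g h :=
    hom₂_hext (F := f ≫ g ≫ h) (G := f' ≫ g ≫ h) (F' := (f ≫ g) ≫ h) (G' := (f' ≫ g) ≫ h)
      (hom_ext (strictPseudofunctor_ext rfl)) (hom_ext (strictPseudofunctor_ext rfl))
      fun _ => HEq.rfl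
  whisker_assoc f g g' _ h :=
    hom₂_hext (F := (f ≫ g) ≫ h) (G := (f ≫ g') ≫ h) (F' := f ≫ g ≫ h) (G' := f ≫ g' ≫ h)
      (hom_ext (strictPseudofunctor_ext rfl)) (hom_ext (strictPseudofunctor_ext rfl))
      fun _ => HEq.rfl

instance instBicategory : Bicategory TwoCat.{w, v, u} := core.toBicategory
instance instStrict : Strict TwoCat.{w, v, u} := core.strict

end TwoCat

/-! ### Equality of cells with different boundaries -/

/-- A 1-cell together with its source and target. -/
structure Arr (B : Type u) [Bicategory.{w, v} B] where
  {src tgt : B}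
  hom : src ⟶ tgt

/-- A 2-cell together with its sources and targets. -/
structure Cell (B : Type u) [Bicategory.{w, v} B] where
  {src tgt : B}
  {dom cod : src ⟶ tgt}
  cell : dom ⟶ cod

section
variable {B : Type u} [Bicategory.{w, v} B]

theorem Arr.inj {a b : B} {f g : a ⟶ b} (h : Arr.mk f = Arr.mk g) : f = g := by
  cases h; rfl

theorem Arr.comp {a b c a' b' c' : B} {f : a ⟶ b} {g : b ⟶ c} {f' : a' ⟶ b'} {g' : b' ⟶ c'}
    (h : Arr.mk f = Arr.mk f') (h' : Arr.mk g = Arr.mk g') :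
    Arr.mk (f ≫ g) = Arr.mk (f' ≫ g') := by
  cases h; cases h'; rfl

theorem Cell.inj {a b : B} {f g : a ⟶ b} {η θ : f ⟶ g} (h : Cell.mk η = Cell.mk θ) : η = θ := by
  cases h; rfl

theorem Cell.of_heq {a b : B} {f g : a ⟶ b} {f' g' : a ⟶ b} {η : f ⟶ g} {θ : f' ⟶ g'}
    (hf : f = f') (hg : g = g') (h : η ≍ θ) : Cell.mk η = Cell.mk θ := by
  subst hf hg; cases h; rfl

theorem Cell.vcomp {a b a' b' : B} {f g h : a ⟶ b} {f' g' h' : a' ⟶ b'}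
    {η : f ⟶ g} {θ : g ⟶ h} {η' : f' ⟶ g'} {θ' : g' ⟶ h'}
    (e : Cell.mk η = Cell.mk η') (e' : Cell.mk θ = Cell.mk θ') :
    Cell.mk (η ≫ θ) = Cell.mk (η' ≫ θ') := by
  cases e; cases e'; rfl

theorem Cell.left {a b c a' b' c' : B} {f : a ⟶ b} {f' : a' ⟶ b'} {g h : b ⟶ c}
    {g' h' : b' ⟶ c'} {η : g ⟶ h} {η' : g' ⟶ h'}
    (e : Arr.mk f = Arr.mk f') (e' : Cell.mk η = Cell.mk η') :
    Cell.mk (f ◁ η) = Cell.mk (f' ◁ η') := by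
  cases e; cases e'; rfl

theorem Cell.right {a b c a' b' c' : B} {f g : a ⟶ b} {f' g' : a' ⟶ b'} {h : b ⟶ c}
    {h' : b' ⟶ c'} {η : f ⟶ g} {η' : f' ⟶ g'}
    (e : Cell.mk η = Cell.mk η') (e' : Arr.mk h = Arr.mk h') :
    Cell.mk (η ▷ h) = Cell.mk (η' ▷ h') := by
  cases e; cases e'; rfl

theorem Cell.id {a b a' b' : B} {f : a ⟶ b} {f' : a' ⟶ b'} (e : Arr.mk f = Arr.mk f') :
    Cell.mk (𝟙 f) = Cell.mk (𝟙 f') := by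
  cases e; rfl

theorem Cell.eqToHom {a b : B} {f g : a ⟶ b} (h : f = g) :
    Cell.mk (eqToHom h) = Cell.mk (𝟙 f) := by
  subst h; rfl

theorem Cell.comp_eqToHom {a b : B} {f g h : a ⟶ b} (η : f ⟶ g) (e : g = h) :
    Cell.mk (η ≫ CategoryTheory.eqToHom e) = Cell.mk η := by
  subst e; simp

theorem Cell.eqToHom_comp {a b : B} {f g h : a ⟶ b} (e : f = g) (η : g ⟶ h) :
    Cell.mk (CategoryTheory.eqToHom e ≫ η) = Cell.mk η := by
  subst e; simp

theorem Arr.eqToHom_eq {a b a' b' : B} (e : a = b) (e' : a' = b') (h : b = b') :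
    Arr.mk (eqToHom e) = Arr.mk (eqToHom e') := by
  subst e e' h; rfl

variable [Strict B]

theorem Arr.assoc {a b c d : B} (f : a ⟶ b) (g : b ⟶ c) (h : c ⟶ d) :
    Arr.mk ((f ≫ g) ≫ h) = Arr.mk (f ≫ g ≫ h) :=
  congrArg _ (Strict.assoc f g h)

theorem Arr.eqToHom_comp {a b c : B} (e : a = b) (f : b ⟶ c) :
    Arr.mk (eqToHom e ≫ f) = Arr.mk f := by
  subst e; exact congrArg _ (Strict.id_comp f)

theorem Arr.comp_eqToHom {a b c : B} (f : a ⟶ b) (e : b = c) :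
    Arr.mk (f ≫ eqToHom e) = Arr.mk f := by
  subst e; exact congrArg _ (Strict.comp_id f)

theorem Cell.eqToHom_left {a a' b : B} (h : a' = a) {f g : a ⟶ b} (η : f ⟶ g) :
    Cell.mk (CategoryTheory.eqToHom h ◁ η) = Cell.mk η := by
  subst h
  exact Cell.of_heq (Strict.id_comp _) (Strict.id_comp _) (id_whiskerLeft_heq η)

theorem Cell.right_eqToHom {a b b' : B} (h : b = b') {f g : a ⟶ b} (η : f ⟶ g) :
    Cell.mk (η ▷ CategoryTheory.eqToHom h) = Cell.mk η := by
  subst h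
  exact Cell.of_heq (Strict.comp_id _) (Strict.comp_id _) (whiskerRight_id_heq η)

theorem Cell.comp_left {a b c d : B} (f : a ⟶ b) (g : b ⟶ c) {h h' : c ⟶ d} (η : h ⟶ h') :
    Cell.mk ((f ≫ g) ◁ η) = Cell.mk (f ◁ g ◁ η) :=
  Cell.of_heq (Strict.assoc _ _ _) (Strict.assoc _ _ _) (comp_whiskerLeft_heq _ _ _)

theorem Cell.right_comp {a b c d : B} {f f' : a ⟶ b} (η : f ⟶ f') (g : b ⟶ c) (h : c ⟶ d) :
    Cell.mk (η ▷ (g ≫ h)) = Cell.mk (η ▷ g ▷ h) :=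
  Cell.of_heq (Strict.assoc _ _ _).symm (Strict.assoc _ _ _).symm (whiskerRight_comp_heq _ _ _)

theorem Cell.left_right {a b c d : B} (f : a ⟶ b) {g g' : b ⟶ c} (η : g ⟶ g') (h : c ⟶ d) :
    Cell.mk ((f ◁ η) ▷ h) = Cell.mk (f ◁ η ▷ h) :=
  Cell.of_heq (Strict.assoc _ _ _) (Strict.assoc _ _ _) (whisker_assoc_heq _ _ _)

end

section
variable {A : Type u₁} [Bicategory.{w₁, v₁} A] {B : Type u₂} [Bicategory.{w₂, v₂} B]

theorem Arr.map {F G : StrictPseudofunctor A B} (h : F = G) {a b a' b' : A} {f : a ⟶ b}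
    {f' : a' ⟶ b'} (e : Arr.mk f = Arr.mk f') : Arr.mk (F.map f) = Arr.mk (G.map f') := by
  subst h; cases e; rfl

theorem Cell.map {F G : StrictPseudofunctor A B} (h : F = G) {a b a' b' : A} {f g : a ⟶ b}
    {f' g' : a' ⟶ b'} {η : f ⟶ g} {η' : f' ⟶ g'} (e : Cell.mk η = Cell.mk η') :
    Cell.mk (F.map₂ η) = Cell.mk (G.map₂ η') := by
  subst h; cases e; rfl

variable (F : StrictPseudofunctor A B)

theorem Arr.map_comp {a b c : A} (f : a ⟶ b) (g : b ⟶ c) :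
    Arr.mk (F.map (f ≫ g)) = Arr.mk (F.map f ≫ F.map g) :=
  congrArg _ (F.map_comp f g)

theorem map_eqToHom {a b : A} (h : a = b) : F.map (eqToHom h) = eqToHom (by rw [h]) := by
  subst h; exact F.map_id a

theorem Arr.map_eqToHom_comp [Strict B] {a b : A} (h : a = b) {c : B} (g : F.obj b ⟶ c) :
    Arr.mk (F.map (eqToHom h) ≫ g) = Arr.mk g := by
  rw [map_eqToHom]; exact Arr.eqToHom_comp _ _

theorem Cell.map_eqToHom {a b : A} {f g : a ⟶ b} (h : f = g) :
    Cell.mk (F.map₂ (CategoryTheory.eqToHom h)) = Cell.mk (𝟙 (F.map f)) := by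
  subst h; exact congrArg _ (F.map₂_id f)

theorem Cell.map_left {a b c : A} (f : a ⟶ b) {g g' : b ⟶ c} (η : g ⟶ g') :
    Cell.mk (F.map₂ (f ◁ η)) = Cell.mk (F.map f ◁ F.map₂ η) :=
  Cell.of_heq (F.map_comp _ _) (F.map_comp _ _) (TwoNatTrans.map₂_whiskerLeft_heq F f η)

theorem Cell.map_right {a b c : A} {f f' : a ⟶ b} (η : f ⟶ f') (g : b ⟶ c) :
    Cell.mk (F.map₂ (η ▷ g)) = Cell.mk (F.map₂ η ▷ F.map g) :=
  Cell.of_heq (F.map_comp _ _) (F.map_comp _ _) (TwoNatTrans.map₂_whiskerRight_heq F η g)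

theorem Cell.map_comp {a b : A} {f g h : a ⟶ b} (η : f ⟶ g) (θ : g ⟶ h) :
    Cell.mk (F.map₂ (η ≫ θ)) = Cell.mk (F.map₂ η ≫ F.map₂ θ) :=
  congrArg _ (F.map₂_comp η θ)

theorem Cell.naturality {F G : StrictPseudofunctor A B} (θ : TwoNatTrans F G) {a b : A}
    {f g : a ⟶ b} (η : f ⟶ g) :
    Cell.mk (F.map₂ η ▷ θ.app b) = Cell.mk (θ.app a ◁ G.map₂ η) :=
  Cell.of_heq (θ.naturality f) (θ.naturality g) (θ.naturality₂_heq η)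

theorem Arr.naturality {F G : StrictPseudofunctor A B} (θ : TwoNatTrans F G) {a b : A}
    (f : a ⟶ b) : Arr.mk (F.map f ≫ θ.app b) = Arr.mk (θ.app a ≫ G.map f) :=
  congrArg _ (θ.naturality f)

end

/-! ### The covariant Grothendieck construction -/

theorem TwoCat.app_congr {A B : TwoCat.{w, v, u}} {F G F' G' : A ⟶ B} (hF : F = F') (hG : G = G')
    {θ : F ⟶ G} {θ' : F' ⟶ G'} (h : θ ≍ θ') (x : A) :
    Arr.mk (θ.toNatTrans.app x) = Arr.mk (θ'.toNatTrans.app x) := by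
  subst hF hG; cases h; rfl

section Grothendieck
variable {C : Type u₁} [Bicategory.{w₁, v₁} C]

section
variable (D : StrictPseudofunctor C TwoCat.{w, v, u})

/-- The 2-functor `f_* : D_a ⟶ D_b` of a 1-cell `f : a ⟶ b`. -/
abbrev push {a b : C} (f : a ⟶ b) : StrictPseudofunctor (D.obj a) (D.obj b) :=
  (D.map f).toFunctor

/-- The component `α_* x : f_* x ⟶ g_* x` of a 2-cell `α : f ⟶ g`. -/
abbrev pushCell {a b : C} {f g : a ⟶ b} (α : f ⟶ g) (x : D.obj a) :
    (push D f).obj x ⟶ (push D g).obj x :=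
  (D.map₂ α).toNatTrans.app x

theorem push_id (a : C) : push D (𝟙 a) = StrictPseudofunctor.id (D.obj a) :=
  congrArg TwoCat.Hom.toFunctor (D.map_id a)

theorem push_comp {a b c : C} (f : a ⟶ b) (g : b ⟶ c) :
    push D (f ≫ g) = (push D f).comp (push D g) :=
  congrArg TwoCat.Hom.toFunctor (D.map_comp f g)

theorem push_id_obj (a : C) (x : D.obj a) : (push D (𝟙 a)).obj x = x := by
  rw [push_id]; rfl

theorem push_comp_obj {a b c : C} (f : a ⟶ b) (g : b ⟶ c) (x : D.obj a) :
    (push D (f ≫ g)).obj x = (push D g).obj ((push D f).obj x) := by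
  rw [push_comp]; rfl

theorem pushCell_id {a b : C} (f : a ⟶ b) (x : D.obj a) : pushCell D (𝟙 f) x = 𝟙 _ := by
  rw [pushCell, D.map₂_id]; rfl

theorem pushCell_comp {a b : C} {f g h : a ⟶ b} (α : f ⟶ g) (β : g ⟶ h) (x : D.obj a) :
    pushCell D (α ≫ β) x = pushCell D α x ≫ pushCell D β x := by
  rw [pushCell, D.map₂_comp]; rfl

theorem pushCell_left {a b c : C} (f : a ⟶ b) {g h : b ⟶ c} (α : g ⟶ h) (x : D.obj a) :
    Arr.mk (pushCell D (f ◁ α) x) = Arr.mk (pushCell D α ((push D f).obj x)) :=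
  TwoCat.app_congr (D.map_comp f g) (D.map_comp f h) (TwoNatTrans.map₂_whiskerLeft_heq D f α) x

theorem pushCell_right {a b c : C} {f g : a ⟶ b} (α : f ⟶ g) (h : b ⟶ c) (x : D.obj a) :
    Arr.mk (pushCell D (α ▷ h) x) = Arr.mk ((push D h).map (pushCell D α x)) :=
  TwoCat.app_congr (D.map_comp f h) (D.map_comp g h) (TwoNatTrans.map₂_whiskerRight_heq D α h) x

theorem push_id_map {a : C} {x y : D.obj a} (u : x ⟶ y) :
    Arr.mk ((push D (𝟙 a)).map u) = Arr.mk u :=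
  Arr.map (push_id D a) rfl

theorem push_comp_map {a b c : C} (f : a ⟶ b) (g : b ⟶ c) {x y : D.obj a} (u : x ⟶ y) :
    Arr.mk ((push D (f ≫ g)).map u) = Arr.mk ((push D g).map ((push D f).map u)) :=
  Arr.map (push_comp D f g) rfl

theorem push_id_map₂ {a : C} {x y : D.obj a} {u v : x ⟶ y} (φ : u ⟶ v) :
    Cell.mk ((push D (𝟙 a)).map₂ φ) = Cell.mk φ :=
  Cell.map (push_id D a) rfl

theorem push_comp_map₂ {a b c : C} (f : a ⟶ b) (g : b ⟶ c) {x y : D.obj a} {u v : x ⟶ y}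
    (φ : u ⟶ v) :
    Cell.mk ((push D (f ≫ g)).map₂ φ) = Cell.mk ((push D g).map₂ ((push D f).map₂ φ)) :=
  Cell.map (push_comp D f g) rfl

end

/-- Objects of the Grothendieck construction `∫_C D` of `D : C ⟶ 2Cat`. -/
structure Groth (D : StrictPseudofunctor C TwoCat.{w, v, u}) where
  base : C
  fiber : D.obj base

namespace Groth
variable {D : StrictPseudofunctor C TwoCat.{w, v, u}}

/-- 1-cells `(f, u) : (a, x) ⟶ (b, y)` of `∫_C D`, where `u : f_* x ⟶ y`. -/
structure Hom (X Y : Groth D) where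
  base : X.base ⟶ Y.base
  fiber : (push D base).obj X.fiber ⟶ Y.fiber

theorem Hom.hext {X Y : Groth D} {f g : Hom X Y} (h : f.base = g.base)
    (h' : Arr.mk f.fiber = Arr.mk g.fiber) : f = g := by
  obtain ⟨f, φ⟩ := f
  obtain ⟨g, ψ⟩ := g
  dsimp at h h'
  subst h
  rw [Arr.inj h']

instance : CategoryStruct (Groth D) where
  Hom := Hom
  id X := ⟨𝟙 X.base, eqToHom (push_id_obj D X.base X.fiber)⟩
  comp {X _ _} f g := ⟨f.base ≫ g.base,
    eqToHom (push_comp_obj D f.base g.base X.fiber) ≫ (push D g.base).map f.fiber ≫ g.fiber⟩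

theorem arr_comp {X Y Z : Groth D} (f : X ⟶ Y) (g : Y ⟶ Z) :
    Arr.mk (f ≫ g).fiber = Arr.mk ((push D g.base).map f.fiber ≫ g.fiber) :=
  Arr.eqToHom_comp _ _

/-- 2-cells `(α, φ) : (f, u) ⟶ (g, v)` of `∫_C D`, where `φ : u ⇒ v ∘ α_* x`. -/
structure Hom₂ {X Y : Groth D} (f g : X ⟶ Y) where
  base : f.base ⟶ g.base
  fiber : f.fiber ⟶ pushCell D base X.fiber ≫ g.fiber

theorem Hom₂.eq_of_cell {X Y : Groth D} {f g : X ⟶ Y} {η θ : Hom₂ f g}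
    (h : η.base = θ.base) (h' : Cell.mk η.fiber = Cell.mk θ.fiber) : η = θ := by
  obtain ⟨η, φ⟩ := η
  obtain ⟨θ, ψ⟩ := θ
  dsimp at h h'
  subst h
  rw [Cell.inj h']

theorem Hom₂.hext {X Y : Groth D} {f g f' g' : X ⟶ Y} (hf : f = f') (hg : g = g')
    {η : Hom₂ f g} {θ : Hom₂ f' g'} (h : η.base ≍ θ.base)
    (h' : Cell.mk η.fiber = Cell.mk θ.fiber) : η ≍ θ := by
  subst hf hg
  exact heq_of_eq (Hom₂.eq_of_cell (eq_of_heq h) h')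

theorem id₂_eq {X Y : Groth D} (f : X ⟶ Y) :
    f.fiber = pushCell D (𝟙 f.base) X.fiber ≫ f.fiber := by
  rw [pushCell_id, Strict.id_comp]

/-- The identity 2-cell `(1_f, 1_u)`. -/
def id₂ {X Y : Groth D} (f : X ⟶ Y) : Hom₂ f f :=
  ⟨𝟙 f.base, eqToHom (id₂_eq f)⟩

/-- The vertical composite `(β · α, (ψ ∘ 1_{α_* x}) · φ)`. -/
def vcomp {X Y : Groth D} {f g h : X ⟶ Y} (η : Hom₂ f g) (θ : Hom₂ g h) : Hom₂ f h :=
  ⟨η.base ≫ θ.base, η.fiber ≫ pushCell D η.base X.fiber ◁ θ.fiber ≫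
    eqToHom (by rw [pushCell_comp, Strict.assoc])⟩

theorem cell_id₂ {X Y : Groth D} (f : X ⟶ Y) : Cell.mk (id₂ f).fiber = Cell.mk (𝟙 f.fiber) :=
  Cell.eqToHom (id₂_eq f)

theorem cell_vcomp {X Y : Groth D} {f g h : X ⟶ Y} (η : Hom₂ f g) (θ : Hom₂ g h) :
    Cell.mk (vcomp η θ).fiber = Cell.mk (η.fiber ≫ pushCell D η.base X.fiber ◁ θ.fiber) :=
  Cell.vcomp rfl (Cell.comp_eqToHom _ _)

instance homCategory (X Y : Groth D) : Category (X ⟶ Y) where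
  Hom f g := Hom₂ f g
  id f := id₂ f
  comp η θ := vcomp η θ
  id_comp {f g} η := by
    refine Hom₂.eq_of_cell (Category.id_comp _) ((cell_vcomp _ _).trans ?_)
    refine (Cell.eqToHom_comp (id₂_eq f) _).trans ?_
    refine (Cell.left (congrArg _ (pushCell_id D f.base X.fiber)) rfl).trans ?_
    exact Cell.eqToHom_left rfl _
  comp_id {f g} η := by
    refine Hom₂.eq_of_cell (Category.comp_id _) ((cell_vcomp _ _).trans ?_)
    change Cell.mk (_ ≫ _ ◁ eqToHom (id₂_eq g)) = _
    rw [whiskerLeft_eqToHom]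
    exact Cell.comp_eqToHom _ _
  assoc η θ κ := by
    refine Hom₂.eq_of_cell (Category.assoc _ _ _) ((cell_vcomp _ _).trans ?_)
    refine Eq.trans ?_ (cell_vcomp _ _).symm
    refine (Cell.vcomp (cell_vcomp _ _) ((Cell.left
      (congrArg _ (pushCell_comp D η.base θ.base X.fiber)) rfl).trans
        (Cell.comp_left _ _ _))).trans ?_
    rw [Category.assoc, ← whiskerLeft_comp]
    exact Cell.vcomp rfl (Cell.left rfl (cell_vcomp θ κ).symm)

theorem id_comp' [Strict C] {X Y : Groth D} (f : X ⟶ Y) : 𝟙 X ≫ f = f := by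
  refine Hom.hext (Strict.id_comp _) ((arr_comp _ _).trans ?_)
  exact Arr.map_eqToHom_comp _ (push_id_obj D X.base X.fiber) _

theorem comp_id' [Strict C] {X Y : Groth D} (f : X ⟶ Y) : f ≫ 𝟙 Y = f := by
  refine Hom.hext (Strict.comp_id _) ((arr_comp _ _).trans ?_)
  exact (Arr.comp_eqToHom _ (push_id_obj D Y.base Y.fiber)).trans (push_id_map D _)

theorem assoc' [Strict C] {X Y Z W : Groth D} (f : X ⟶ Y) (g : Y ⟶ Z) (h : Z ⟶ W) :
    (f ≫ g) ≫ h = f ≫ g ≫ h := by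
  refine Hom.hext (Strict.assoc _ _ _) ((arr_comp _ _).trans ?_)
  refine Eq.trans ?_ (arr_comp _ _).symm
  refine (Arr.comp ((Arr.map rfl (arr_comp f g)).trans (Arr.map_comp _ _ _)) rfl).trans ?_
  refine (Arr.assoc _ _ _).trans ?_
  exact Arr.comp (push_comp_map D _ _ _).symm (arr_comp g h).symm

theorem whiskerLeft_eq {X Y Z : Groth D} (f : X ⟶ Y) {g h : Y ⟶ Z} (η : Hom₂ g h) :
    eqToHom (push_comp_obj D f.base g.base X.fiber) ≫ (push D g.base).map f.fiber ≫
      pushCell D η.base Y.fiber ≫ h.fiber =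
    pushCell D (f.base ◁ η.base) X.fiber ≫ (f ≫ h).fiber := by
  apply Arr.inj
  refine (Arr.eqToHom_comp _ _).trans ?_
  refine (Arr.assoc _ _ _).symm.trans ?_
  refine (Arr.comp (Arr.naturality (D.map₂ η.base).toNatTrans f.fiber) rfl).trans ?_
  refine (Arr.assoc _ _ _).trans ?_
  exact Arr.comp (pushCell_left D _ _ _).symm (arr_comp f h).symm

/-- Whiskering `(α, φ) ∘ 1_{(f, u)}`. -/
def whiskerL {X Y Z : Groth D} (f : X ⟶ Y) {g h : Y ⟶ Z} (η : Hom₂ g h) :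
    Hom₂ (f ≫ g) (f ≫ h) :=
  ⟨f.base ◁ η.base,
    eqToHom (push_comp_obj D f.base g.base X.fiber) ◁ (push D g.base).map f.fiber ◁ η.fiber ≫
      eqToHom (whiskerLeft_eq f η)⟩

theorem cell_whiskerL {X Y Z : Groth D} (f : X ⟶ Y) {g h : Y ⟶ Z} (η : Hom₂ g h) :
    Cell.mk (whiskerL f η).fiber = Cell.mk ((push D g.base).map f.fiber ◁ η.fiber) :=
  (Cell.comp_eqToHom _ _).trans (Cell.eqToHom_left _ _)

theorem whiskerRight_eq {X Y Z : Groth D} {f g : X ⟶ Y} (η : Hom₂ f g) (h : Y ⟶ Z) :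
    eqToHom (push_comp_obj D f.base h.base X.fiber) ≫
      (push D h.base).map (pushCell D η.base X.fiber ≫ g.fiber) ≫ h.fiber =
    pushCell D (η.base ▷ h.base) X.fiber ≫ (g ≫ h).fiber := by
  apply Arr.inj
  refine (Arr.eqToHom_comp _ _).trans ?_
  refine (Arr.comp (Arr.map_comp _ _ _) rfl).trans ?_
  refine (Arr.assoc _ _ _).trans ?_
  exact Arr.comp (pushCell_right D _ _ _).symm (arr_comp g h).symm

/-- Whiskering `1_{(h, v)} ∘ (α, φ)`. -/
def whiskerR {X Y Z : Groth D} {f g : X ⟶ Y} (η : Hom₂ f g) (h : Y ⟶ Z) :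
    Hom₂ (f ≫ h) (g ≫ h) :=
  ⟨η.base ▷ h.base,
    eqToHom (push_comp_obj D f.base h.base X.fiber) ◁ (push D h.base).map₂ η.fiber ▷ h.fiber ≫
      eqToHom (whiskerRight_eq η h)⟩

theorem cell_whiskerR {X Y Z : Groth D} {f g : X ⟶ Y} (η : Hom₂ f g) (h : Y ⟶ Z) :
    Cell.mk (whiskerR η h).fiber = Cell.mk ((push D h.base).map₂ η.fiber ▷ h.fiber) :=
  (Cell.comp_eqToHom _ _).trans (Cell.eqToHom_left _ _)

/-- The 2-category structure of `∫_C D`. -/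
@[reducible] def core [Strict C] : StrictCore (Groth D) where
  homCategory := homCategory
  id_comp := id_comp'
  comp_id := comp_id'
  assoc := assoc'
  whiskerLeft f _ _ η := whiskerL f η
  whiskerRight η h := whiskerR η h
  whiskerLeft_id f g := by
    refine Hom₂.eq_of_cell (whiskerLeft_id _ _) ((cell_whiskerL _ _).trans ?_)
    refine (Cell.left rfl (cell_id₂ g)).trans ?_
    rw [whiskerLeft_id]
    exact (Cell.id (arr_comp f g).symm).trans (cell_id₂ _).symm
  whiskerLeft_comp {X Y Z} f g h i η θ := by
    refine Hom₂.eq_of_cell (whiskerLeft_comp _ _ _) ((cell_whiskerL _ _).trans ?_)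
    refine Eq.trans ?_ (cell_vcomp _ _).symm
    refine (Cell.left rfl (cell_vcomp η θ)).trans ?_
    rw [whiskerLeft_comp]
    refine Cell.vcomp (cell_whiskerL f η).symm ?_
    refine (Cell.comp_left _ _ _).symm.trans ?_
    refine (Cell.left (Arr.naturality (D.map₂ η.base).toNatTrans f.fiber) rfl).trans ?_
    refine (Cell.comp_left _ _ _).trans ?_
    exact Cell.left (pushCell_left D _ _ _).symm (cell_whiskerL f θ).symm
  id_whiskerRight f g := by
    refine Hom₂.eq_of_cell (id_whiskerRight _ _) ((cell_whiskerR _ _).trans ?_)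
    refine (Cell.right ((Cell.map rfl (cell_id₂ f)).trans
      (congrArg _ ((push D g.base).map₂_id _))) rfl).trans ?_
    rw [id_whiskerRight]
    exact (Cell.id (arr_comp f g).symm).trans (cell_id₂ _).symm
  comp_whiskerRight {X Y Z} f g h η θ i := by
    refine Hom₂.eq_of_cell (comp_whiskerRight _ _ _) ((cell_whiskerR _ _).trans ?_)
    refine Eq.trans ?_ (cell_vcomp _ _).symm
    refine (Cell.right ((Cell.map rfl (cell_vcomp η θ)).trans (Cell.map_comp _ _ _)) rfl).trans ?_
    rw [comp_whiskerRight]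
    refine Cell.vcomp (cell_whiskerR η i).symm ?_
    refine (Cell.right (Cell.map_left _ _ _) rfl).trans ?_
    refine (Cell.left_right _ _ _).trans ?_
    exact Cell.left (pushCell_right D _ _ _).symm (cell_whiskerR θ i).symm
  whisker_exchange {X Y Z f g h i} η θ := by
    refine Hom₂.eq_of_cell (whisker_exchange _ _) ((cell_vcomp _ _).trans ?_)
    refine Eq.trans ?_ (cell_vcomp _ _).symm
    have h₁ : Cell.mk ((push D h.base).map₂ η.fiber ▷ (pushCell D θ.base Y.fiber ≫ i.fiber)) =
        Cell.mk (pushCell D (f.base ◁ θ.base) X.fiber ◁ (whiskerR η i).fiber) := by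
      refine (Cell.right_comp _ _ _).trans ?_
      refine (Cell.right (Cell.naturality (D.map₂ θ.base).toNatTrans η.fiber) rfl).trans ?_
      refine (Cell.left_right _ _ _).trans ?_
      exact Cell.left (pushCell_left D _ _ _).symm (cell_whiskerR η i).symm
    have h₂ : Cell.mk ((push D h.base).map (pushCell D η.base X.fiber ≫ g.fiber) ◁ θ.fiber) =
        Cell.mk (pushCell D (η.base ▷ h.base) X.fiber ◁ (whiskerL g θ).fiber) := by
      refine (Cell.left (Arr.map_comp _ _ _) rfl).trans ?_
      refine (Cell.comp_left _ _ _).trans ?_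
      exact Cell.left (pushCell_right D _ _ _).symm (cell_whiskerL g θ).symm
    refine (Cell.vcomp (cell_whiskerL f θ) h₁.symm).trans ?_
    refine Eq.trans ?_ (Cell.vcomp (cell_whiskerR η h).symm h₂)
    exact congrArg _ (whisker_exchange _ _)
  id_whiskerLeft η := by
    refine Hom₂.hext (id_comp' _) (id_comp' _) (id_whiskerLeft_heq _) ((cell_whiskerL _ _).trans ?_)
    refine (Cell.left (congrArg _ (map_eqToHom _ (push_id_obj D _ _))) rfl).trans ?_
    exact Cell.eqToHom_left _ _
  whiskerRight_id η := by
    refine Hom₂.hext (comp_id' _) (comp_id' _) (whiskerRight_id_heq _) ((cell_whiskerR _ _).trans ?_)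
    refine (Cell.right_eqToHom (push_id_obj D _ _) _).trans ?_
    exact push_id_map₂ D _
  comp_whiskerLeft f g h h' η := by
    refine Hom₂.hext (assoc' _ _ _) (assoc' _ _ _) (comp_whiskerLeft_heq _ _ _)
      ((cell_whiskerL _ _).trans ?_)
    refine Eq.trans ?_ (cell_whiskerL _ _).symm
    refine (Cell.left ((Arr.map rfl (arr_comp f g)).trans (Arr.map_comp _ _ _)) rfl).trans ?_
    refine (Cell.comp_left _ _ _).trans ?_
    exact Cell.left (push_comp_map D _ _ _).symm (cell_whiskerL g η).symm
  whiskerRight_comp η g h := by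
    refine Hom₂.hext (assoc' _ _ _).symm (assoc' _ _ _).symm (whiskerRight_comp_heq _ _ _)
      ((cell_whiskerR _ _).trans ?_)
    refine Eq.trans ?_ (cell_whiskerR _ _).symm
    refine (Cell.right (push_comp_map₂ D _ _ _) (arr_comp g h)).trans ?_
    refine (Cell.right_comp _ _ _).trans ?_
    exact Cell.right ((Cell.map_right _ _ _).symm.trans (Cell.map rfl (cell_whiskerR η g).symm)) rfl
  whisker_assoc f g g' η h := by
    refine Hom₂.hext (assoc' _ _ _) (assoc' _ _ _) (whisker_assoc_heq _ _ _)
      ((cell_whiskerR _ _).trans ?_)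
    refine Eq.trans ?_ (cell_whiskerL _ _).symm
    refine (Cell.right ((Cell.map rfl (cell_whiskerL f η)).trans (Cell.map_left _ _ _)) rfl).trans ?_
    refine (Cell.left_right _ _ _).trans ?_
    exact Cell.left (push_comp_map D _ _ _).symm (cell_whiskerR η h).symm

instance [Strict C] : Bicategory (Groth D) := core.toBicategory
instance [Strict C] : Strict (Groth D) := core.strict

variable {E : StrictPseudofunctor C TwoCat.{w, v, u}}

/-- The component `Γ_c : D_c ⟶ E_c`, as a 2-functor. -/
abbrev component (Γ : TwoNatTrans D E) (c : C) : StrictPseudofunctor (D.obj c) (E.obj c) :=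
  (Γ.app c).toFunctor

theorem naturality_functor (Γ : TwoNatTrans D E) {a b : C} (f : a ⟶ b) :
    (component Γ a).comp (push E f) = (push D f).comp (component Γ b) :=
  (congrArg TwoCat.Hom.toFunctor (Γ.naturality f)).symm

theorem naturality_obj (Γ : TwoNatTrans D E) {a b : C} (f : a ⟶ b) (x : D.obj a) :
    (push E f).obj ((component Γ a).obj x) = (component Γ b).obj ((push D f).obj x) :=
  congrArg (fun F => F.obj x) (naturality_functor Γ f)

theorem naturality_map (Γ : TwoNatTrans D E) {a b : C} (f : a ⟶ b) {x y : D.obj a} (u : x ⟶ y) :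
    Arr.mk ((push E f).map ((component Γ a).map u)) = Arr.mk ((component Γ b).map ((push D f).map u)) :=
  Arr.map (naturality_functor Γ f) (f := u) rfl

theorem naturality_map₂ (Γ : TwoNatTrans D E) {a b : C} (f : a ⟶ b) {x y : D.obj a} {u v : x ⟶ y}
    (φ : u ⟶ v) : Cell.mk ((push E f).map₂ ((component Γ a).map₂ φ)) =
      Cell.mk ((component Γ b).map₂ ((push D f).map₂ φ)) :=
  Cell.map (naturality_functor Γ f) (η := φ) rfl

theorem naturality_pushCell (Γ : TwoNatTrans D E) {a b : C} {f g : a ⟶ b} (α : f ⟶ g)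
    (x : D.obj a) : Arr.mk (pushCell E α ((component Γ a).obj x)) =
      Arr.mk ((component Γ b).map (pushCell D α x)) :=
  (TwoCat.app_congr (Γ.naturality f) (Γ.naturality g) (Γ.naturality₂_heq α) x).symm

/-- The action of `∫_C Γ` on objects. -/
def mapObj (Γ : TwoNatTrans D E) (X : Groth D) : Groth E := ⟨X.base, (component Γ X.base).obj X.fiber⟩

/-- The action of `∫_C Γ` on 1-cells: `(f, u) ↦ (f, Γ_b u)`. -/
def mapHom (Γ : TwoNatTrans D E) {X Y : Groth D} (f : X ⟶ Y) : mapObj Γ X ⟶ mapObj Γ Y :=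
  ⟨f.base, eqToHom (naturality_obj Γ f.base X.fiber) ≫ (component Γ Y.base).map f.fiber⟩

theorem arr_mapHom (Γ : TwoNatTrans D E) {X Y : Groth D} (f : X ⟶ Y) :
    Arr.mk (mapHom Γ f).fiber = Arr.mk ((component Γ Y.base).map f.fiber) :=
  Arr.eqToHom_comp _ _

theorem mapHom₂_eq (Γ : TwoNatTrans D E) {X Y : Groth D} {f g : X ⟶ Y} (η : f.base ⟶ g.base) :
    eqToHom (naturality_obj Γ f.base X.fiber) ≫
      (component Γ Y.base).map (pushCell D η X.fiber ≫ g.fiber) =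
    pushCell E η (mapObj Γ X).fiber ≫ (mapHom Γ g).fiber := by
  apply Arr.inj
  refine (Arr.eqToHom_comp _ _).trans ?_
  refine (Arr.map_comp _ _ _).trans ?_
  exact Arr.comp (naturality_pushCell Γ _ _).symm (arr_mapHom Γ g).symm

/-- The action of `∫_C Γ` on 2-cells: `(α, φ) ↦ (α, Γ_b φ)`. -/
def mapHom₂ (Γ : TwoNatTrans D E) {X Y : Groth D} {f g : X ⟶ Y} (η : Hom₂ f g) :
    Hom₂ (mapHom Γ f) (mapHom Γ g) :=
  ⟨η.base, eqToHom (naturality_obj Γ f.base X.fiber) ◁ (component Γ Y.base).map₂ η.fiber ≫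
    eqToHom (mapHom₂_eq Γ η.base)⟩

theorem cell_mapHom₂ (Γ : TwoNatTrans D E) {X Y : Groth D} {f g : X ⟶ Y} (η : Hom₂ f g) :
    Cell.mk (mapHom₂ Γ η).fiber = Cell.mk ((component Γ Y.base).map₂ η.fiber) :=
  (Cell.comp_eqToHom _ _).trans (Cell.eqToHom_left _ _)

theorem mapHom_id (Γ : TwoNatTrans D E) (X : Groth D) : mapHom Γ (𝟙 X) = 𝟙 (mapObj Γ X) := by
  refine Hom.hext rfl ((arr_mapHom _ _).trans ?_)
  refine (congrArg _ (map_eqToHom _ (push_id_obj D _ _))).trans ?_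
  exact Arr.eqToHom_eq _ (push_id_obj E _ _) rfl

theorem mapHom_comp (Γ : TwoNatTrans D E) {X Y Z : Groth D} (f : X ⟶ Y) (g : Y ⟶ Z) :
    mapHom Γ (f ≫ g) = mapHom Γ f ≫ mapHom Γ g := by
  refine Hom.hext rfl ((arr_mapHom _ _).trans ?_)
  refine Eq.trans ?_ (arr_comp _ _).symm
  refine (Arr.map rfl (arr_comp f g)).trans ((Arr.map_comp _ _ _).trans ?_)
  refine Arr.comp ?_ (arr_mapHom Γ g).symm
  refine (naturality_map Γ _ _).symm.trans ?_
  exact Arr.map rfl (arr_mapHom Γ f).symm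

/-- The 2-functor `∫_C Γ : ∫_C D ⟶ ∫_C E`. -/
def map [Strict C] (Γ : TwoNatTrans D E) : StrictPseudofunctor (Groth D) (Groth E) :=
  StrictPseudofunctor.mk''
    { obj := mapObj Γ
      map := mapHom Γ
      map₂ := mapHom₂ Γ
      map₂_id := fun {X Y} f => by
        refine Hom₂.eq_of_cell rfl ((cell_mapHom₂ _ _).trans ?_)
        refine (Cell.map rfl (cell_id₂ f)).trans ?_
        refine (congrArg _ ((component Γ Y.base).map₂_id _)).trans ?_
        exact (Cell.id (arr_mapHom Γ f).symm).trans (cell_id₂ _).symm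
      map₂_comp := fun {X Y f g h} η θ => by
        refine Hom₂.eq_of_cell rfl ((cell_mapHom₂ _ _).trans ?_)
        refine Eq.trans ?_ (cell_vcomp _ _).symm
        refine (Cell.map rfl (cell_vcomp η θ)).trans ((Cell.map_comp _ _ _).trans ?_)
        refine Cell.vcomp (cell_mapHom₂ Γ η).symm ?_
        refine (Cell.map_left _ _ _).trans ?_
        exact Cell.left (naturality_pushCell Γ _ _).symm (cell_mapHom₂ Γ θ).symm
      map_id := mapHom_id Γ
      map_comp := mapHom_comp Γ
      map₂_whisker_left := fun {X Y Z} f {g g'} η => by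
        refine eq_of_heq (HEq.trans ?_ ((eqToHom_comp_heq _ _).trans (comp_eqToHom_heq _ _)).symm)
        refine Hom₂.hext (mapHom_comp Γ f g) (mapHom_comp Γ f g') HEq.rfl
          ((cell_mapHom₂ _ _).trans ?_)
        refine Eq.trans ?_ (cell_whiskerL _ _).symm
        refine (Cell.map rfl (cell_whiskerL f η)).trans ((Cell.map_left _ _ _).trans ?_)
        exact Cell.left ((naturality_map Γ _ _).symm.trans (Arr.map rfl (arr_mapHom Γ f).symm))
          (cell_mapHom₂ Γ η).symm
      map₂_whisker_right := fun {X Y Z f f'} η g => by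
        refine eq_of_heq (HEq.trans ?_ ((eqToHom_comp_heq _ _).trans (comp_eqToHom_heq _ _)).symm)
        refine Hom₂.hext (mapHom_comp Γ f g) (mapHom_comp Γ f' g) HEq.rfl
          ((cell_mapHom₂ _ _).trans ?_)
        refine Eq.trans ?_ (cell_whiskerR _ _).symm
        refine (Cell.map rfl (cell_whiskerR η g)).trans ((Cell.map_right _ _ _).trans ?_)
        exact Cell.right ((naturality_map₂ Γ _ _).symm.trans (Cell.map rfl (cell_mapHom₂ Γ η).symm))
          (arr_mapHom Γ g).symm }

end Groth
end Grothendieck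

/-! ### The contravariant Grothendieck construction -/

section GrothendieckOp
open Opposite Bicategory.Opposite
variable {C : Type u₁} [Bicategory.{w₁, v₁} C]

section
variable (D : StrictPseudofunctor Cᵒᵖ TwoCat.{w, v, u})

/-- The 2-functor `f^* : D_b ⟶ D_a` of a 1-cell `f : a ⟶ b`. -/
abbrev pull {a b : C} (f : a ⟶ b) : StrictPseudofunctor (D.obj (op b)) (D.obj (op a)) :=
  (D.map f.op).toFunctor

/-- The component `α^* y : f^* y ⟶ g^* y` of a 2-cell `α : f ⟶ g`. -/
abbrev pullCell {a b : C} {f g : a ⟶ b} (α : f ⟶ g) (y : D.obj (op b)) :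
    (pull D f).obj y ⟶ (pull D g).obj y :=
  (D.map₂ (op2 α)).toNatTrans.app y

theorem pull_id (a : C) : pull D (𝟙 a) = StrictPseudofunctor.id (D.obj (op a)) :=
  congrArg TwoCat.Hom.toFunctor (D.map_id (op a))

theorem pull_comp {a b c : C} (f : a ⟶ b) (g : b ⟶ c) :
    pull D (f ≫ g) = (pull D g).comp (pull D f) :=
  congrArg TwoCat.Hom.toFunctor (D.map_comp g.op f.op)

theorem pull_id_obj (a : C) (x : D.obj (op a)) : x = (pull D (𝟙 a)).obj x := by
  rw [pull_id]; rfl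

theorem pull_comp_obj {a b c : C} (f : a ⟶ b) (g : b ⟶ c) (z : D.obj (op c)) :
    (pull D f).obj ((pull D g).obj z) = (pull D (f ≫ g)).obj z := by
  rw [pull_comp]; rfl

theorem pullCell_id {a b : C} (f : a ⟶ b) (y : D.obj (op b)) : pullCell D (𝟙 f) y = 𝟙 _ := by
  rw [pullCell, op2_id, D.map₂_id]; rfl

theorem pullCell_comp {a b : C} {f g h : a ⟶ b} (α : f ⟶ g) (β : g ⟶ h) (y : D.obj (op b)) :
    pullCell D (α ≫ β) y = pullCell D α y ≫ pullCell D β y := by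
  rw [pullCell, op2_comp, D.map₂_comp]; rfl

theorem pullCell_left {a b c : C} (f : a ⟶ b) {g h : b ⟶ c} (α : g ⟶ h) (z : D.obj (op c)) :
    Arr.mk (pullCell D (f ◁ α) z) = Arr.mk ((pull D f).map (pullCell D α z)) :=
  TwoCat.app_congr (D.map_comp g.op f.op) (D.map_comp h.op f.op)
    (TwoNatTrans.map₂_whiskerRight_heq D (op2 α) f.op) z

theorem pullCell_right {a b c : C} {f g : a ⟶ b} (α : f ⟶ g) (h : b ⟶ c) (z : D.obj (op c)) :
    Arr.mk (pullCell D (α ▷ h) z) = Arr.mk (pullCell D α ((pull D h).obj z)) :=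
  TwoCat.app_congr (D.map_comp h.op f.op) (D.map_comp h.op g.op)
    (TwoNatTrans.map₂_whiskerLeft_heq D h.op (op2 α)) z

theorem pull_id_map {a : C} {x y : D.obj (op a)} (u : x ⟶ y) :
    Arr.mk ((pull D (𝟙 a)).map u) = Arr.mk u :=
  Arr.map (pull_id D a) rfl

theorem pull_comp_map {a b c : C} (f : a ⟶ b) (g : b ⟶ c) {x y : D.obj (op c)} (u : x ⟶ y) :
    Arr.mk ((pull D (f ≫ g)).map u) = Arr.mk ((pull D f).map ((pull D g).map u)) :=
  Arr.map (pull_comp D f g) rfl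

theorem pull_id_map₂ {a : C} {x y : D.obj (op a)} {u v : x ⟶ y} (φ : u ⟶ v) :
    Cell.mk ((pull D (𝟙 a)).map₂ φ) = Cell.mk φ :=
  Cell.map (pull_id D a) rfl

theorem pull_comp_map₂ {a b c : C} (f : a ⟶ b) (g : b ⟶ c) {x y : D.obj (op c)} {u v : x ⟶ y}
    (φ : u ⟶ v) :
    Cell.mk ((pull D (f ≫ g)).map₂ φ) = Cell.mk ((pull D f).map₂ ((pull D g).map₂ φ)) :=
  Cell.map (pull_comp D f g) rfl

end

/-- Objects of the Grothendieck construction `∫_C D` of `D : Cᵒᵖ ⟶ 2Cat`. -/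
structure GrothOp (D : StrictPseudofunctor Cᵒᵖ TwoCat.{w, v, u}) where
  base : C
  fiber : D.obj (op base)

namespace GrothOp
variable {D : StrictPseudofunctor Cᵒᵖ TwoCat.{w, v, u}}

/-- 1-cells `(f, u) : (a, x) ⟶ (b, y)` of `∫_C D`, where `u : x ⟶ f^* y`. -/
structure Hom (X Y : GrothOp D) where
  base : X.base ⟶ Y.base
  fiber : X.fiber ⟶ (pull D base).obj Y.fiber

theorem Hom.hext {X Y : GrothOp D} {f g : Hom X Y} (h : f.base = g.base)
    (h' : Arr.mk f.fiber = Arr.mk g.fiber) : f = g := by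
  obtain ⟨f, φ⟩ := f
  obtain ⟨g, ψ⟩ := g
  dsimp at h h'
  subst h
  rw [Arr.inj h']

instance : CategoryStruct (GrothOp D) where
  Hom := Hom
  id X := ⟨𝟙 X.base, eqToHom (pull_id_obj D X.base X.fiber)⟩
  comp {_ _ Z} f g := ⟨f.base ≫ g.base,
    f.fiber ≫ (pull D f.base).map g.fiber ≫ eqToHom (pull_comp_obj D f.base g.base Z.fiber)⟩

theorem arr_comp {X Y Z : GrothOp D} (f : X ⟶ Y) (g : Y ⟶ Z) :
    Arr.mk (f ≫ g).fiber = Arr.mk (f.fiber ≫ (pull D f.base).map g.fiber) :=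
  Arr.comp rfl (Arr.comp_eqToHom _ _)

/-- 2-cells `(α, φ) : (f, u) ⟶ (g, v)` of `∫_C D`, where `φ : α^* y ∘ u ⇒ v`. -/
structure Hom₂ {X Y : GrothOp D} (f g : X ⟶ Y) where
  base : f.base ⟶ g.base
  fiber : f.fiber ≫ pullCell D base Y.fiber ⟶ g.fiber

theorem Hom₂.eq_of_cell {X Y : GrothOp D} {f g : X ⟶ Y} {η θ : Hom₂ f g}
    (h : η.base = θ.base) (h' : Cell.mk η.fiber = Cell.mk θ.fiber) : η = θ := by
  obtain ⟨η, φ⟩ := η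
  obtain ⟨θ, ψ⟩ := θ
  dsimp at h h'
  subst h
  rw [Cell.inj h']

theorem Hom₂.hext {X Y : GrothOp D} {f g f' g' : X ⟶ Y} (hf : f = f') (hg : g = g')
    {η : Hom₂ f g} {θ : Hom₂ f' g'} (h : η.base ≍ θ.base)
    (h' : Cell.mk η.fiber = Cell.mk θ.fiber) : η ≍ θ := by
  subst hf hg
  exact heq_of_eq (Hom₂.eq_of_cell (eq_of_heq h) h')

theorem id₂_eq {X Y : GrothOp D} (f : X ⟶ Y) :
    f.fiber ≫ pullCell D (𝟙 f.base) Y.fiber = f.fiber := by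
  rw [pullCell_id, Strict.comp_id]

/-- The identity 2-cell `(1_f, 1_u)`. -/
def id₂ {X Y : GrothOp D} (f : X ⟶ Y) : Hom₂ f f :=
  ⟨𝟙 f.base, eqToHom (id₂_eq f)⟩

/-- The vertical composite `(β · α, ψ · (1_{β^* y} ∘ φ))`. -/
def vcomp {X Y : GrothOp D} {f g h : X ⟶ Y} (η : Hom₂ f g) (θ : Hom₂ g h) : Hom₂ f h :=
  ⟨η.base ≫ θ.base, eqToHom (by rw [pullCell_comp, Strict.assoc]) ≫
    η.fiber ▷ pullCell D θ.base Y.fiber ≫ θ.fiber⟩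

theorem cell_id₂ {X Y : GrothOp D} (f : X ⟶ Y) : Cell.mk (id₂ f).fiber = Cell.mk (𝟙 f.fiber) :=
  (Cell.eqToHom (id₂_eq f)).trans (Cell.id (congrArg _ (id₂_eq f)))

theorem cell_vcomp {X Y : GrothOp D} {f g h : X ⟶ Y} (η : Hom₂ f g) (θ : Hom₂ g h) :
    Cell.mk (vcomp η θ).fiber = Cell.mk (η.fiber ▷ pullCell D θ.base Y.fiber ≫ θ.fiber) :=
  Cell.eqToHom_comp _ _

instance homCategory (X Y : GrothOp D) : Category (X ⟶ Y) where
  Hom f g := Hom₂ f g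
  id f := id₂ f
  comp η θ := vcomp η θ
  id_comp {f g} η := by
    refine Hom₂.eq_of_cell (Category.id_comp _) ((cell_vcomp _ _).trans ?_)
    change Cell.mk (eqToHom (id₂_eq f) ▷ _ ≫ _) = _
    rw [eqToHom_whiskerRight]
    exact Cell.eqToHom_comp _ _
  comp_id {f g} η := by
    refine Hom₂.eq_of_cell (Category.comp_id _) ((cell_vcomp _ _).trans ?_)
    refine (Cell.comp_eqToHom _ (id₂_eq g)).trans ?_
    refine (Cell.right rfl (congrArg _ (pullCell_id D g.base Y.fiber))).trans ?_
    exact Cell.right_eqToHom rfl _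
  assoc η θ κ := by
    refine Hom₂.eq_of_cell (Category.assoc _ _ _) ((cell_vcomp _ _).trans ?_)
    refine Eq.trans ?_ (cell_vcomp _ _).symm
    refine Eq.trans ?_ (Cell.vcomp ((Cell.right rfl
      (congrArg _ (pullCell_comp D θ.base κ.base Y.fiber))).trans
        (Cell.right_comp _ _ _)) (cell_vcomp θ κ)).symm
    rw [← Category.assoc, ← comp_whiskerRight]
    exact Cell.vcomp (Cell.right (cell_vcomp η θ) rfl) rfl

theorem id_comp' [Strict C] {X Y : GrothOp D} (f : X ⟶ Y) : 𝟙 X ≫ f = f := by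
  refine Hom.hext (Strict.id_comp _) ((arr_comp _ _).trans ?_)
  exact (Arr.eqToHom_comp (pull_id_obj D X.base X.fiber) _).trans (pull_id_map D _)

theorem comp_id' [Strict C] {X Y : GrothOp D} (f : X ⟶ Y) : f ≫ 𝟙 Y = f := by
  refine Hom.hext (Strict.comp_id _) ((arr_comp _ _).trans ?_)
  refine (Arr.comp rfl (congrArg _ (map_eqToHom _ (pull_id_obj D Y.base Y.fiber)))).trans ?_
  exact Arr.comp_eqToHom _ _

theorem assoc' [Strict C] {X Y Z W : GrothOp D} (f : X ⟶ Y) (g : Y ⟶ Z) (h : Z ⟶ W) :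
    (f ≫ g) ≫ h = f ≫ g ≫ h := by
  refine Hom.hext (Strict.assoc _ _ _) ((arr_comp _ _).trans ?_)
  refine Eq.trans ?_ (arr_comp _ _).symm
  refine Eq.trans ?_ (Arr.comp rfl ((Arr.map rfl (arr_comp g h)).trans (Arr.map_comp _ _ _))).symm
  refine Eq.trans ?_ (Arr.assoc _ _ _)
  exact Arr.comp (arr_comp f g) (pull_comp_map D _ _ _)

theorem whiskerLeft_eq {X Y Z : GrothOp D} (f : X ⟶ Y) {g h : Y ⟶ Z} (η : Hom₂ g h) :
    (f ≫ g).fiber ≫ pullCell D (f.base ◁ η.base) Z.fiber =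
    f.fiber ≫ (pull D f.base).map (g.fiber ≫ pullCell D η.base Z.fiber) ≫
      eqToHom (pull_comp_obj D f.base h.base Z.fiber) := by
  apply Arr.inj
  refine Eq.trans ?_ (Arr.comp rfl ((Arr.comp_eqToHom _ _).trans (Arr.map_comp _ _ _))).symm
  refine Eq.trans ?_ (Arr.assoc _ _ _)
  exact Arr.comp (arr_comp f g) (pullCell_left D _ _ _)

/-- Whiskering `(α, φ) ∘ 1_{(f, u)}`. -/
def whiskerL {X Y Z : GrothOp D} (f : X ⟶ Y) {g h : Y ⟶ Z} (η : Hom₂ g h) :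
    Hom₂ (f ≫ g) (f ≫ h) :=
  ⟨f.base ◁ η.base, eqToHom (whiskerLeft_eq f η) ≫
    f.fiber ◁ (pull D f.base).map₂ η.fiber ▷ eqToHom (pull_comp_obj D f.base h.base Z.fiber)⟩

theorem cell_whiskerL {X Y Z : GrothOp D} (f : X ⟶ Y) {g h : Y ⟶ Z} (η : Hom₂ g h) :
    Cell.mk (whiskerL f η).fiber = Cell.mk (f.fiber ◁ (pull D f.base).map₂ η.fiber) :=
  (Cell.eqToHom_comp _ _).trans (Cell.left rfl (Cell.right_eqToHom _ _))

theorem whiskerRight_eq {X Y Z : GrothOp D} {f g : X ⟶ Y} (η : Hom₂ f g) (h : Y ⟶ Z) :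
    (f ≫ h).fiber ≫ pullCell D (η.base ▷ h.base) Z.fiber =
    (f.fiber ≫ pullCell D η.base Y.fiber) ≫ (pull D g.base).map h.fiber ≫
      eqToHom (pull_comp_obj D g.base h.base Z.fiber) := by
  apply Arr.inj
  refine Eq.trans ?_ (Arr.comp rfl (Arr.comp_eqToHom _ _)).symm
  refine Eq.trans ?_ (Arr.assoc _ _ _).symm
  refine Eq.trans ?_ (Arr.comp rfl (Arr.naturality (D.map₂ (op2 η.base)).toNatTrans h.fiber))
  refine Eq.trans ?_ (Arr.assoc _ _ _)
  exact Arr.comp (arr_comp f h) (pullCell_right D _ _ _)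

/-- Whiskering `1_{(h, v)} ∘ (α, φ)`. -/
def whiskerR {X Y Z : GrothOp D} {f g : X ⟶ Y} (η : Hom₂ f g) (h : Y ⟶ Z) :
    Hom₂ (f ≫ h) (g ≫ h) :=
  ⟨η.base ▷ h.base, eqToHom (whiskerRight_eq η h) ≫
    η.fiber ▷ ((pull D g.base).map h.fiber ≫
      eqToHom (pull_comp_obj D g.base h.base Z.fiber))⟩

theorem cell_whiskerR {X Y Z : GrothOp D} {f g : X ⟶ Y} (η : Hom₂ f g) (h : Y ⟶ Z) :
    Cell.mk (whiskerR η h).fiber = Cell.mk (η.fiber ▷ (pull D g.base).map h.fiber) :=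
  (Cell.eqToHom_comp _ _).trans (Cell.right rfl (Arr.comp_eqToHom _ _))

/-- The 2-category structure of `∫_C D`. -/
@[reducible] def core [Strict C] : StrictCore (GrothOp D) where
  homCategory := homCategory
  id_comp := id_comp'
  comp_id := comp_id'
  assoc := assoc'
  whiskerLeft f _ _ η := whiskerL f η
  whiskerRight η h := whiskerR η h
  whiskerLeft_id f g := by
    refine Hom₂.eq_of_cell (whiskerLeft_id _ _) ((cell_whiskerL _ _).trans ?_)
    refine (Cell.left rfl ((Cell.map rfl (cell_id₂ g)).trans
      (congrArg _ ((pull D f.base).map₂_id _)))).trans ?_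
    rw [whiskerLeft_id]
    exact (Cell.id (arr_comp f g).symm).trans (cell_id₂ _).symm
  whiskerLeft_comp {X Y Z} f g h i η θ := by
    refine Hom₂.eq_of_cell (whiskerLeft_comp _ _ _) ((cell_whiskerL _ _).trans ?_)
    refine Eq.trans ?_ (cell_vcomp _ _).symm
    refine (Cell.left rfl ((Cell.map rfl (cell_vcomp η θ)).trans (Cell.map_comp _ _ _))).trans ?_
    rw [whiskerLeft_comp]
    refine Cell.vcomp ?_ (cell_whiskerL f θ).symm
    refine (Cell.left rfl (Cell.map_right _ _ _)).trans ?_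
    refine (Cell.left_right _ _ _).symm.trans ?_
    exact Cell.right (cell_whiskerL f η).symm (pullCell_left D _ _ _).symm
  id_whiskerRight f g := by
    refine Hom₂.eq_of_cell (id_whiskerRight _ _) ((cell_whiskerR _ _).trans ?_)
    refine (Cell.right (cell_id₂ f) rfl).trans ?_
    rw [id_whiskerRight]
    exact (Cell.id (arr_comp f g).symm).trans (cell_id₂ _).symm
  comp_whiskerRight {X Y Z} f g h η θ i := by
    refine Hom₂.eq_of_cell (comp_whiskerRight _ _ _) ((cell_whiskerR _ _).trans ?_)
    refine Eq.trans ?_ (cell_vcomp _ _).symm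
    refine (Cell.right (cell_vcomp η θ) rfl).trans ?_
    rw [comp_whiskerRight]
    refine Cell.vcomp ?_ (cell_whiskerR θ i).symm
    refine (Cell.right_comp _ _ _).symm.trans ?_
    refine (Cell.right rfl (Arr.naturality (D.map₂ (op2 θ.base)).toNatTrans i.fiber).symm).trans ?_
    refine (Cell.right_comp _ _ _).trans ?_
    exact Cell.right (cell_whiskerR η i).symm (pullCell_right D _ _ _).symm
  whisker_exchange {X Y Z f g h i} η θ := by
    refine Hom₂.eq_of_cell (whisker_exchange _ _) ((cell_vcomp _ _).trans ?_)
    refine Eq.trans ?_ (cell_vcomp _ _).symm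
    have h₁ : Cell.mk ((f.fiber ≫ pullCell D η.base Y.fiber) ◁ (pull D g.base).map₂ θ.fiber) =
        Cell.mk ((whiskerL f θ).fiber ▷ pullCell D (η.base ▷ i.base) Z.fiber) := by
      refine (Cell.comp_left _ _ _).trans ?_
      refine (Cell.left rfl
        (Cell.naturality (D.map₂ (op2 η.base)).toNatTrans θ.fiber).symm).trans ?_
      refine (Cell.left_right _ _ _).symm.trans ?_
      exact Cell.right (cell_whiskerL f θ).symm (pullCell_right D _ _ _).symm
    have h₂ : Cell.mk (η.fiber ▷ (pull D g.base).map (h.fiber ≫ pullCell D θ.base Z.fiber)) =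
        Cell.mk ((whiskerR η h).fiber ▷ pullCell D (g.base ◁ θ.base) Z.fiber) := by
      refine (Cell.right rfl (Arr.map_comp _ _ _)).trans ?_
      refine (Cell.right_comp _ _ _).trans ?_
      exact Cell.right (cell_whiskerR η h).symm (pullCell_left D _ _ _).symm
    refine (Cell.vcomp h₁.symm (cell_whiskerR η i)).trans ?_
    refine Eq.trans ?_ (Cell.vcomp h₂ (cell_whiskerL g θ).symm)
    exact congrArg _ (whisker_exchange _ _)
  id_whiskerLeft η := by
    refine Hom₂.hext (id_comp' _) (id_comp' _) (id_whiskerLeft_heq _) ((cell_whiskerL _ _).trans ?_)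
    refine (Cell.eqToHom_left (pull_id_obj D _ _) _).trans ?_
    exact pull_id_map₂ D _
  whiskerRight_id η := by
    refine Hom₂.hext (comp_id' _) (comp_id' _) (whiskerRight_id_heq _) ((cell_whiskerR _ _).trans ?_)
    refine (Cell.right rfl (congrArg _ (map_eqToHom _ (pull_id_obj D _ _)))).trans ?_
    exact Cell.right_eqToHom _ _
  comp_whiskerLeft f g h h' η := by
    refine Hom₂.hext (assoc' _ _ _) (assoc' _ _ _) (comp_whiskerLeft_heq _ _ _)
      ((cell_whiskerL _ _).trans ?_)
    refine Eq.trans ?_ (cell_whiskerL _ _).symm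
    refine (Cell.left (arr_comp f g) (pull_comp_map₂ D _ _ _)).trans ?_
    refine (Cell.comp_left _ _ _).trans ?_
    exact Cell.left rfl ((Cell.map_left _ _ _).symm.trans (Cell.map rfl (cell_whiskerL g η).symm))
  whiskerRight_comp η g h := by
    refine Hom₂.hext (assoc' _ _ _).symm (assoc' _ _ _).symm (whiskerRight_comp_heq _ _ _)
      ((cell_whiskerR _ _).trans ?_)
    refine Eq.trans ?_ (cell_whiskerR _ _).symm
    refine (Cell.right rfl ((Arr.map rfl (arr_comp g h)).trans (Arr.map_comp _ _ _))).trans ?_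
    refine (Cell.right_comp _ _ _).trans ?_
    exact Cell.right (cell_whiskerR η g).symm (pull_comp_map D _ _ _).symm
  whisker_assoc f g g' η h := by
    refine Hom₂.hext (assoc' _ _ _) (assoc' _ _ _) (whisker_assoc_heq _ _ _)
      ((cell_whiskerR _ _).trans ?_)
    refine Eq.trans ?_ (cell_whiskerL _ _).symm
    refine (Cell.right (cell_whiskerL f η) (pull_comp_map D _ _ _)).trans ?_
    refine (Cell.left_right _ _ _).trans ?_
    exact Cell.left rfl ((Cell.map_right _ _ _).symm.trans (Cell.map rfl (cell_whiskerR η h).symm))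

instance [Strict C] : Bicategory (GrothOp D) := core.toBicategory
instance [Strict C] : Strict (GrothOp D) := core.strict

variable {E : StrictPseudofunctor Cᵒᵖ TwoCat.{w, v, u}}

/-- The component `Γ_c : D_c ⟶ E_c`, as a 2-functor. -/
abbrev component (Γ : TwoNatTrans D E) (c : C) : StrictPseudofunctor (D.obj (op c)) (E.obj (op c)) :=
  (Γ.app (op c)).toFunctor

theorem naturality_functor (Γ : TwoNatTrans D E) {a b : C} (f : a ⟶ b) :
    (pull D f).comp (component Γ a) = (component Γ b).comp (pull E f) :=
  congrArg TwoCat.Hom.toFunctor (Γ.naturality f.op)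

theorem naturality_obj (Γ : TwoNatTrans D E) {a b : C} (f : a ⟶ b) (y : D.obj (op b)) :
    (component Γ a).obj ((pull D f).obj y) = (pull E f).obj ((component Γ b).obj y) :=
  congrArg (fun F => F.obj y) (naturality_functor Γ f)

theorem naturality_map (Γ : TwoNatTrans D E) {a b : C} (f : a ⟶ b) {x y : D.obj (op b)}
    (u : x ⟶ y) :
    Arr.mk ((component Γ a).map ((pull D f).map u)) = Arr.mk ((pull E f).map ((component Γ b).map u)) :=
  Arr.map (naturality_functor Γ f) (f := u) rfl

theorem naturality_map₂ (Γ : TwoNatTrans D E) {a b : C} (f : a ⟶ b) {x y : D.obj (op b)}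
    {u v : x ⟶ y} (φ : u ⟶ v) : Cell.mk ((component Γ a).map₂ ((pull D f).map₂ φ)) =
      Cell.mk ((pull E f).map₂ ((component Γ b).map₂ φ)) :=
  Cell.map (naturality_functor Γ f) (η := φ) rfl

theorem naturality_pullCell (Γ : TwoNatTrans D E) {a b : C} {f g : a ⟶ b} (α : f ⟶ g)
    (y : D.obj (op b)) : Arr.mk ((component Γ a).map (pullCell D α y)) =
      Arr.mk (pullCell E α ((component Γ b).obj y)) :=
  TwoCat.app_congr (Γ.naturality f.op) (Γ.naturality g.op) (Γ.naturality₂_heq (op2 α)) y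

/-- The action of `∫_C Γ` on objects. -/
def mapObj (Γ : TwoNatTrans D E) (X : GrothOp D) : GrothOp E :=
  ⟨X.base, (component Γ X.base).obj X.fiber⟩

/-- The action of `∫_C Γ` on 1-cells: `(f, u) ↦ (f, Γ_a u)`. -/
def mapHom (Γ : TwoNatTrans D E) {X Y : GrothOp D} (f : X ⟶ Y) : mapObj Γ X ⟶ mapObj Γ Y :=
  ⟨f.base, (component Γ X.base).map f.fiber ≫ eqToHom (naturality_obj Γ f.base Y.fiber)⟩

theorem arr_mapHom (Γ : TwoNatTrans D E) {X Y : GrothOp D} (f : X ⟶ Y) :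
    Arr.mk (mapHom Γ f).fiber = Arr.mk ((component Γ X.base).map f.fiber) :=
  Arr.comp_eqToHom _ _

theorem mapHom₂_eq (Γ : TwoNatTrans D E) {X Y : GrothOp D} {f g : X ⟶ Y} (η : f.base ⟶ g.base) :
    (mapHom Γ f).fiber ≫ pullCell E η (mapObj Γ Y).fiber =
    (component Γ X.base).map (f.fiber ≫ pullCell D η Y.fiber) ≫
      eqToHom (naturality_obj Γ g.base Y.fiber) := by
  apply Arr.inj
  refine Eq.trans ?_ (Arr.comp_eqToHom _ _).symm
  refine Eq.trans ?_ (Arr.map_comp _ _ _).symm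
  exact Arr.comp (arr_mapHom Γ f) (naturality_pullCell Γ _ _).symm

/-- The action of `∫_C Γ` on 2-cells: `(α, φ) ↦ (α, Γ_a φ)`. -/
def mapHom₂ (Γ : TwoNatTrans D E) {X Y : GrothOp D} {f g : X ⟶ Y} (η : Hom₂ f g) :
    Hom₂ (mapHom Γ f) (mapHom Γ g) :=
  ⟨η.base, eqToHom (mapHom₂_eq Γ η.base) ≫
    (component Γ X.base).map₂ η.fiber ▷ eqToHom (naturality_obj Γ g.base Y.fiber)⟩

theorem cell_mapHom₂ (Γ : TwoNatTrans D E) {X Y : GrothOp D} {f g : X ⟶ Y} (η : Hom₂ f g) :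
    Cell.mk (mapHom₂ Γ η).fiber = Cell.mk ((component Γ X.base).map₂ η.fiber) :=
  (Cell.eqToHom_comp _ _).trans (Cell.right_eqToHom _ _)

theorem mapHom_id (Γ : TwoNatTrans D E) (X : GrothOp D) : mapHom Γ (𝟙 X) = 𝟙 (mapObj Γ X) := by
  refine Hom.hext rfl ((arr_mapHom _ _).trans ?_)
  refine (congrArg _ (map_eqToHom _ (pull_id_obj D _ _))).trans ?_
  refine Arr.eqToHom_eq _ (pull_id_obj E _ _) ?_
  exact naturality_obj Γ _ _

theorem mapHom_comp (Γ : TwoNatTrans D E) {X Y Z : GrothOp D} (f : X ⟶ Y) (g : Y ⟶ Z) :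
    mapHom Γ (f ≫ g) = mapHom Γ f ≫ mapHom Γ g := by
  refine Hom.hext rfl ((arr_mapHom _ _).trans ?_)
  refine Eq.trans ?_ (arr_comp _ _).symm
  refine (Arr.map rfl (arr_comp f g)).trans ((Arr.map_comp _ _ _).trans ?_)
  refine Arr.comp (arr_mapHom Γ f).symm ?_
  refine (naturality_map Γ _ _).trans ?_
  exact Arr.map rfl (arr_mapHom Γ g).symm

/-- The 2-functor `∫_C Γ : ∫_C D ⟶ ∫_C E`. -/
def map [Strict C] (Γ : TwoNatTrans D E) : StrictPseudofunctor (GrothOp D) (GrothOp E) :=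
  StrictPseudofunctor.mk''
    { obj := mapObj Γ
      map := mapHom Γ
      map₂ := mapHom₂ Γ
      map₂_id := fun {X Y} f => by
        refine Hom₂.eq_of_cell rfl ((cell_mapHom₂ _ _).trans ?_)
        refine (Cell.map rfl (cell_id₂ f)).trans ?_
        refine (congrArg _ ((component Γ X.base).map₂_id _)).trans ?_
        exact (Cell.id (arr_mapHom Γ f).symm).trans (cell_id₂ _).symm
      map₂_comp := fun {X Y f g h} η θ => by
        refine Hom₂.eq_of_cell rfl ((cell_mapHom₂ _ _).trans ?_)
        refine Eq.trans ?_ (cell_vcomp _ _).symm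
        refine (Cell.map rfl (cell_vcomp η θ)).trans ((Cell.map_comp _ _ _).trans ?_)
        refine Cell.vcomp ?_ (cell_mapHom₂ Γ θ).symm
        refine (Cell.map_right _ _ _).trans ?_
        exact Cell.right (cell_mapHom₂ Γ η).symm (naturality_pullCell Γ _ _)
      map_id := mapHom_id Γ
      map_comp := mapHom_comp Γ
      map₂_whisker_left := fun {X Y Z} f {g g'} η => by
        refine eq_of_heq (HEq.trans ?_ ((eqToHom_comp_heq _ _).trans (comp_eqToHom_heq _ _)).symm)
        refine Hom₂.hext (mapHom_comp Γ f g) (mapHom_comp Γ f g') HEq.rfl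
          ((cell_mapHom₂ _ _).trans ?_)
        refine Eq.trans ?_ (cell_whiskerL _ _).symm
        refine (Cell.map rfl (cell_whiskerL f η)).trans ((Cell.map_left _ _ _).trans ?_)
        exact Cell.left (arr_mapHom Γ f).symm
          ((naturality_map₂ Γ _ _).trans (Cell.map rfl (cell_mapHom₂ Γ η).symm))
      map₂_whisker_right := fun {X Y Z f f'} η g => by
        refine eq_of_heq (HEq.trans ?_ ((eqToHom_comp_heq _ _).trans (comp_eqToHom_heq _ _)).symm)
        refine Hom₂.hext (mapHom_comp Γ f g) (mapHom_comp Γ f' g) HEq.rfl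
          ((cell_mapHom₂ _ _).trans ?_)
        refine Eq.trans ?_ (cell_whiskerR _ _).symm
        refine (Cell.map rfl (cell_whiskerR η g)).trans ((Cell.map_right _ _ _).trans ?_)
        exact Cell.right (cell_mapHom₂ Γ η).symm
          ((naturality_map Γ _ _).trans (Arr.map rfl (arr_mapHom Γ g).symm)) }

end GrothOp
end GrothendieckOp

/-! ### Homotopy-fibre 2-categories -/

section Fibres
variable {A : Type u₁} [Bicategory.{w₁, v₁} A] [Strict A]
  {C : Type u₂} [Bicategory.{w₂, v₂} C] [Strict C]

/-- Objects of the homotopy-fibre 2-category `F ↓ c`: pairs `(a, p : F a ⟶ c)`. -/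
structure OverFibre (F : StrictPseudofunctor A C) (c : C) where
  base : A
  hom : F.obj base ⟶ c

namespace OverFibre
variable {F : StrictPseudofunctor A C} {c : C}

/-- 1-cells `(u, φ) : (a, p) ⟶ (a', p')` of `F ↓ c`, where `φ : p ⇒ p' ∘ F u`. -/
structure Hom (X Y : OverFibre F c) where
  base : X.base ⟶ Y.base
  cell : X.hom ⟶ F.map base ≫ Y.hom

theorem Hom.hext {X Y : OverFibre F c} {f g : Hom X Y} (h : f.base = g.base)
    (h' : f.cell ≍ g.cell) : f = g := by
  obtain ⟨f, φ⟩ := f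
  obtain ⟨g, ψ⟩ := g
  dsimp at h h'
  subst h
  cases h'
  rfl

instance : CategoryStruct (OverFibre F c) where
  Hom := Hom
  id X := ⟨𝟙 X.base, eqToHom (by rw [F.map_id, Strict.id_comp])⟩
  comp {_ _ Z} f g := ⟨f.base ≫ g.base,
    f.cell ≫ F.map f.base ◁ g.cell ≫
      eqToHom (by rw [F.map_comp, Strict.assoc] : _ = F.map (f.base ≫ g.base) ≫ Z.hom)⟩

/-- 2-cells `α : (u, φ) ⇒ (u', φ')` of `F ↓ c`: those 2-cells `α : u ⇒ u'` of `A` for which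
`(1_{p'} ∘ F α) · φ = φ'`. -/
structure Hom₂ {X Y : OverFibre F c} (f g : X ⟶ Y) where
  cell : f.base ⟶ g.base
  w : f.cell ≫ F.map₂ cell ▷ Y.hom = g.cell

theorem Hom₂.eq_of_cell {X Y : OverFibre F c} {f g : X ⟶ Y} {η θ : Hom₂ f g}
    (h : η.cell = θ.cell) : η = θ := by
  cases η; cases θ; cases h; rfl

theorem Hom₂.hext {X Y : OverFibre F c} {f g f' g' : X ⟶ Y} (hf : f = f') (hg : g = g')
    {η : Hom₂ f g} {θ : Hom₂ f' g'} (h : η.cell ≍ θ.cell) : η ≍ θ := by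
  subst hf hg
  exact heq_of_eq (Hom₂.eq_of_cell (eq_of_heq h))

instance homCategory (X Y : OverFibre F c) : Category (X ⟶ Y) where
  Hom f g := Hom₂ f g
  id f := ⟨𝟙 f.base, by simp⟩
  comp η θ := ⟨η.cell ≫ θ.cell, by simp [← θ.w, ← η.w]⟩
  id_comp _ := Hom₂.eq_of_cell (Category.id_comp _)
  comp_id _ := Hom₂.eq_of_cell (Category.comp_id _)
  assoc _ _ _ := Hom₂.eq_of_cell (Category.assoc _ _ _)

theorem id_comp' {X Y : OverFibre F c} (f : X ⟶ Y) : 𝟙 X ≫ f = f := by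
  refine Hom.hext (Strict.id_comp f.base) ?_
  change eqToHom (by rw [F.map_id, Strict.id_comp]) ≫ F.map (𝟙 X.base) ◁ f.cell ≫ eqToHom _ ≍ f.cell
  rw [eqToHom_comp_heq_iff, comp_eqToHom_heq_iff]
  refine (whiskerLeft_hcongr rfl rfl rfl (heq_of_eq (F.map_id _)) HEq.rfl HEq.rfl HEq.rfl).trans ?_
  exact id_whiskerLeft_heq _

theorem comp_id' {X Y : OverFibre F c} (f : X ⟶ Y) : f ≫ 𝟙 Y = f := by
  refine Hom.hext (Strict.comp_id f.base) ?_
  change f.cell ≫ F.map f.base ◁ eqToHom (by rw [F.map_id, Strict.id_comp] :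
    Y.hom = F.map (𝟙 Y.base) ≫ Y.hom) ≫ eqToHom _ ≍ f.cell
  simp

theorem assoc' {X Y Z W : OverFibre F c} (f : X ⟶ Y) (g : Y ⟶ Z) (h : Z ⟶ W) :
    (f ≫ g) ≫ h = f ≫ g ≫ h := by
  refine Hom.hext (Strict.assoc f.base g.base h.base) ?_
  change (f.cell ≫ F.map f.base ◁ g.cell ≫ eqToHom _) ≫ F.map (f.base ≫ g.base) ◁ h.cell ≫
    eqToHom _ ≍ f.cell ≫ F.map f.base ◁ (g.cell ≫ F.map g.base ◁ h.cell ≫ eqToHom _) ≫ eqToHom _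
  rw [congr_whiskerLeft (F.map_comp f.base g.base)]
  simp only [Category.assoc, eqToHom_trans_assoc, whiskerLeft_comp, comp_whiskerLeft,
    Strict.associator_eqToIso, eqToIso.hom, eqToIso.inv, whiskerLeft_eqToHom, eqToHom_refl,
    Category.id_comp, eqToHom_trans]
  simp only [← Category.assoc]
  exact (comp_eqToHom_heq _ _).trans (comp_eqToHom_heq _ _).symm

/-- The 2-category structure of `F ↓ c`. -/
@[reducible] def core : StrictCore (OverFibre F c) where
  homCategory := homCategory
  id_comp := id_comp'
  comp_id := comp_id'
  assoc := assoc'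
  whiskerLeft {X Y Z} f {g h} η := ⟨f.base ◁ η.cell, by
    change (f.cell ≫ F.map f.base ◁ g.cell ≫ eqToHom _) ≫ F.map₂ (f.base ◁ η.cell) ▷ Z.hom =
      f.cell ≫ F.map f.base ◁ h.cell ≫ eqToHom _
    rw [← η.w]
    simp [F.map₂_whisker_left, F.mapComp_eq_eqToIso, Strict.associator_eqToIso]⟩
  whiskerRight {X Y Z} {f g} η h := ⟨η.cell ▷ h.base, by
    change (f.cell ≫ F.map f.base ◁ h.cell ≫ eqToHom _) ≫ F.map₂ (η.cell ▷ h.base) ▷ Z.hom =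
      g.cell ≫ F.map g.base ◁ h.cell ≫ eqToHom _
    rw [← η.w]
    have := whisker_exchange (F.map₂ η.cell) h.cell
    rw [Category.assoc f.cell (_ ▷ _), ← reassoc_of% this]
    simp [F.map₂_whisker_right, F.mapComp_eq_eqToIso, Strict.associator_eqToIso]⟩
  whiskerLeft_id _ _ := Hom₂.eq_of_cell (whiskerLeft_id _ _)
  whiskerLeft_comp _ _ _ _ _ _ := Hom₂.eq_of_cell (whiskerLeft_comp _ _ _)
  id_whiskerRight _ _ := Hom₂.eq_of_cell (id_whiskerRight _ _)
  comp_whiskerRight _ _ _ := Hom₂.eq_of_cell (comp_whiskerRight _ _ _)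
  whisker_exchange _ _ := Hom₂.eq_of_cell (whisker_exchange _ _)
  id_whiskerLeft _ := Hom₂.hext (id_comp' _) (id_comp' _) (id_whiskerLeft_heq _)
  whiskerRight_id _ := Hom₂.hext (comp_id' _) (comp_id' _) (whiskerRight_id_heq _)
  comp_whiskerLeft _ _ _ _ _ := Hom₂.hext (assoc' _ _ _) (assoc' _ _ _) (comp_whiskerLeft_heq _ _ _)
  whiskerRight_comp _ _ _ := Hom₂.hext (assoc' _ _ _).symm (assoc' _ _ _).symm
    (whiskerRight_comp_heq _ _ _)
  whisker_assoc _ _ _ _ _ := Hom₂.hext (assoc' _ _ _) (assoc' _ _ _) (whisker_assoc_heq _ _ _)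

instance : Bicategory (OverFibre F c) := core.toBicategory
instance : Strict (OverFibre F c) := core.strict

end OverFibre

/-- Objects of the homotopy-fibre 2-category `c ↓ F`: pairs `(a, p : c ⟶ F a)`. -/
structure UnderFibre (c : C) (F : StrictPseudofunctor A C) where
  base : A
  hom : c ⟶ F.obj base

namespace UnderFibre
variable {F : StrictPseudofunctor A C} {c : C}

/-- 1-cells `(u, φ) : (a, p) ⟶ (a', p')` of `c ↓ F`, where `φ : F u ∘ p ⇒ p'`. -/
structure Hom (X Y : UnderFibre c F) where
  base : X.base ⟶ Y.base
  cell : X.hom ≫ F.map base ⟶ Y.hom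

theorem Hom.hext {X Y : UnderFibre c F} {f g : Hom X Y} (h : f.base = g.base)
    (h' : f.cell ≍ g.cell) : f = g := by
  obtain ⟨f, φ⟩ := f
  obtain ⟨g, ψ⟩ := g
  dsimp at h h'
  subst h
  cases h'
  rfl

instance : CategoryStruct (UnderFibre c F) where
  Hom := Hom
  id X := ⟨𝟙 X.base, eqToHom (by rw [F.map_id, Strict.comp_id])⟩
  comp {X _ _} f g := ⟨f.base ≫ g.base,
    eqToHom (by rw [F.map_comp, Strict.assoc] : X.hom ≫ F.map (f.base ≫ g.base) = _) ≫
      f.cell ▷ F.map g.base ≫ g.cell⟩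

/-- 2-cells `α : (u, φ) ⇒ (u', φ')` of `c ↓ F`: those 2-cells `α : u ⇒ u'` of `A` for which
`φ' · (F α ∘ 1_p) = φ`. -/
structure Hom₂ {X Y : UnderFibre c F} (f g : X ⟶ Y) where
  cell : f.base ⟶ g.base
  w : X.hom ◁ F.map₂ cell ≫ g.cell = f.cell

theorem Hom₂.eq_of_cell {X Y : UnderFibre c F} {f g : X ⟶ Y} {η θ : Hom₂ f g}
    (h : η.cell = θ.cell) : η = θ := by
  cases η; cases θ; cases h; rfl

theorem Hom₂.hext {X Y : UnderFibre c F} {f g f' g' : X ⟶ Y} (hf : f = f') (hg : g = g')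
    {η : Hom₂ f g} {θ : Hom₂ f' g'} (h : η.cell ≍ θ.cell) : η ≍ θ := by
  subst hf hg
  exact heq_of_eq (Hom₂.eq_of_cell (eq_of_heq h))

instance homCategory (X Y : UnderFibre c F) : Category (X ⟶ Y) where
  Hom f g := Hom₂ f g
  id f := ⟨𝟙 f.base, by simp⟩
  comp η θ := ⟨η.cell ≫ θ.cell, by simp [θ.w, η.w]⟩
  id_comp _ := Hom₂.eq_of_cell (Category.id_comp _)
  comp_id _ := Hom₂.eq_of_cell (Category.comp_id _)
  assoc _ _ _ := Hom₂.eq_of_cell (Category.assoc _ _ _)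

theorem id_comp' {X Y : UnderFibre c F} (f : X ⟶ Y) : 𝟙 X ≫ f = f := by
  refine Hom.hext (Strict.id_comp f.base) ?_
  change eqToHom _ ≫ eqToHom (by rw [F.map_id, Strict.comp_id] :
    X.hom ≫ F.map (𝟙 X.base) = X.hom) ▷ F.map f.base ≫ f.cell ≍ f.cell
  simp

theorem comp_id' {X Y : UnderFibre c F} (f : X ⟶ Y) : f ≫ 𝟙 Y = f := by
  refine Hom.hext (Strict.comp_id f.base) ?_
  change eqToHom _ ≫ f.cell ▷ F.map (𝟙 Y.base) ≫ eqToHom (by rw [F.map_id, Strict.comp_id]) ≍ f.cell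
  rw [eqToHom_comp_heq_iff, comp_eqToHom_heq_iff]
  refine (whiskerRight_hcongr rfl rfl rfl HEq.rfl HEq.rfl HEq.rfl (heq_of_eq (F.map_id _))).trans ?_
  exact whiskerRight_id_heq _

theorem assoc' {X Y Z W : UnderFibre c F} (f : X ⟶ Y) (g : Y ⟶ Z) (h : Z ⟶ W) :
    (f ≫ g) ≫ h = f ≫ g ≫ h := by
  refine Hom.hext (Strict.assoc f.base g.base h.base) ?_
  change eqToHom _ ≫ (eqToHom _ ≫ f.cell ▷ F.map g.base ≫ g.cell) ▷ F.map h.base ≫ h.cell ≍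
    eqToHom _ ≫ f.cell ▷ F.map (g.base ≫ h.base) ≫ eqToHom _ ≫ g.cell ▷ F.map h.base ≫ h.cell
  rw [whiskerRight_congr (F.map_comp g.base h.base)]
  simp [Strict.associator_eqToIso]

/-- The 2-category structure of `c ↓ F`. -/
@[reducible] def core : StrictCore (UnderFibre c F) where
  homCategory := homCategory
  id_comp := id_comp'
  comp_id := comp_id'
  assoc := assoc'
  whiskerLeft {X Y Z} f {g h} η := ⟨f.base ◁ η.cell, by
    change X.hom ◁ F.map₂ (f.base ◁ η.cell) ≫ eqToHom _ ≫ f.cell ▷ F.map h.base ≫ h.cell =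
      eqToHom _ ≫ f.cell ▷ F.map g.base ≫ g.cell
    rw [← η.w]
    have := whisker_exchange f.cell (F.map₂ η.cell)
    rw [← reassoc_of% this]
    simp [F.map₂_whisker_left, F.mapComp_eq_eqToIso, Strict.associator_eqToIso]⟩
  whiskerRight {X Y Z} {f g} η h := ⟨η.cell ▷ h.base, by
    change X.hom ◁ F.map₂ (η.cell ▷ h.base) ≫ eqToHom _ ≫ g.cell ▷ F.map h.base ≫ h.cell =
      eqToHom _ ≫ f.cell ▷ F.map h.base ≫ h.cell
    rw [← η.w]
    simp [F.map₂_whisker_right, F.mapComp_eq_eqToIso, Strict.associator_eqToIso]⟩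
  whiskerLeft_id _ _ := Hom₂.eq_of_cell (whiskerLeft_id _ _)
  whiskerLeft_comp _ _ _ _ _ _ := Hom₂.eq_of_cell (whiskerLeft_comp _ _ _)
  id_whiskerRight _ _ := Hom₂.eq_of_cell (id_whiskerRight _ _)
  comp_whiskerRight _ _ _ := Hom₂.eq_of_cell (comp_whiskerRight _ _ _)
  whisker_exchange _ _ := Hom₂.eq_of_cell (whisker_exchange _ _)
  id_whiskerLeft _ := Hom₂.hext (id_comp' _) (id_comp' _) (id_whiskerLeft_heq _)
  whiskerRight_id _ := Hom₂.hext (comp_id' _) (comp_id' _) (whiskerRight_id_heq _)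
  comp_whiskerLeft _ _ _ _ _ := Hom₂.hext (assoc' _ _ _) (assoc' _ _ _) (comp_whiskerLeft_heq _ _ _)
  whiskerRight_comp _ _ _ := Hom₂.hext (assoc' _ _ _).symm (assoc' _ _ _).symm
    (whiskerRight_comp_heq _ _ _)
  whisker_assoc _ _ _ _ _ := Hom₂.hext (assoc' _ _ _) (assoc' _ _ _) (whisker_assoc_heq _ _ _)

instance : Bicategory (UnderFibre c F) := core.toBicategory
instance : Strict (UnderFibre c F) := core.strict

end UnderFibre
end Fibres

/-! ### Classifying spaces -/

section Nerve
variable (B : Type u) [Bicategory.{w, v} B]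

/-- The objects of the category `Column B q`: the objects of the 2-category `B`. -/
structure Column (q : SimplexCategory) where
  as : B

namespace Column
variable {B}

/-- Pointwise horizontal composition. -/
@[simps]
def hcomp {J : Type} [SmallCategory J] {x y z : B} (F : J ⥤ (x ⟶ y)) (G : J ⥤ (y ⟶ z)) :
    J ⥤ (x ⟶ z) where
  obj i := F.obj i ≫ G.obj i
  map {i j} h := F.map h ▷ G.obj i ≫ F.obj j ◁ G.map h
  map_comp {i j k} h h' := by
    simp [whisker_exchange_assoc]

theorem id_hcomp [Strict B] {J : Type} [SmallCategory J] {x y : B} (F : J ⥤ (x ⟶ y)) :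
    hcomp ((Functor.const J).obj (𝟙 x)) F = F :=
  CategoryTheory.Functor.ext (fun i => Strict.id_comp (F.obj i)) fun i j h => by
    simp [Strict.leftUnitor_eqToIso]
    rfl

theorem hcomp_id [Strict B] {J : Type} [SmallCategory J] {x y : B} (F : J ⥤ (x ⟶ y)) :
    hcomp F ((Functor.const J).obj (𝟙 y)) = F :=
  CategoryTheory.Functor.ext (fun i => Strict.comp_id (F.obj i)) fun i j h => by
    simp [Strict.rightUnitor_eqToIso]
    rfl

theorem hcomp_assoc [Strict B] {J : Type} [SmallCategory J] {x y z t : B} (F : J ⥤ (x ⟶ y))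
    (G : J ⥤ (y ⟶ z)) (H : J ⥤ (z ⟶ t)) : hcomp (hcomp F G) H = hcomp F (hcomp G H) :=
  CategoryTheory.Functor.ext (fun i => Strict.assoc (F.obj i) (G.obj i) (H.obj i))
    fun i j h => by
      change (F.map h ▷ G.obj i ≫ F.obj j ◁ G.map h) ▷ H.obj i ≫
          (F.obj j ≫ G.obj j) ◁ H.map h =
        eqToHom (Strict.assoc _ _ _) ≫ (F.map h ▷ (G.obj i ≫ H.obj i) ≫
          F.obj j ◁ (G.map h ▷ H.obj i ≫ G.obj j ◁ H.map h)) ≫ eqToHom (Strict.assoc _ _ _).symm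
      simp [Strict.associator_eqToIso]

/-- Morphisms `x ⟶ y` of `Column B q` are the chains of `q` composable 2-cells in `B(x, y)`;
they are composed by horizontal composition in `B`. -/
instance [Strict B] (q : SimplexCategory) : Category (Column B q) where
  Hom x y := Fin (q.len + 1) ⥤ (x.as ⟶ y.as)
  id x := (Functor.const _).obj (𝟙 x.as)
  comp F G := hcomp F G
  id_comp F := id_hcomp F
  comp_id F := hcomp_id F
  assoc F G H := hcomp_assoc F G H

/-- Reindexing the chains of 2-cells along a map of `Δ`. -/
@[simps]
def reindex [Strict B] {q r : SimplexCategory} (θ : r ⟶ q) : Column B q ⥤ Column B r where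
  obj x := ⟨x.as⟩
  map F := θ.toOrderHom.monotone.functor ⋙ F
  map_id _ := rfl
  map_comp _ _ := rfl

end Column

variable [Strict B]

/-- The double nerve of a 2-category, `[q] ↦ ([p] ↦ N_q N_p B)`. A `q`-simplex of the nerve of
the category `N_p B = ∐ B(c₀, c₁) × ⋯ × B(c_{p-1}, c_p)` is a string of `p` composable morphisms
of `Column B q`. -/
def doubleNerve : SimplexCategoryᵒᵖ ⥤ SSet.{max u v w} where
  obj q := nerve (Column B q.unop)
  map θ := nerveMap (Column.reindex θ.unop)
  map_id _ := rfl
  map_comp _ _ := rfl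

/-- The diagonal of the double nerve. -/
def diagNerve : SSet.{max u v w} :=
  Functor.diag SimplexCategoryᵒᵖ ⋙ Functor.uncurry.obj (doubleNerve B)

/-- The classifying space of a 2-category. -/
noncomputable def classifyingSpace : TopCat.{max u v w} := SSet.toTop.obj (diagNerve B)

/-- A 2-category is weakly contractible if its classifying space is contractible. -/
def WeaklyContractible : Prop := ContractibleSpace (classifyingSpace B)

end Nerve

/-! ### Homotopy cofinality -/

section Cofinal
variable {A : Type u₁} [Bicategory.{w₁, v₁} A] [Strict A]
  {C : Type u₂} [Bicategory.{w₂, v₂} C] [Strict C]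

/-- `F` is homotopy left cofinal if all the 2-categories `F ↓ c` are weakly contractible. -/
def HomotopyLeftCofinal (F : StrictPseudofunctor A C) : Prop :=
  ∀ c : C, WeaklyContractible (OverFibre F c)

/-- `F` is homotopy right cofinal if all the 2-categories `c ↓ F` are weakly contractible. -/
def HomotopyRightCofinal (F : StrictPseudofunctor A C) : Prop :=
  ∀ c : C, WeaklyContractible (UnderFibre c F)

end Cofinal

end TwoDiag

/-! ### Points of geometric realizations -/

namespace Realization

open Opposite

/-! Every object of `∫_C E` is a pair `(c, y)`. It is therefore enough to compare, for each such
pair, the homotopy fibre of `∫_C Γ` at `(c, y)` (`TotalFibre`) with the homotopy fibre of `Γ_c` at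
`y` (`LocalFibre`), and to show that their classifying spaces are homotopy equivalent. The local
fibre turns out to be a strict retract of the total one, and a lax transformation deforms the total
fibre onto it.

Covariant case. An object of the total fibre consists of `(a, x)`, a 1-cell `f : a ⟶ c` and `u : f_*
Γ_a x ⟶ y`. As `f_* Γ_a x = Γ_c f_* x`, the pair `(f_* x, u)` is an object of the local fibre; this
is `toLocal`. The inclusion of the fibre over `c` induces `ofLocal`, and including followed by
pushing forward is the identity on the nose (`ofLocal_comp_toLocal`). The cocartesian 1-cells `(f,
1) : (a, x) ⟶ (c, f_* x)` are the components of a lax transformation `unit` from the identity to the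
other composite. Its 2-cell at a 1-cell of the total fibre is essentially the `C`-part of the
structure 2-cell of that 1-cell, which need not be invertible. The contravariant case is dual: pull
back along `f : c ⟶ a`, use cartesian 1-cells, and obtain a lax transformation `counit` towards the
identity.

It remains to see that a lax transformation `θ` from `F` to `G` induces a homotopy of classifying
spaces (`LaxNat.homotopic`). Its squares commute only up to 2-cells, so they do not directly give a
cylinder of diagonal simplices. On the threefold edgewise subdivision they do. A simplex there has
three consecutive blocks of vertices. From `F` at a vertex of the first block to `G` at a vertex of
the third, consider the paths that follow `F` up to a vertex of the middle block, cross by `θ`, and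
go on along `G`. Moving the crossing point through the middle block links these paths by the 2-cells
of `θ` into a chain of 2-cells, which is a morphism of the column category. These morphisms are
strictly natural (`LaxNat.trans`), and a strict transformation gives a simplicial homotopy
(`LaxNat.homotopy`). The subdivision is removed again by a map `split` from the realization of `X`
to that of its subdivision: restricting to the first block after splitting is homotopic to the
identity (`restrictPart_split_homotopic`), and restrictions to different blocks are simplicially
homotopic (`restrictPartsHomotopy`).

The topology rests on one device. A point `t` of a simplex is the same as a step function on `[0,
1)` whose intervals have lengths `t i`. Several monotone step functions together take values in a
chain of a product of ordinals, and the distribution of the combined function is a point of the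
simplex spanned by that chain (`ChainFamily.point`). Such formulas commute with simplicial operators
by `step_map` and are continuous by dominated convergence. A homotopy is built as a map from a
realization to a path space, glued by the adjunction defining realization, so that no realization of
a product has to be analysed. -/

/-- The topological simplex of an object of `SimplexCategory`. -/
abbrev Tsx (n : SimplexCategory) : Type := stdSimplex ℝ (Fin (n.len + 1))

section Points
variable {X Y : SSet.{u}}

/-- The characteristic map of a simplex of `X`. -/
noncomputable def charMap {n : SimplexCategory} (x : X.obj (op n)) :
    C(Tsx n, SSet.toTop.obj X) :=
  TopCat.toSSetObjEquiv _ (op n) ((sSetTopAdj.unit.app X).app (op n) x)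

/-- The point of the realization with coordinates `t` in the simplex `x`. -/
noncomputable def pt {n : SimplexCategory} (x : X.obj (op n)) (t : Tsx n) : SSet.toTop.obj X :=
  charMap x t

theorem continuous_pt {n : SimplexCategory} (x : X.obj (op n)) : Continuous (pt x) :=
  (charMap x).continuous

theorem pt_map {m n : SimplexCategory} (θ : m ⟶ n) (x : X.obj (op n)) (t : Tsx m) :
    pt (X.map θ.op x) t = pt x (stdSimplex.map θ t) := by
  have h := ConcreteCategory.congr_hom ((sSetTopAdj.unit.app X).naturality θ.op) x
  change (sSetTopAdj.unit.app X).app (op m) (X.map θ.op x) = _ at h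
  simp only [pt, charMap, h]
  rfl

theorem toTop_map_pt (f : X ⟶ Y) {n : SimplexCategory} (x : X.obj (op n)) (t : Tsx n) :
    SSet.toTop.map f (pt x t) = pt (f.app (op n) x) t := by
  have h := sSetTopAdj.unit.naturality f
  have h' := congrArg (fun k => k.app (op n) x) h
  change (sSetTopAdj.unit.app Y).app (op n) (f.app (op n) x) = _ at h'
  simp only [pt, charMap, h']
  rfl

variable {Z : Type u} [TopologicalSpace Z]

/-- A compatible family of maps on the simplices of `X` defines a map out of the realization. -/
noncomputable def desc (φ : ∀ (n : SimplexCategory), X.obj (op n) → C(Tsx n, Z))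
    (hφ : ∀ {m n : SimplexCategory} (θ : m ⟶ n) (x : X.obj (op n)) (t : Tsx m),
      φ m (X.map θ.op x) t = φ n x (stdSimplex.map θ t)) : C(SSet.toTop.obj X, Z) :=
  ((sSetTopAdj.homEquiv X (TopCat.of Z)).symm
    { app := fun n => TypeCat.ofHom fun x => (TopCat.toSSetObjEquiv (TopCat.of Z) n).symm (φ n.unop x)
      naturality := fun n m θ => by
        ext x
        apply (TopCat.toSSetObjEquiv (TopCat.of Z) m).injective
        ext t
        exact hφ θ.unop x t }).hom

theorem desc_pt (φ : ∀ (n : SimplexCategory), X.obj (op n) → C(Tsx n, Z))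
    (hφ : ∀ {m n : SimplexCategory} (θ : m ⟶ n) (x : X.obj (op n)) (t : Tsx m),
      φ m (X.map θ.op x) t = φ n x (stdSimplex.map θ t))
    {n : SimplexCategory} (x : X.obj (op n)) (t : Tsx n) : desc φ hφ (pt x t) = φ n x t := by
  have h := (sSetTopAdj.homEquiv X (TopCat.of Z)).apply_symm_apply
    { app := fun n => TypeCat.ofHom fun x => (TopCat.toSSetObjEquiv (TopCat.of Z) n).symm (φ n.unop x)
      naturality := fun n m θ => by
        ext x
        apply (TopCat.toSSetObjEquiv (TopCat.of Z) m).injective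
        ext t
        exact hφ θ.unop x t }
  rw [Adjunction.homEquiv_unit] at h
  have h' := congrArg (fun k => TopCat.toSSetObjEquiv (TopCat.of Z) (op n) (k.app (op n) x) t) h
  exact h'

/-- Under the adjunction a map out of the realization corresponds to the family of its restrictions
along characteristic maps, so the points `pt x t` detect equality. -/
theorem hom_ext {f g : C(SSet.toTop.obj X, Z)}
    (h : ∀ (n : SimplexCategory) (x : X.obj (op n)) (t : Tsx n), f (pt x t) = g (pt x t)) :
    f = g := by
  have : (TopCat.ofHom f : SSet.toTop.obj X ⟶ TopCat.of Z) = TopCat.ofHom g := by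
    apply (sSetTopAdj.homEquiv X (TopCat.of Z)).injective
    ext n x
    apply (TopCat.toSSetObjEquiv (TopCat.of Z) n).injective
    ext t
    simp only [Adjunction.homEquiv_unit]
    exact h n.unop x t
  exact congrArg TopCat.Hom.hom this

end Points

/-! ### Realizing weights supported on chains -/

section Chains
variable {ι : Type} [LinearOrder ι] [Fintype ι]

theorem map_apply {κ : Type} [Fintype κ] [DecidableEq κ] {ι : Type} [Fintype ι] (f : ι → κ)
    (t : stdSimplex ℝ ι) (k : κ) : stdSimplex.map f t k = ∑ i with f i = k, t i := by
  rw [stdSimplex.map_coe, FunOnFinite.linearMap_apply_apply]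

theorem map_injective {κ : Type} [Fintype κ] {ι : Type} [Fintype ι] {f : ι → κ}
    (hf : Function.Injective f) :
    Function.Injective (stdSimplex.map f : stdSimplex ℝ ι → stdSimplex ℝ κ) := by
  classical
  intro s t h
  ext i
  have h' := congrArg (fun w : stdSimplex ℝ κ => w (f i)) h
  have key : ∀ s : stdSimplex ℝ ι, stdSimplex.map f s (f i) = s i := by
    intro s
    rw [map_apply, Finset.sum_eq_single i]
    · intro j hj hji
      exact absurd (hf (Finset.mem_filter.mp hj).2) hji
    · simp
  simp only [key] at h'
  exact h'

/-- A family of simplices of `Y` indexed by the monotone maps into `ι` with admissible range. -/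
structure ChainFamily (ι : Type) [LinearOrder ι] (Y : SSet.{u}) where
  adm : Set ι → Prop
  adm_mono : ∀ {s s' : Set ι}, adm s' → s ⊆ s' → adm s
  simplex : ∀ {m : SimplexCategory} (g : Fin (m.len + 1) →o ι), adm (Set.range g) → Y.obj (op m)
  map_simplex : ∀ {m m' : SimplexCategory} (θ : m' ⟶ m) (g : Fin (m.len + 1) →o ι)
    (h : adm (Set.range g)) (h' : adm (Set.range (g.comp θ.toOrderHom))),
      Y.map θ.op (simplex g h) = simplex (g.comp θ.toOrderHom) h'

/-- The support of a point of a simplex. -/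
def supp {ι : Type} [Fintype ι] (w : stdSimplex ℝ ι) : Set ι := {i | w i ≠ 0}

theorem supp_map_subset {κ : Type} [Fintype κ] {ι : Type} [Fintype ι] (f : ι → κ)
    (t : stdSimplex ℝ ι) : supp (stdSimplex.map f t) ⊆ Set.range f := by
  classical
  intro k hk
  by_contra hcon
  apply hk
  rw [map_apply]
  apply Finset.sum_eq_zero
  intro i hi
  exact absurd ⟨i, (Finset.mem_filter.mp hi).2⟩ hcon

theorem supp_nonempty {ι : Type} [Fintype ι] (w : stdSimplex ℝ ι) : (supp w).Nonempty := by
  by_contra h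
  have : ∀ i, w i = 0 := fun i => by
    by_contra hi
    exact h ⟨i, hi⟩
  have h1 := stdSimplex.sum_eq_one w
  simp [this] at h1

namespace ChainFamily
variable {Y : SSet.{u}} (𝒞 : ChainFamily ι Y)

/-- Since `g'` is an order embedding, `g` factors through it by a monotone `θ`. Hence the simplex of
`g` is the image of the simplex of `g'` under `θ`, and the coordinates correspond because pushing
forward along the injective `g'` is injective. -/
theorem pt_eq_of_range_subset {m m' : SimplexCategory} (g : Fin (m.len + 1) →o ι)
    (g' : Fin (m'.len + 1) ↪o ι) (hg : 𝒞.adm (Set.range g)) (hg' : 𝒞.adm (Set.range g'.toOrderHom))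
    (h : Set.range g ⊆ Set.range g') (v : Tsx m) (v' : Tsx m')
    (e : stdSimplex.map g v = stdSimplex.map g' v') :
    pt (𝒞.simplex g hg) v = pt (𝒞.simplex g'.toOrderHom hg') v' := by
  choose θ hθ using fun i => h ⟨i, rfl⟩
  have mono : Monotone θ := fun i j hij => by
    rw [← g'.le_iff_le, hθ, hθ]
    exact g.monotone hij
  let θ' : m ⟶ m' := SimplexCategory.mkHom ⟨θ, mono⟩
  have hc : g'.toOrderHom.comp θ'.toOrderHom = g := by
    ext i
    exact hθ i
  have h1 := 𝒞.map_simplex θ' g'.toOrderHom hg' (hc ▸ hg)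
  have h2 : 𝒞.simplex g hg = Y.map θ'.op (𝒞.simplex g'.toOrderHom hg') := by
    rw [h1]
    congr 1
    exact hc.symm
  rw [h2, pt_map]
  congr 1
  apply map_injective g'.injective
  rw [← e]
  refine (stdSimplex.map_comp_apply _ _ _).trans ?_
  congr 1
  funext i
  exact hθ i

/-- The increasing enumeration of a nonempty finite set. -/
def enum {ι : Type} [LinearOrder ι] (s : Finset ι) (hs : s.Nonempty) : Fin ((s.card - 1) + 1) ↪o ι :=
  s.orderEmbOfFin (Nat.succ_pred_eq_of_pos hs.card_pos).symm

theorem range_enum {ι : Type} [LinearOrder ι] (s : Finset ι) (hs : s.Nonempty) : Set.range (enum s hs) = s :=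
  Finset.range_orderEmbOfFin _ _

/-- The coordinates of `w` with respect to a finite set containing its support. -/
def coords (s : Finset ι) (hs : s.Nonempty) (w : stdSimplex ℝ ι) (h : supp w ⊆ s) :
    Tsx (SimplexCategory.mk (s.card - 1)) :=
  ⟨fun i => w (enum s hs i), fun i => w.2.1 _, by
    change ∑ i : Fin ((s.card - 1) + 1), w (enum s hs i) = 1
    rw [← stdSimplex.sum_eq_one w]
    rw [← Finset.sum_subset (Finset.subset_univ s) (fun i _ hi => by
      by_contra hne
      exact hi (h hne))]
    refine Finset.sum_bij (fun i _ => enum s hs i) (fun i _ => ?_) (fun i _ j _ hij => ?_)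
      (fun b hb => ?_) (fun _ _ => rfl)
    · have : enum s hs i ∈ Set.range (enum s hs) := ⟨i, rfl⟩
      rwa [range_enum] at this
    · exact (enum s hs).injective hij
    · have : b ∈ Set.range (enum s hs) := by rw [range_enum]; exact hb
      obtain ⟨i, hi⟩ := this
      exact ⟨i, Finset.mem_univ _, hi⟩⟩

theorem map_enum_coords (s : Finset ι) (hs : s.Nonempty) (w : stdSimplex ℝ ι) (h : supp w ⊆ s) :
    stdSimplex.map (enum s hs) (coords s hs w h) = w := by
  ext k
  rw [map_apply]
  by_cases hk : k ∈ Set.range (enum s hs)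
  · obtain ⟨i, rfl⟩ := hk
    rw [Finset.sum_eq_single i]
    · rfl
    · intro j hj hji
      exact absurd ((enum s hs).injective (Finset.mem_filter.mp hj).2) hji
    · simp
  · rw [Finset.sum_eq_zero]
    · rw [range_enum] at hk
      by_contra hne
      exact hk (h (Ne.symm hne))
    · intro i hi
      exact absurd ⟨i, (Finset.mem_filter.mp hi).2⟩ hk

/-- The weights with admissible support. -/
abbrev Weights : Type := {w : stdSimplex ℝ ι // 𝒞.adm (supp w)}

open Classical in
/-- The support as a finite set. -/
noncomputable def suppF {ι : Type} [Fintype ι] (w : stdSimplex ℝ ι) : Finset ι := (supp w).toFinset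

theorem coe_suppF {ι : Type} [Fintype ι] (w : stdSimplex ℝ ι) : (suppF w : Set ι) = supp w := by
  simp [suppF]

theorem suppF_nonempty {ι : Type} [Fintype ι] (w : stdSimplex ℝ ι) : (suppF w).Nonempty := by
  rw [← Finset.coe_nonempty, coe_suppF]
  exact supp_nonempty w

theorem adm_enum {ι : Type} [LinearOrder ι] (𝒞 : ChainFamily ι Y) {s : Finset ι} (hs : s.Nonempty) (h : 𝒞.adm s) :
    𝒞.adm (Set.range (enum s hs).toOrderHom) := by
  change 𝒞.adm (Set.range (enum s hs))
  rwa [range_enum]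

theorem adm_suppF (w : 𝒞.Weights) : 𝒞.adm (suppF w.1 : Set ι) := by
  rw [coe_suppF]; exact w.2

/-- The point of the realization of `Y` defined by a weight with admissible support. -/
noncomputable def point (w : 𝒞.Weights) : SSet.toTop.obj Y :=
  pt (n := .mk ((suppF w.1).card - 1))
    (𝒞.simplex (enum (suppF w.1) (suppF_nonempty w.1)).toOrderHom
      (𝒞.adm_enum (suppF_nonempty w.1) (𝒞.adm_suppF w)))
    (coords _ (suppF_nonempty w.1) w.1 (coe_suppF w.1).symm.subset)

/-- The support in the definition of `point` jumps as `w` varies. Any fixed admissible set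
containing the support may be used instead, which is what continuity requires. -/
theorem point_eq_coords (w : 𝒞.Weights) (s : Finset ι) (hs : s.Nonempty) (h : 𝒞.adm s)
    (hw : supp w.1 ⊆ s) : 𝒞.point w =
      pt (n := .mk (s.card - 1)) (𝒞.simplex (enum s hs).toOrderHom (𝒞.adm_enum hs h))
        (coords s hs w.1 hw) := by
  refine 𝒞.pt_eq_of_range_subset (m := .mk _) (m' := .mk _) _ (enum s hs) _ _ ?_ _ _ ?_
  · change Set.range (enum _ (suppF_nonempty w.1)) ⊆ _
    rw [range_enum _ (suppF_nonempty w.1), range_enum, coe_suppF]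
    exact hw
  · exact (map_enum_coords _ (suppF_nonempty w.1) _ _).trans (map_enum_coords _ _ _ _).symm

/-- Independence of the representative: enumerate the image of `g` and compare both sides with that
enumeration. Compatibility of the constructions with simplicial operators is checked through this
lemma, by choosing convenient maps `g`. -/
theorem point_eq (w : 𝒞.Weights) {m : SimplexCategory} (g : Fin (m.len + 1) →o ι)
    (hg : 𝒞.adm (Set.range g)) (v : Tsx m) (h : stdSimplex.map g v = w.1) :
    𝒞.point w = pt (𝒞.simplex g hg) v := by
  classical
  let s : Finset ι := Finset.univ.image g
  have hs : s.Nonempty := ⟨g 0, Finset.mem_image_of_mem _ (Finset.mem_univ _)⟩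
  have hsr : (s : Set ι) = Set.range g := by simp [s]
  have hw : supp w.1 ⊆ s := by rw [← h, hsr]; exact supp_map_subset _ _
  rw [𝒞.point_eq_coords w s hs (by rwa [hsr]) hw]
  symm
  refine 𝒞.pt_eq_of_range_subset (m' := .mk _) _ (enum s hs) _ _ ?_ _ _ ?_
  · rw [range_enum, hsr]
  · exact h.trans (map_enum_coords _ _ _ _).symm

theorem exists_representative (w : 𝒞.Weights) : ∃ (m : SimplexCategory) (g : Fin (m.len + 1) →o ι)
    (_ : 𝒞.adm (Set.range g)) (v : Tsx m), stdSimplex.map g v = w.1 :=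
  ⟨.mk _, (enum (suppF w.1) (suppF_nonempty w.1)).toOrderHom,
    𝒞.adm_enum (suppF_nonempty w.1) (𝒞.adm_suppF w),
    coords _ (suppF_nonempty w.1) w.1 (coe_suppF w.1).symm.subset,
    map_enum_coords _ (suppF_nonempty w.1) _ (coe_suppF w.1).symm.subset⟩

/-- The sets of weights supported in a given admissible finite set form a finite closed cover. On
each of them `point` is the characteristic map of one fixed simplex applied to continuous
coordinates. -/
theorem continuous_point : Continuous 𝒞.point := by
  classical
  let A : {s : Finset ι // s.Nonempty ∧ 𝒞.adm s} → Set 𝒞.Weights := fun s => {w | supp w.1 ⊆ s.1}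
  refine LocallyFinite.continuous (f := A) (locallyFinite_of_finite A) ?_ ?_ ?_
  · ext w
    simp only [Set.mem_iUnion, Set.mem_univ, iff_true]
    exact ⟨⟨suppF w.1, suppF_nonempty _, 𝒞.adm_suppF w⟩, (coe_suppF w.1).symm.subset⟩
  · intro s
    -- Being supported in `s` means that the coordinates outside `s` vanish, which is a closed
    -- condition.
    have : A s = ⋂ i : {i : ι // i ∉ s.1}, {w : 𝒞.Weights | w.1.1 i.1 = 0} := by
      ext w
      simp only [Set.mem_iInter, Set.mem_ofPred_eq]
      constructor
      · rintro h ⟨i, hi⟩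
        by_contra hne
        exact hi (h hne)
      · intro h i hi
        by_contra hne
        exact hi (h ⟨i, hne⟩)
    rw [this]
    refine isClosed_iInter fun i => isClosed_eq ?_ continuous_const
    exact (continuous_apply _).comp (continuous_subtype_val.comp continuous_subtype_val)
  · rintro ⟨s, hs, hs'⟩
    rw [continuousOn_iff_continuous_domRestrict]
    have : (A ⟨s, hs, hs'⟩).domRestrict 𝒞.point = fun w =>
        pt (n := .mk (s.card - 1)) (𝒞.simplex (enum s hs).toOrderHom (𝒞.adm_enum hs hs'))
          (coords s hs w.1.1 w.2) := by
      funext w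
      exact 𝒞.point_eq_coords w.1 s hs hs' w.2
    rw [this]
    refine (continuous_pt _).comp ?_
    refine Continuous.subtype_mk ?_ _
    refine continuous_pi fun i => ?_
    exact (continuous_apply _).comp (continuous_subtype_val.comp
      (continuous_subtype_val.comp continuous_subtype_val))

end ChainFamily
end Chains
end Realization

/-! ### Distributions of step functions -/

namespace Realization
open Opposite MeasureTheory Set Filter Topology

section Distribution
variable {ι : Type} [Fintype ι]

/-- The distribution of a function on `[0, 1)` with finitely many values. -/
noncomputable def distribution (γ : ℝ → ι) (hγ : ∀ p, MeasurableSet {x | x ∈ Ico (0 : ℝ) 1 ∧ γ x = p}) :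
    stdSimplex ℝ ι :=
  ⟨fun p => volume.real {x | x ∈ Ico (0 : ℝ) 1 ∧ γ x = p}, fun _ => measureReal_nonneg, by
    rw [← measureReal_iUnion_fintype (h' := fun p =>
      ((measure_mono (fun x hx => hx.1)).trans_lt measure_Ico_lt_top).ne)]
    · have : ⋃ p, {x | x ∈ Ico (0 : ℝ) 1 ∧ γ x = p} = Ico (0 : ℝ) 1 := by
        ext x; simp
      rw [this]; simp
    · intro p q hpq
      refine Set.disjoint_left.mpr fun x hx hx' => hpq (hx.2.symm.trans hx'.2)
    · exact hγ⟩

variable {γ : ℝ → ι} {hγ : ∀ p, MeasurableSet {x | x ∈ Ico (0 : ℝ) 1 ∧ γ x = p}}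

/-- A level set of nonzero measure is nonempty. Order relations between values of a step function
thus pass to the support of its distribution. -/
theorem exists_of_mem_supp {p : ι} (hp : p ∈ supp (distribution γ hγ)) :
    ∃ x ∈ Ico (0 : ℝ) 1, γ x = p := by
  by_contra h
  push Not at h
  apply hp
  have : {x | x ∈ Ico (0 : ℝ) 1 ∧ γ x = p} = ∅ := by
    ext x
    simp only [mem_ofPred_eq, mem_empty_iff_false, iff_false, not_and]
    exact h x
  change volume.real {x | x ∈ Ico (0 : ℝ) 1 ∧ γ x = p} = 0
  rw [this]; simp

/-- Each level set of `γ'` is the disjoint union of the level sets of `γ` over a fibre of `f`.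
Identities between points of simplices are thereby reduced to pointwise identities of functions on
`[0, 1)`. -/
theorem map_distribution {κ : Type} [Fintype κ] (f : ι → κ) {γ' : ℝ → κ}
    (hγ' : ∀ p, MeasurableSet {x | x ∈ Ico (0 : ℝ) 1 ∧ γ' x = p})
    (h : ∀ x ∈ Ico (0 : ℝ) 1, f (γ x) = γ' x) :
    stdSimplex.map f (distribution γ hγ) = distribution γ' hγ' := by
  classical
  ext k
  rw [map_apply]
  change ∑ i with f i = k, volume.real {x | x ∈ Ico (0 : ℝ) 1 ∧ γ x = i} =
    volume.real {x | x ∈ Ico (0 : ℝ) 1 ∧ γ' x = k}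
  rw [← measureReal_biUnion_finset (h := fun p _ =>
    ((measure_mono (fun x hx => hx.1)).trans_lt measure_Ico_lt_top).ne)]
  · congr 1
    ext x
    simp only [Finset.mem_filter, Finset.mem_univ, true_and, mem_iUnion, mem_ofPred_eq, exists_prop]
    constructor
    · rintro ⟨i, rfl, hx, rfl⟩
      exact ⟨hx, (h x hx).symm⟩
    · rintro ⟨hx, rfl⟩
      exact ⟨γ x, h x hx, hx, rfl⟩
  · intro p _ q _ hpq
    refine Set.disjoint_left.mpr fun x hx hx' => hpq (hx.2.symm.trans hx'.2)
  · exact fun p _ => hγ p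

/-- Each coordinate is the integral of an indicator bounded by that of `[0, 1)`. For every `x` off a
null set the integrand is locally constant in the parameter, so dominated convergence applies; first
countability is needed for it. -/
theorem continuous_distribution {Z : Type*} [TopologicalSpace Z] [FirstCountableTopology Z]
    (γ : Z → ℝ → ι) (hγ : ∀ z p, MeasurableSet {x | x ∈ Ico (0 : ℝ) 1 ∧ γ z x = p})
    (h : ∀ z₀, ∃ s : Set ℝ, s.Countable ∧ ∀ x ∈ Ico (0 : ℝ) 1, x ∉ s → ∀ᶠ z in 𝓝 z₀, γ z x = γ z₀ x) :
    Continuous fun z => distribution (γ z) (hγ z) := by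
  refine Continuous.subtype_mk (continuous_pi fun p => ?_) _
  rw [continuous_iff_continuousAt]
  intro z₀
  have key : ∀ z, volume.real {x | x ∈ Ico (0 : ℝ) 1 ∧ γ z x = p} =
      ∫ x, ({x | x ∈ Ico (0 : ℝ) 1 ∧ γ z x = p} : Set ℝ).indicator (fun _ => (1 : ℝ)) x := by
    intro z
    rw [integral_indicator_const _ (hγ z p)]
    simp
  simp only [key]
  refine continuousAt_of_dominated (bound := (Ico (0 : ℝ) 1).indicator fun _ => 1) ?_ ?_ ?_ ?_
  · exact Eventually.of_forall fun z =>
      (stronglyMeasurable_const.indicator (hγ z p)).aestronglyMeasurable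
  · refine Eventually.of_forall fun z => Eventually.of_forall fun x => ?_
    by_cases hx : x ∈ Ico (0 : ℝ) 1
    · rw [indicator_of_mem hx]
      refine (norm_indicator_le_norm_self _ _).trans ?_
      simp
    · rw [indicator_of_notMem (fun h => hx h.1), indicator_of_notMem hx]
      simp
  · rw [integrable_indicator_iff measurableSet_Ico]
    exact integrableOn_const (by simp)
  · obtain ⟨s, hs, h⟩ := h z₀
    have : ∀ᵐ x ∂(volume : Measure ℝ), x ∉ s := hs.ae_notMem volume
    filter_upwards [this] with x hx
    by_cases hx' : x ∈ Ico (0 : ℝ) 1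
    · have h' := h x hx' hx
      refine (continuousAt_const (y := ({x | x ∈ Ico (0 : ℝ) 1 ∧ γ z₀ x = p} : Set ℝ).indicator
        (fun _ => (1 : ℝ)) x)).congr ?_
      filter_upwards [h'] with z hz
      by_cases hp : γ z₀ x = p
      · exact (indicator_of_mem (s := {x | x ∈ Ico (0 : ℝ) 1 ∧ γ z₀ x = p}) ⟨hx', hp⟩ _).trans
          (indicator_of_mem (s := {x | x ∈ Ico (0 : ℝ) 1 ∧ γ z x = p}) ⟨hx', hz.trans hp⟩
            (fun _ => (1 : ℝ))).symm
      · rw [indicator_of_notMem (fun h => hp h.2),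
          indicator_of_notMem (fun h => hp (hz.symm.trans h.2))]
    · have : ∀ z, ({x | x ∈ Ico (0 : ℝ) 1 ∧ γ z x = p} : Set ℝ).indicator
          (fun _ => (1 : ℝ)) x = 0 := fun z => indicator_of_notMem (fun h => hx' h.1) _
      simp only [this]
      exact continuousAt_const

end Distribution

/-! ### Step functions attached to points of a simplex. -/

section Step
variable {n : ℕ}

/-- The sum of the first `k` coordinates. -/
noncomputable def cum (t : stdSimplex ℝ (Fin (n + 1))) (k : ℕ) : ℝ := ∑ i with i.val < k, t i

theorem cum_mono (t : stdSimplex ℝ (Fin (n + 1))) : Monotone (cum t) := fun _ _ h =>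
  Finset.sum_le_sum_of_subset_of_nonneg
    (fun i hi => by simp only [Finset.mem_filter, Finset.mem_univ, true_and] at hi ⊢; omega)
    fun i _ _ => stdSimplex.zero_le t i

theorem cum_zero (t : stdSimplex ℝ (Fin (n + 1))) : cum t 0 = 0 := by simp [cum]

theorem cum_top (t : stdSimplex ℝ (Fin (n + 1))) : cum t (n + 1) = 1 := by
  rw [cum, Finset.filter_true_of_mem fun i _ => i.2]
  exact stdSimplex.sum_eq_one t

theorem cum_succ (t : stdSimplex ℝ (Fin (n + 1))) (i : Fin (n + 1)) :
    cum t (i + 1) = cum t i + t i := by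
  have : (Finset.univ.filter fun j : Fin (n + 1) => j.val < i.val + 1) =
      insert i (Finset.univ.filter fun j : Fin (n + 1) => j.val < i.val) := by
    ext j
    simp only [Finset.mem_filter, Finset.mem_univ, true_and, Finset.mem_insert, Fin.ext_iff]
    omega
  rw [cum, this, Finset.sum_insert (by simp), add_comm]
  rfl

theorem continuous_cum (k : ℕ) : Continuous fun t : stdSimplex ℝ (Fin (n + 1)) => cum t k :=
  continuous_finsetSum _ fun i _ => (continuous_apply i).comp continuous_subtype_val

/-- The half-open intervals between consecutive partial sums tile `[0, 1)`; the index is the least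
`k` whose next partial sum exceeds `x`. -/
theorem exists_step (t : stdSimplex ℝ (Fin (n + 1))) {x : ℝ} (hx : x ∈ Ico (0 : ℝ) 1) :
    ∃ i : Fin (n + 1), cum t i ≤ x ∧ x < cum t (i + 1) := by
  classical
  have h : ∃ k : ℕ, x < cum t (k + 1) := ⟨n, by rw [cum_top]; exact hx.2⟩
  have hk : Nat.find h ≤ n := Nat.find_min' h (by rw [cum_top]; exact hx.2)
  refine ⟨⟨Nat.find h, by omega⟩, ?_, Nat.find_spec h⟩
  change cum t (Nat.find h) ≤ x
  rcases Nat.eq_zero_or_pos (Nat.find h) with h0 | h0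
  · rw [h0, cum_zero]; exact hx.1
  · have := Nat.find_min h (m := Nat.find h - 1) (by omega)
    rw [Nat.sub_add_cancel h0] at this
    exact not_lt.mp this

open Classical in
/-- The step function on `[0, 1)` whose distribution is `t`. -/
noncomputable def step (t : stdSimplex ℝ (Fin (n + 1))) (x : ℝ) : Fin (n + 1) :=
  if h : ∃ i : Fin (n + 1), cum t i ≤ x ∧ x < cum t (i + 1) then h.choose else 0

theorem step_spec (t : stdSimplex ℝ (Fin (n + 1))) {x : ℝ} (hx : x ∈ Ico (0 : ℝ) 1) :
    cum t (step t x) ≤ x ∧ x < cum t (step t x + 1) := by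
  rw [step, dif_pos (exists_step t hx)]
  exact (exists_step t hx).choose_spec

theorem step_unique {t : stdSimplex ℝ (Fin (n + 1))} {x : ℝ} (hx : x ∈ Ico (0 : ℝ) 1)
    {i : Fin (n + 1)} (h : cum t i ≤ x) (h' : x < cum t (i + 1)) : step t x = i := by
  obtain ⟨h₁, h₂⟩ := step_spec t hx
  apply le_antisymm
  · by_contra hlt
    have : cum t (i + 1) ≤ cum t (step t x) := cum_mono t (Nat.succ_le_of_lt (not_le.mp hlt))
    linarith
  · by_contra hlt
    have : cum t (step t x + 1) ≤ cum t i := cum_mono t (Nat.succ_le_of_lt (not_le.mp hlt))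
    linarith

theorem step_eq_iff (t : stdSimplex ℝ (Fin (n + 1))) {x : ℝ} (hx : x ∈ Ico (0 : ℝ) 1)
    (i : Fin (n + 1)) : step t x = i ↔ cum t i ≤ x ∧ x < cum t (i + 1) :=
  ⟨fun h => h ▸ step_spec t hx, fun h => step_unique hx h.1 h.2⟩

theorem step_mono (t : stdSimplex ℝ (Fin (n + 1))) {x y : ℝ} (hx : x ∈ Ico (0 : ℝ) 1)
    (hy : y ∈ Ico (0 : ℝ) 1) (h : x ≤ y) : step t x ≤ step t y := by
  by_contra hlt
  have : cum t (step t y + 1) ≤ cum t (step t x) := cum_mono t (Nat.succ_le_of_lt (not_le.mp hlt))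
  have h₁ := (step_spec t hx).1
  have h₂ := (step_spec t hy).2
  linarith

/-- The partial sums of the pushforward are sums of `t` over the sets of `i` with `θ i < k`, which
are initial segments because `θ` is monotone. The intervals of the pushforward are therefore unions
of consecutive intervals of `t`. This is the source of compatibility with simplicial operators
throughout. -/
theorem step_map {m : ℕ} (θ : Fin (n + 1) →o Fin (m + 1)) (t : stdSimplex ℝ (Fin (n + 1))) {x : ℝ}
    (hx : x ∈ Ico (0 : ℝ) 1) : step (stdSimplex.map θ t) x = θ (step t x) := by
  have hc : ∀ k, cum (stdSimplex.map θ t) k = ∑ i with (θ i).val < k, t i := by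
    intro k
    simp only [cum, map_apply]
    rw [← Finset.sum_fiberwise_of_maps_to (s := Finset.univ.filter fun i => (θ i).val < k)
      (t := Finset.univ.filter fun j : Fin (m + 1) => j.val < k) (g := θ) (by simp)]
    refine Finset.sum_congr rfl fun j hj => Finset.sum_congr ?_ fun _ _ => rfl
    ext i
    simp only [Finset.mem_filter, Finset.mem_univ, true_and] at hj ⊢
    constructor
    · rintro rfl; exact ⟨hj, rfl⟩
    · exact fun h => h.2
  obtain ⟨h₁, h₂⟩ := step_spec t hx
  apply step_unique hx
  · rw [hc]
    refine le_trans ?_ h₁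
    refine Finset.sum_le_sum_of_subset_of_nonneg (fun i hi => ?_) fun i _ _ => stdSimplex.zero_le t i
    simp only [Finset.mem_filter, Finset.mem_univ, true_and] at hi ⊢
    by_contra hle
    exact absurd (θ.monotone (not_lt.mp hle)) (not_le.mpr hi)
  · rw [hc]
    refine lt_of_lt_of_le h₂ ?_
    refine Finset.sum_le_sum_of_subset_of_nonneg (fun i hi => ?_) fun i _ _ => stdSimplex.zero_le t i
    simp only [Finset.mem_filter, Finset.mem_univ, true_and] at hi ⊢
    exact Nat.lt_succ_of_le (θ.monotone (Nat.le_of_lt_succ hi))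

/-- The step function can jump only at partial sums. Away from them both bounds on the position are
strict, and strict inequalities between continuous functions persist nearby. -/
theorem eventually_step {Z : Type*} [TopologicalSpace Z] {z₀ : Z}
    {t : Z → stdSimplex ℝ (Fin (n + 1))} {y : Z → ℝ} (ht : ContinuousAt t z₀)
    (hy : ContinuousAt y z₀) (hy' : ∀ z, y z ∈ Ico (0 : ℝ) 1)
    (h : ∀ k ∈ Finset.range (n + 1), y z₀ ≠ cum (t z₀) k) :
    ∀ᶠ z in 𝓝 z₀, step (t z) (y z) = step (t z₀) (y z₀) := by
  obtain ⟨h₁, h₂⟩ := step_spec (t z₀) (hy' z₀)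
  -- Only the lower bound has to be made strict, as the intervals are open on the right; hence the
  -- partial sums with index at most `n` suffice.
  have h₁' := lt_of_le_of_ne h₁ (h _ (Finset.mem_range.mpr (step (t z₀) (y z₀)).2)).symm
  have c := fun k => (continuous_cum (n := n) k).continuousAt.comp ht
  filter_upwards [(c (step (t z₀) (y z₀))).eventually_lt hy h₁', hy.eventually_lt (c _) h₂]
    with z hz hz'
  exact step_unique (hy' z) hz.le hz'

theorem measurableSet_step (t : stdSimplex ℝ (Fin (n + 1))) {y : ℝ → ℝ} (hy : Measurable y)
    (hy' : ∀ x ∈ Ico (0 : ℝ) 1, y x ∈ Ico (0 : ℝ) 1) (p : Fin (n + 1)) :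
    MeasurableSet {x | x ∈ Ico (0 : ℝ) 1 ∧ step t (y x) = p} := by
  have : {x | x ∈ Ico (0 : ℝ) 1 ∧ step t (y x) = p} =
      Ico (0 : ℝ) 1 ∩ (y ⁻¹' Ico (cum t p) (cum t (p + 1))) := by
    ext x
    simp only [mem_ofPred_eq, mem_inter_iff, mem_preimage]
    refine and_congr_right fun hx => ?_
    rw [step_eq_iff t (hy' x hx)]
    rfl
  rw [this]
  exact measurableSet_Ico.inter (hy measurableSet_Ico)

/-- The interval belonging to `i` has length `t i`, so passing to the step function loses nothing.
-/
theorem distribution_step (t : stdSimplex ℝ (Fin (n + 1))) :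
    distribution (step t) (measurableSet_step t measurable_id fun _ h => h) = t := by
  ext i
  change volume.real {x | x ∈ Ico (0 : ℝ) 1 ∧ step t x = i} = t i
  have : {x | x ∈ Ico (0 : ℝ) 1 ∧ step t x = i} = Ico (cum t i) (cum t (i + 1)) := by
    ext x
    simp only [mem_ofPred_eq]
    constructor
    · rintro ⟨hx, h⟩
      exact (step_eq_iff t hx i).mp h
    · intro h
      have hx : x ∈ Ico (0 : ℝ) 1 := by
        refine ⟨?_, lt_of_lt_of_le h.2 ?_⟩
        · rw [← cum_zero t]; exact (cum_mono t (Nat.zero_le _)).trans h.1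
        · rw [← cum_top t]; exact cum_mono t (Nat.succ_le_of_lt i.2)
      exact ⟨hx, (step_eq_iff t hx i).mpr h⟩
  rw [this, Real.volume_real_Ico_of_le (cum_mono t (Nat.le_succ _)), cum_succ]
  ring

end Step
end Realization

/-! ### Simplicial homotopies give homotopies of realizations -/

namespace Realization
open Opposite MeasureTheory Set Filter Topology

/-- The morphism of `SimplexCategory` given by a monotone map. -/
def monoHom {m n : SimplexCategory} (f : Fin (m.len + 1) → Fin (n.len + 1)) (hf : Monotone f) :
    m ⟶ n :=
  SimplexCategory.Hom.mk ⟨f, hf⟩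

section Homotopy
variable {X Y : SSet.{u}}

/-- A simplicial homotopy, as a compatible family of maps indexed by the simplices of `Δ[1]`. -/
structure SimplicialHomotopy (f g : X ⟶ Y) where
  toFun : ∀ {n : SimplexCategory}, X.obj (op n) → (n ⟶ SimplexCategory.mk 1) → Y.obj (op n)
  map_toFun : ∀ {m n : SimplexCategory} (θ : m ⟶ n) (x : X.obj (op n))
    (χ : n ⟶ SimplexCategory.mk 1), Y.map θ.op (toFun x χ) = toFun (X.map θ.op x) (θ ≫ χ)
  toFun_zero : ∀ {n : SimplexCategory} (x : X.obj (op n)) (χ : n ⟶ SimplexCategory.mk 1),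
    (∀ i, χ i = 0) → toFun x χ = f.app (op n) x
  toFun_one : ∀ {n : SimplexCategory} (x : X.obj (op n)) (χ : n ⟶ SimplexCategory.mk 1),
    (∀ i, χ i = 1) → toFun x χ = g.app (op n) x

/-- A lexicographically monotone map with values in a chain of a product. -/
theorem monotone_of_chain {α β : Type} [LinearOrder α] [LinearOrder β] {m : ℕ}
    (g : Fin m →o α ×ₗ β)
    (h : ∀ p ∈ range g, ∀ q ∈ range g, p ≤ q → (ofLex p).1 ≤ (ofLex q).1 ∧ (ofLex p).2 ≤ (ofLex q).2) :
    Monotone (fun i => (ofLex (g i)).1) ∧ Monotone (fun i => (ofLex (g i)).2) :=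
  ⟨fun _ _ hij => (h _ ⟨_, rfl⟩ _ ⟨_, rfl⟩ (g.monotone hij)).1,
    fun _ _ hij => (h _ ⟨_, rfl⟩ _ ⟨_, rfl⟩ (g.monotone hij)).2⟩

namespace SimplicialHomotopy
variable {f g : X ⟶ Y} (H : SimplicialHomotopy f g)

/-- The simplices of the prism over a simplex `x`. -/
def prism {n : SimplexCategory} (x : X.obj (op n)) : ChainFamily (Fin (n.len + 1) ×ₗ Fin 2) Y where
  adm s := ∀ p ∈ s, ∀ q ∈ s, p ≤ q → (ofLex p).1 ≤ (ofLex q).1 ∧ (ofLex p).2 ≤ (ofLex q).2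
  adm_mono h hs p hp q hq := h p (hs hp) q (hs hq)
  simplex {m} k hk := H.toFun
    (X.map (monoHom (m := m) (n := n) _ (monotone_of_chain k hk).1).op x)
    (monoHom (m := m) (n := .mk 1) _ (monotone_of_chain k hk).2)
  map_simplex {m m'} θ k hk hk' := by
    rw [H.map_toFun, ← Functor.map_comp_apply]
    rfl

/-- The step function of a point of the prism. -/
noncomputable def prismStep {n : SimplexCategory} (t : Tsx n) (s : unitInterval) (x : ℝ) :
    Fin (n.len + 1) ×ₗ Fin 2 :=
  toLex (step t x, if x < s then 0 else 1)

theorem measurableSet_prismStep {n : SimplexCategory} (t : Tsx n) (s : unitInterval)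
    (p : Fin (n.len + 1) ×ₗ Fin 2) :
    MeasurableSet {x | x ∈ Ico (0 : ℝ) 1 ∧ prismStep t s x = p} := by
  have : {x | x ∈ Ico (0 : ℝ) 1 ∧ prismStep t s x = p} =
      {x | x ∈ Ico (0 : ℝ) 1 ∧ step t x = (ofLex p).1} ∩
        {x : ℝ | (if x < s then (0 : Fin 2) else 1) = (ofLex p).2} := by
    ext x
    simp only [mem_ofPred_eq, mem_inter_iff, and_assoc]
    refine and_congr_right fun _ => ?_
    rw [← Prod.mk_inj]
    exact ⟨fun h => h ▸ rfl, fun h => ofLex.injective h⟩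
  rw [this]
  refine (measurableSet_step t measurable_id (fun _ h => h) _).inter ?_
  have hm : Measurable fun x : ℝ => if x < s then (0 : Fin 2) else 1 :=
    Measurable.ite measurableSet_Iio measurable_const measurable_const
  exact hm (measurableSet_singleton _)

/-- Both coordinates increase with the position, so the values form a chain for the product order
and not merely for the lexicographic one. -/
theorem prismStep_mono {n : SimplexCategory} (t : Tsx n) (s : unitInterval) {x y : ℝ}
    (hx : x ∈ Ico (0 : ℝ) 1) (hy : y ∈ Ico (0 : ℝ) 1) (h : x ≤ y) :
    ofLex (prismStep t s x) ≤ ofLex (prismStep t s y) := by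
  refine ⟨step_mono t hx hy h, ?_⟩
  change (if x < s then (0 : Fin 2) else 1) ≤ if y < s then 0 else 1
  split_ifs with h₁ h₂
  · exact le_rfl
  · exact Fin.zero_le _
  · exact absurd (lt_of_le_of_lt h ‹_›) h₁
  · exact le_rfl

/-- The weight on the prism defined by a pair of coordinates. -/
noncomputable def prismWeight {n : SimplexCategory} (x : X.obj (op n)) (t : Tsx n)
    (s : unitInterval) : (H.prism x).Weights :=
  ⟨distribution (prismStep t s) (measurableSet_prismStep t s), by
    intro p hp q hq hpq
    obtain ⟨a, ha, rfl⟩ := exists_of_mem_supp hp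
    obtain ⟨b, hb, rfl⟩ := exists_of_mem_supp hq
    rcases le_total a b with hab | hab
    · exact prismStep_mono t s ha hb hab
    -- If the positions are in the opposite order, the values are comparable both ways
    -- lexicographically, hence equal.
    · have := prismStep_mono t s hb ha hab
      rw [le_antisymm hpq (Prod.Lex.toLex_mono this)]
      exact ⟨le_rfl, le_rfl⟩⟩

theorem continuous_prismWeight {n : SimplexCategory} (x : X.obj (op n)) :
    Continuous fun z : Tsx n × unitInterval => H.prismWeight x z.1 z.2 := by
  refine Continuous.subtype_mk ?_ _
  refine continuous_distribution (fun z : Tsx n × unitInterval => prismStep z.1 z.2)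
    (fun z => measurableSet_prismStep z.1 z.2) fun z₀ => ?_
  -- The exceptional positions are the jumps of the step function of `z₀.1` together with the cut at
  -- `z₀.2`.
  refine ⟨((Finset.range (n.len + 1)).image (cum z₀.1) : Set ℝ) ∪ {(z₀.2 : ℝ)},
    (Finset.countable_toSet _).union (countable_singleton _), fun a ha ha' => ?_⟩
  have h₁ : ∀ᶠ z : Tsx n × unitInterval in 𝓝 z₀, step z.1 a = step z₀.1 a := by
    refine eventually_step continuousAt_fst continuousAt_const (fun _ => ha) fun k hk hne => ?_
    exact ha' (Or.inl (Finset.mem_coe.mpr (Finset.mem_image.mpr ⟨k, hk, hne.symm⟩)))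
  have hne : a ≠ z₀.2 := fun h => ha' (Or.inr h)
  have hc : ContinuousAt (fun z : Tsx n × unitInterval => (z.2 : ℝ)) z₀ :=
    (continuous_subtype_val.comp continuous_snd).continuousAt
  have h₂ : ∀ᶠ z : Tsx n × unitInterval in 𝓝 z₀, (a < z.2 ↔ a < z₀.2) := by
    rcases lt_or_gt_of_ne hne with h | h
    · filter_upwards [continuousAt_const.eventually_lt hc h] with z hz
      exact ⟨fun _ => h, fun _ => hz⟩
    · filter_upwards [hc.eventually_lt continuousAt_const h] with z hz
      exact ⟨fun h' => absurd h' hz.not_gt, fun h' => absurd h' h.not_gt⟩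
  filter_upwards [h₁, h₂] with z hz hz'
  simp only [prismStep, hz, hz']

/-- The map on the prism over a simplex. -/
noncomputable def prismMap {n : SimplexCategory} (x : X.obj (op n)) (z : Tsx n × unitInterval) :
    SSet.toTop.obj Y :=
  (H.prism x).point (H.prismWeight x z.1 z.2)

/-- Apply `θ` to the first coordinate of a representative of the left-hand point. By `step_map` the
result represents the right-hand weight with the same coordinates `v`, and the two simplices of `Y`
agree by functoriality of `X`. -/
theorem prismMap_map {m n : SimplexCategory} (θ : m ⟶ n) (x : X.obj (op n)) (t : Tsx m)
    (s : unitInterval) :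
    H.prismMap (X.map θ.op x) (t, s) = H.prismMap x (stdSimplex.map θ t, s) := by
  obtain ⟨l, k, hk, v, hv⟩ := (H.prism (X.map θ.op x)).exists_representative
    (H.prismWeight (X.map θ.op x) t s)
  obtain ⟨hk₁, hk₂⟩ := monotone_of_chain k hk
  let k' : Fin (l.len + 1) →o Fin (n.len + 1) ×ₗ Fin 2 :=
    ⟨fun i => toLex (θ (ofLex (k i)).1, (ofLex (k i)).2), fun i j hij =>
      Prod.Lex.toLex_mono ⟨θ.toOrderHom.monotone (hk₁ hij), hk₂ hij⟩⟩
  have hk' : (H.prism x).adm (range k') := by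
    rintro _ ⟨i, rfl⟩ _ ⟨j, rfl⟩ hij
    rcases le_total i j with h | h
    · exact ⟨θ.toOrderHom.monotone (hk₁ h), hk₂ h⟩
    · rw [le_antisymm hij (k'.monotone h)]
      exact ⟨le_rfl, le_rfl⟩
  have hv' : stdSimplex.map k' v = (H.prismWeight x (stdSimplex.map θ t) s).1 := by
    have h₁ : stdSimplex.map (fun p : Fin (m.len + 1) ×ₗ Fin 2 =>
        (toLex (θ (ofLex p).1, (ofLex p).2) : Fin (n.len + 1) ×ₗ Fin 2))
          (H.prismWeight (X.map θ.op x) t s).1 = (H.prismWeight x (stdSimplex.map θ t) s).1 := by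
      refine map_distribution (hγ := measurableSet_prismStep t s) _
        (measurableSet_prismStep _ s) fun a ha => ?_
      simp only [prismStep]
      congr 2
      exact (step_map θ.toOrderHom t ha).symm
    rw [← h₁, ← hv]
    exact (stdSimplex.map_comp_apply k (fun p : Fin (m.len + 1) ×ₗ Fin 2 =>
        (toLex (θ (ofLex p).1, (ofLex p).2) : Fin (n.len + 1) ×ₗ Fin 2)) v).symm
  refine ((H.prism (X.map θ.op x)).point_eq _ k hk v hv).trans ?_
  refine Eq.trans ?_ ((H.prism x).point_eq _ k' hk' v hv').symm
  congr 1
  simp only [prism]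
  rw [← Functor.map_comp_apply]
  rfl

/-- When the cut takes the constant value `e` on `[0, 1)`, the weight is the image of `t` under `i ↦
(i, e)`. This computes the two ends of the homotopy. -/
theorem prismMap_const {n : SimplexCategory} (x : X.obj (op n)) (t : Tsx n) (s : unitInterval)
    (e : Fin 2) (he : ∀ y ∈ Ico (0 : ℝ) 1, (if y < s then (0 : Fin 2) else 1) = e) :
    H.prismMap x (t, s) = pt (H.toFun x (monoHom (m := n) (n := .mk 1) (fun _ => e)
      (fun _ _ _ => le_rfl))) t := by
  let k : Fin (n.len + 1) →o Fin (n.len + 1) ×ₗ Fin 2 :=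
    ⟨fun i => toLex (i, e), fun i j hij => Prod.Lex.toLex_mono ⟨hij, le_rfl⟩⟩
  have hk : (H.prism x).adm (range k) := by
    rintro _ ⟨i, rfl⟩ _ ⟨j, rfl⟩ hij
    rcases le_total i j with h | h
    · exact ⟨h, le_rfl⟩
    · rw [le_antisymm hij (k.monotone h)]
      exact ⟨le_rfl, le_rfl⟩
  have hv : stdSimplex.map k t = (H.prismWeight x t s).1 := by
    nth_rw 1 [← distribution_step t]
    refine map_distribution _ (measurableSet_prismStep t s) fun a ha => ?_
    simp only [prismStep, he a ha]
    rfl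
  refine ((H.prism x).point_eq _ k hk t hv).trans ?_
  congr 1
  simp only [prism]
  congr 1
  exact Functor.map_id_apply X _ x

/-- The map from the realization to the path space of the target. -/
noncomputable def toPath : C(SSet.toTop.obj X, C(unitInterval, SSet.toTop.obj Y)) :=
  desc (fun n x => ContinuousMap.curry ⟨H.prismMap x,
      (H.prism x).continuous_point.comp (H.continuous_prismWeight x)⟩)
    (fun θ x t => by
      ext s
      exact H.prismMap_map θ x t s)

theorem toPath_pt {n : SimplexCategory} (x : X.obj (op n)) (t : Tsx n) (s : unitInterval) :
    H.toPath (pt x t) s = H.prismMap x (t, s) := by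
  rw [toPath, desc_pt]
  · rfl
  · intro m n θ x t
    ext s
    exact H.prismMap_map θ x t s

/-- Simplicially homotopic maps have homotopic realizations. -/
theorem homotopic (H : SimplicialHomotopy f g) : ContinuousMap.Homotopic (SSet.toTop.map f).hom (SSet.toTop.map g).hom := by
  have h₁ : ∀ z, H.toPath z 1 = SSet.toTop.map f z := by
    refine fun z => DFunLike.congr_fun (f := (⟨fun z => H.toPath z 1, by fun_prop⟩ :
      C(SSet.toTop.obj X, SSet.toTop.obj Y))) (g := (SSet.toTop.map f).hom) (hom_ext ?_) z
    intro n x t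
    change H.toPath (pt x t) 1 = SSet.toTop.map f (pt x t)
    rw [toPath_pt, toTop_map_pt, H.prismMap_const x t 1 0, H.toFun_zero _ _ fun _ => rfl]
    intro y hy
    simp [hy.2]
  have h₀ : ∀ z, H.toPath z 0 = SSet.toTop.map g z := by
    refine fun z => DFunLike.congr_fun (f := (⟨fun z => H.toPath z 0, by fun_prop⟩ :
      C(SSet.toTop.obj X, SSet.toTop.obj Y))) (g := (SSet.toTop.map g).hom) (hom_ext ?_) z
    intro n x t
    change H.toPath (pt x t) 0 = SSet.toTop.map g (pt x t)
    rw [toPath_pt, toTop_map_pt, H.prismMap_const x t 0 1, H.toFun_one _ _ fun _ => rfl]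
    intro y hy
    simp [not_lt.mpr hy.1]
  -- Positions before the cut have value `0`, so the path runs from `g` at parameter `0` to `f` at
  -- parameter `1`; the homotopy is reversed.
  refine ContinuousMap.Homotopic.symm ⟨⟨⟨fun p => H.toPath p.2 p.1, by fun_prop⟩, h₀, h₁⟩⟩

end SimplicialHomotopy
end Homotopy
end Realization

/-! ### Edgewise subdivision into three parts -/

namespace Realization
open Opposite MeasureTheory Set Filter Topology

section Triple

/-- The object `[n] * [n] * [n]`. -/
def tripleObj (n : SimplexCategory) : SimplexCategory := .mk (3 * n.len + 2)

theorem incl_lt {n : SimplexCategory} (e : Fin 3) (i : Fin (n.len + 1)) :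
    e.val * (n.len + 1) + i.val < (tripleObj n).len + 1 := by
  have h : e.val * (n.len + 1) ≤ 2 * (n.len + 1) := Nat.mul_le_mul_right _ (by omega)
  have := i.2
  change _ < 3 * n.len + 2 + 1
  omega

/-- The inclusion of the part `e` into `[n] * [n] * [n]`. -/
def incl {n : SimplexCategory} (e : Fin 3) : n ⟶ tripleObj n :=
  monoHom (fun i => ⟨e.val * (n.len + 1) + i.val, incl_lt e i⟩) fun i j h => by
    change e.val * (n.len + 1) + i.val ≤ e.val * (n.len + 1) + j.val
    exact Nat.add_le_add_left h _

theorem incl_le_incl {n : SimplexCategory} {e e' : Fin 3} (h : e < e') (i j : Fin (n.len + 1)) :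
    incl e i ≤ incl e' j := by
  change e.val * (n.len + 1) + i.val ≤ e'.val * (n.len + 1) + j.val
  have h₁ : (e.val + 1) * (n.len + 1) ≤ e'.val * (n.len + 1) := Nat.mul_le_mul_right _ h
  have := i.2
  rw [Nat.succ_mul] at h₁
  omega

theorem exists_incl {n : SimplexCategory} (x : Fin ((tripleObj n).len + 1)) :
    ∃ (e : Fin 3) (i : Fin (n.len + 1)), incl e i = x := by
  have hx : x.val < 3 * n.len + 2 + 1 := x.2
  have hlt : x.val / (n.len + 1) < 3 := by
    rw [Nat.div_lt_iff_lt_mul (by omega)]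
    omega
  refine ⟨⟨x.val / (n.len + 1), hlt⟩, ⟨x.val % (n.len + 1), Nat.mod_lt _ (by omega)⟩, ?_⟩
  apply Fin.ext
  change x.val / (n.len + 1) * (n.len + 1) + x.val % (n.len + 1) = x.val
  rw [mul_comm]
  exact Nat.div_add_mod _ _

/-- The three inclusions are jointly surjective, so maps out of a threefold join are compared part
by part. -/
theorem triple_hom_ext {m n : SimplexCategory} {f g : tripleObj m ⟶ n}
    (h : ∀ e : Fin 3, incl e ≫ f = incl e ≫ g) : f = g := by
  apply ConcreteCategory.hom_ext
  intro x
  obtain ⟨e, i, rfl⟩ := exists_incl x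
  exact ConcreteCategory.congr_hom (h e) i

/-- The map out of `[m] * [m] * [m]` given by three successive maps. -/
def join {m n : SimplexCategory} (a : Fin 3 → (m ⟶ n))
    (ha : ∀ e e', e < e' → ∀ i j, a e i ≤ a e' j) : tripleObj m ⟶ n :=
  monoHom (fun x => a ⟨x.val / (m.len + 1), by
      have hx : x.val < 3 * m.len + 2 + 1 := x.2
      rw [Nat.div_lt_iff_lt_mul (by omega)]
      omega⟩ ⟨x.val % (m.len + 1), Nat.mod_lt _ (by omega)⟩) fun x y hxy => by
    have hxy' : x.val ≤ y.val := hxy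
    have hd : x.val / (m.len + 1) ≤ y.val / (m.len + 1) := Nat.div_le_div_right hxy'
    rcases hd.lt_or_eq with h | h
    · exact ha _ _ h _ _
    · have hm : x.val % (m.len + 1) ≤ y.val % (m.len + 1) := by
        have h₁ := Nat.div_add_mod x.val (m.len + 1)
        have h₂ := Nat.div_add_mod y.val (m.len + 1)
        rw [h] at h₁
        omega
      simp only [h]
      exact (a _).toOrderHom.monotone hm

theorem incl_join {m n : SimplexCategory} (a : Fin 3 → (m ⟶ n))
    (ha : ∀ e e', e < e' → ∀ i j, a e i ≤ a e' j) (e : Fin 3) : incl e ≫ join a ha = a e := by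
  apply ConcreteCategory.hom_ext
  intro i
  have hd : (e.val * (m.len + 1) + i.val) / (m.len + 1) = e.val := by
    rw [mul_comm, Nat.mul_add_div (by omega), Nat.div_eq_of_lt i.2, add_zero]
  have hm : (e.val * (m.len + 1) + i.val) % (m.len + 1) = i.val := by
    rw [mul_comm, Nat.mul_add_mod, Nat.mod_eq_of_lt i.2]
  change a ⟨(e.val * (m.len + 1) + i.val) / (m.len + 1), _⟩
    ⟨(e.val * (m.len + 1) + i.val) % (m.len + 1), _⟩ = a e i
  simp only [hd, hm, Fin.eta]

/-- The functor `[n] ↦ [n] * [n] * [n]`. -/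
def triple : SimplexCategory ⥤ SimplexCategory where
  obj n := tripleObj n
  map θ := join (fun e => θ ≫ incl e) fun _ _ h _ _ => incl_le_incl h _ _
  map_id _ := triple_hom_ext fun _ =>
    (incl_join _ _ _).trans ((Category.id_comp _).trans (Category.comp_id _).symm)
  map_comp θ θ' := triple_hom_ext fun e =>
    (incl_join _ _ _).trans <| (Category.assoc _ _ _).trans <|
      (congrArg (θ ≫ ·) (incl_join (fun e => θ' ≫ incl e) _ e)).symm.trans <|
      (Category.assoc _ _ _).symm.trans <|
      (congrArg (· ≫ join _ _) (incl_join (fun e => θ ≫ incl e) _ e)).symm.trans <|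
      Category.assoc _ _ _

theorem incl_triple_map {m n : SimplexCategory} (θ : m ⟶ n) (e : Fin 3) :
    incl e ≫ triple.map θ = θ ≫ incl e :=
  incl_join _ _ _

theorem join_comp {l m n : SimplexCategory} (a : Fin 3 → (l ⟶ m))
    (ha : ∀ e e', e < e' → ∀ i j, a e i ≤ a e' j) (θ : m ⟶ n) :
    join a ha ≫ θ = join (fun e => a e ≫ θ)
      (fun e e' h i j => θ.toOrderHom.monotone (ha e e' h i j)) :=
  triple_hom_ext fun e => (Category.assoc _ _ _).symm.trans <|
    (congrArg (· ≫ θ) (incl_join a ha e)).trans (incl_join (fun e => a e ≫ θ) _ e).symm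

theorem triple_map_join {l m n : SimplexCategory} (θ : l ⟶ m) (a : Fin 3 → (m ⟶ n))
    (ha : ∀ e e', e < e' → ∀ i j, a e i ≤ a e' j) :
    triple.map θ ≫ join a ha = join (fun e => θ ≫ a e) (fun e e' h _ _ => ha e e' h _ _) :=
  triple_hom_ext fun e => (Category.assoc _ _ _).symm.trans <|
    (congrArg (· ≫ join a ha) (incl_triple_map θ e)).trans <| (Category.assoc _ _ _).trans <|
    (congrArg (θ ≫ ·) (incl_join a ha e)).trans (incl_join (fun e => θ ≫ a e) _ e).symm

theorem map_map_op (X : SSet.{u}) {l m n : SimplexCategory} (f : l ⟶ m) (g : m ⟶ n)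
    (x : X.obj (op n)) : X.map f.op (X.map g.op x) = X.map (f ≫ g).op x := by
  rw [op_comp, Functor.map_comp_apply]

/-- The threefold edgewise subdivision. -/
def subdivision (X : SSet.{u}) : SSet.{u} := triple.op ⋙ X

/-- Restriction of the subdivision to its part `e`. -/
def restrictPart (X : SSet.{u}) (e : Fin 3) : subdivision X ⟶ X where
  app n := X.map (incl (n := n.unop) e).op
  naturality n m θ := by
    ext x
    exact (map_map_op X _ _ x).trans <|
      (congrArg (fun f => X.map (Quiver.Hom.op f) x) (incl_triple_map θ.unop e)).trans
        (map_map_op X _ _ x).symm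

end Triple

/-! ### Splitting the realization along the threefold subdivision. -/

section Split
variable {X : SSet.{u}}

theorem monotone_part {n m : ℕ} (g : Fin m →o Lex (Fin 3 → Fin n))
    (h : ∀ p ∈ range g, ∀ q ∈ range g, p ≤ q → ofLex p ≤ ofLex q) (e : Fin 3) :
    Monotone (fun i => ofLex (g i) e) :=
  fun _ _ hij => h _ ⟨_, rfl⟩ _ ⟨_, rfl⟩ (g.monotone hij) e

/-- The simplices of the subdivision of a simplex `x`. -/
def splitFamily {n : SimplexCategory} (x : X.obj (op n)) :
    ChainFamily (Lex (Fin 3 → Fin (n.len + 1))) (subdivision X) where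
  adm s := (∀ p ∈ s, ∀ q ∈ s, p ≤ q → ofLex p ≤ ofLex q) ∧
    ∀ p ∈ s, ∀ q ∈ s, ∀ e e' : Fin 3, e < e' → ofLex p e ≤ ofLex q e'
  adm_mono h hs := ⟨fun p hp q hq => h.1 p (hs hp) q (hs hq), fun p hp q hq => h.2 p (hs hp) q (hs hq)⟩
  simplex {m} g hg := X.map (join (m := m) (n := n) (fun e => monoHom _ (monotone_part g hg.1 e))
    fun e e' h i j => hg.2 _ ⟨i, rfl⟩ _ ⟨j, rfl⟩ e e' h).op x
  map_simplex θ _ _ _ := (map_map_op X _ _ x).trans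
    (congrArg (fun f => X.map (Quiver.Hom.op f) x) (triple_map_join θ _ _))

/-- The point `(x + e) / 3` of the part `e` of the unit interval. -/
noncomputable def third (e : Fin 3) (x : ℝ) : ℝ := (x + (e.val : ℝ)) / 3

theorem third_mem (e : Fin 3) {x : ℝ} (hx : x ∈ Ico (0 : ℝ) 1) : third e x ∈ Ico (0 : ℝ) 1 := by
  have h : (e.val : ℝ) ≤ 2 := by exact_mod_cast Nat.le_of_lt_succ e.2
  have h' : (0 : ℝ) ≤ e.val := Nat.cast_nonneg _
  obtain ⟨h₁, h₂⟩ := hx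
  constructor
  · unfold third; positivity
  · unfold third; linarith

/-- The step function on the subdivision of a simplex. -/
noncomputable def splitStep {n : SimplexCategory} (t : Tsx n) (x : ℝ) :
    Lex (Fin 3 → Fin (n.len + 1)) :=
  toLex fun e => step t (third e x)

theorem measurable_third (e : Fin 3) : Measurable (third e) := by
  unfold third; fun_prop

theorem measurableSet_splitStep {n : SimplexCategory} (t : Tsx n)
    (p : Lex (Fin 3 → Fin (n.len + 1))) :
    MeasurableSet {x | x ∈ Ico (0 : ℝ) 1 ∧ splitStep t x = p} := by
  have : {x | x ∈ Ico (0 : ℝ) 1 ∧ splitStep t x = p} =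
      ⋂ e : Fin 3, {x | x ∈ Ico (0 : ℝ) 1 ∧ step t (third e x) = ofLex p e} := by
    ext x
    simp only [mem_ofPred_eq, mem_iInter]
    constructor
    · rintro ⟨hx, rfl⟩ e
      exact ⟨hx, rfl⟩
    · intro h
      exact ⟨(h 0).1, funext fun e => (h e).2⟩
  rw [this]
  exact MeasurableSet.iInter fun e =>
    measurableSet_step t (measurable_third e) (fun _ hx => third_mem e hx) _

/-- The weight on the subdivision defined by a point of a simplex. -/
noncomputable def splitWeight {n : SimplexCategory} (x : X.obj (op n)) (t : Tsx n) :
    (splitFamily x).Weights :=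
  ⟨distribution (splitStep t) (measurableSet_splitStep t), by
    refine ⟨fun p hp q hq hpq => ?_, fun p hp q hq e e' hee' => ?_⟩ <;>
      obtain ⟨a, ha, rfl⟩ := exists_of_mem_supp hp <;>
      obtain ⟨b, hb, rfl⟩ := exists_of_mem_supp hq
    · have key : ∀ {a b : ℝ}, a ∈ Ico (0 : ℝ) 1 → b ∈ Ico (0 : ℝ) 1 → a ≤ b →
          ofLex (splitStep t a) ≤ ofLex (splitStep t b) := fun ha hb hab e =>
        step_mono t (third_mem e ha) (third_mem e hb) (by unfold third; linarith)
      rcases le_total a b with hab | hab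
      · exact key ha hb hab
      · rw [le_antisymm hpq (Pi.toLex_monotone (key hb ha hab))]
    -- A point of an earlier third precedes every point of a later one, wherever the two points lie
    -- within their thirds: `a < 1` and `0 ≤ b`.
    · refine step_mono t (third_mem e ha) (third_mem e' hb) ?_
      have h : (e.val : ℝ) + 1 ≤ e'.val := by exact_mod_cast hee'
      have := ha.2
      have := hb.1
      unfold third
      linarith⟩

theorem continuous_splitWeight {n : SimplexCategory} (x : X.obj (op n)) :
    Continuous (splitWeight x) := by
  refine Continuous.subtype_mk ?_ _
  refine continuous_distribution (fun t : Tsx n => splitStep t) measurableSet_splitStep fun t₀ => ?_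
  -- The exceptional positions are those carried to a jump of the step function by one of the three
  -- injective rescalings.
  refine ⟨⋃ e : Fin 3, third e ⁻¹' ((Finset.range (n.len + 1)).image (cum t₀) : Set ℝ), ?_, ?_⟩
  · refine countable_iUnion fun e => Countable.preimage (Finset.countable_toSet _) ?_
    intro a b h
    unfold third at h
    linarith
  · intro a ha ha'
    have h : ∀ e, ∀ᶠ t : Tsx n in 𝓝 t₀, step t (third e a) = step t₀ (third e a) := fun e => by
      refine eventually_step continuousAt_id continuousAt_const (fun _ => third_mem e ha)
        fun k hk hne => ?_
      exact ha' (mem_iUnion.mpr ⟨e, Finset.mem_coe.mpr (Finset.mem_image.mpr ⟨k, hk, hne.symm⟩)⟩)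
    filter_upwards [eventually_all.mpr h] with t ht
    exact congrArg toLex (funext ht)

/-- A representative of the left-hand point becomes one of the right-hand point when `θ` is applied
in all three coordinates; the weights correspond by `step_map`, used on each third separately. -/
theorem split_map {m n : SimplexCategory} (θ : m ⟶ n) (x : X.obj (op n)) (t : Tsx m) :
    (splitFamily (X.map θ.op x)).point (splitWeight (X.map θ.op x) t) =
      (splitFamily x).point (splitWeight x (stdSimplex.map θ t)) := by
  obtain ⟨l, k, hk, v, hv⟩ := (splitFamily (X.map θ.op x)).exists_representative
    (splitWeight (X.map θ.op x) t)
  have hk₁ := monotone_part k hk.1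
  let f : Lex (Fin 3 → Fin (m.len + 1)) → Lex (Fin 3 → Fin (n.len + 1)) :=
    fun p => toLex fun e => θ (ofLex p e)
  let k' : Fin (l.len + 1) →o Lex (Fin 3 → Fin (n.len + 1)) :=
    ⟨fun i => f (k i), fun i j hij =>
      Pi.toLex_monotone fun e => θ.toOrderHom.monotone (hk₁ e hij)⟩
  have hk' : (splitFamily x).adm (range k') := by
    constructor
    · rintro _ ⟨i, rfl⟩ _ ⟨j, rfl⟩ hij
      rcases le_total i j with h | h
      · exact fun e => θ.toOrderHom.monotone (hk₁ e h)
      · rw [le_antisymm hij (k'.monotone h)]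
    · rintro _ ⟨i, rfl⟩ _ ⟨j, rfl⟩ e e' hee'
      exact θ.toOrderHom.monotone (hk.2 _ ⟨i, rfl⟩ _ ⟨j, rfl⟩ e e' hee')
  have hv' : stdSimplex.map k' v = (splitWeight x (stdSimplex.map θ t)).1 := by
    have h₁ : stdSimplex.map f (splitWeight (X.map θ.op x) t).1 =
        (splitWeight x (stdSimplex.map θ t)).1 := by
      refine map_distribution (hγ := measurableSet_splitStep t) _
        (measurableSet_splitStep _) fun a ha => ?_
      exact congrArg toLex (funext fun e => (step_map θ.toOrderHom t (third_mem e ha)).symm)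
    rw [← h₁, ← hv]
    exact (stdSimplex.map_comp_apply k f v).symm
  refine ((splitFamily (X.map θ.op x)).point_eq _ k hk v hv).trans ?_
  refine Eq.trans ?_ ((splitFamily x).point_eq _ k' hk' v hv').symm
  refine congrArg (fun y => pt (X := subdivision X) (n := l) y v) ?_
  exact (map_map_op X _ _ x).trans
    (congrArg (fun f => X.map (Quiver.Hom.op f) x) (join_comp _ _ θ))

variable (X) in
/-- The comparison map from the realization to the realization of the subdivision. -/
noncomputable def split : C(SSet.toTop.obj X, SSet.toTop.obj (subdivision X)) :=
  desc (fun _ x => ⟨fun t => (splitFamily x).point (splitWeight x t),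
    (splitFamily x).continuous_point.comp (continuous_splitWeight x)⟩) split_map

theorem split_pt {n : SimplexCategory} (x : X.obj (op n)) (t : Tsx n) :
    split X (pt x t) = (splitFamily x).point (splitWeight x t) :=
  desc_pt _ split_map x t

/-- The reparametrization of the unit interval from its first third to the identity. -/
noncomputable def stretch (s : unitInterval) (x : ℝ) : ℝ := x * ((1 + 2 * (s : ℝ)) / 3)

theorem stretch_mem (s : unitInterval) {x : ℝ} (hx : x ∈ Ico (0 : ℝ) 1) :
    stretch s x ∈ Ico (0 : ℝ) 1 := by
  have h₀ := s.2.1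
  have h₁ := s.2.2
  have hc : 0 ≤ (1 + 2 * (s : ℝ)) / 3 := by positivity
  have hc' : (1 + 2 * (s : ℝ)) / 3 ≤ 1 := by linarith
  exact ⟨mul_nonneg hx.1 hc, lt_of_le_of_lt (mul_le_of_le_one_right hx.1 hc') hx.2⟩

theorem measurableSet_stretch {n : SimplexCategory} (t : Tsx n) (s : unitInterval)
    (p : Fin (n.len + 1)) : MeasurableSet {x | x ∈ Ico (0 : ℝ) 1 ∧ step t (stretch s x) = p} :=
  measurableSet_step t (by unfold stretch; fun_prop) (fun _ hx => stretch_mem s hx) p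

/-- The natural deformation of a simplex by reparametrization. -/
noncomputable def deform {n : SimplexCategory} (z : Tsx n × unitInterval) : Tsx n :=
  distribution (fun x => step z.1 (stretch z.2 x)) (measurableSet_stretch z.1 z.2)

theorem continuous_deform {n : SimplexCategory} : Continuous (deform (n := n)) := by
  refine continuous_distribution (fun (z : Tsx n × unitInterval) x => step z.1 (stretch z.2 x))
    (fun z => measurableSet_stretch z.1 z.2) fun z₀ => ?_
  refine ⟨stretch z₀.2 ⁻¹' ((Finset.range (n.len + 1)).image (cum z₀.1) : Set ℝ), ?_, ?_⟩
  · refine Countable.preimage (Finset.countable_toSet _) ?_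
    have h₀ := z₀.2.2.1
    -- The scaling factor is at least `1/3`, hence nonzero, so only countably many positions are
    -- carried to one of the finitely many jumps.
    exact mul_left_injective₀ (by positivity)
  · intro a ha ha'
    refine eventually_step continuousAt_fst ?_ (fun _ => stretch_mem _ ha) fun k hk hne => ?_
    · unfold stretch
      fun_prop
    · exact ha' (Finset.mem_coe.mpr (Finset.mem_image.mpr ⟨k, hk, hne.symm⟩))

theorem deform_map {m n : SimplexCategory} (θ : m ⟶ n) (t : Tsx m) (s : unitInterval) :
    stdSimplex.map θ (deform (t, s)) = deform (stdSimplex.map θ t, s) :=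
  map_distribution (hγ := measurableSet_stretch t s) _ (measurableSet_stretch _ s) fun _ ha =>
    (step_map θ.toOrderHom t (stretch_mem s ha)).symm

theorem deform_one {n : SimplexCategory} (t : Tsx n) : deform (t, 1) = t := by
  refine Eq.trans ?_ (distribution_step t)
  simp only [deform]
  congr 1
  funext x
  congr 1
  simp only [stretch, Set.Icc.coe_one]
  norm_num

/-- Restriction to the first part forgets two of the three step functions. What remains is the
distribution of `x ↦ step t (x / 3)`, the starting value of the deformation. -/
theorem restrictPart_split_pt {n : SimplexCategory} (x : X.obj (op n)) (t : Tsx n) :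
    SSet.toTop.map (restrictPart X 0) (split X (pt x t)) = pt x (deform (t, 0)) := by
  rw [split_pt]
  obtain ⟨l, k, hk, v, hv⟩ := (splitFamily x).exists_representative (splitWeight x t)
  rw [(splitFamily x).point_eq _ k hk v hv, toTop_map_pt]
  have h₁ : (restrictPart X 0).app (op l) ((splitFamily x).simplex k hk) =
      X.map (monoHom (m := l) (n := n) _ (monotone_part k hk.1 0)).op x := by
    exact (map_map_op X _ _ x).trans
      (congrArg (fun f => X.map (Quiver.Hom.op f) x) (incl_join _ _ 0))
  refine (congrArg (fun y => pt (X := X) (n := l) y v) h₁).trans ((pt_map _ _ _).trans ?_)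
  congr 1
  have h₂ : stdSimplex.map (fun p : Lex (Fin 3 → Fin (n.len + 1)) => ofLex p 0)
      (splitWeight x t).1 = deform (t, 0) := by
    refine map_distribution (hγ := measurableSet_splitStep t) _ (measurableSet_stretch t 0)
      fun a ha => ?_
    simp [splitStep, third, stretch, div_eq_mul_inv]
  rw [← h₂, ← hv]
  exact (stdSimplex.map_comp_apply k (fun p : Lex (Fin 3 → Fin (n.len + 1)) => ofLex p 0) v).symm

variable (X) in
/-- Splitting and restricting to the first part is homotopic to the identity. -/
theorem restrictPart_split_homotopic : ContinuousMap.Homotopic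
    ((SSet.toTop.map (restrictPart X 0)).hom.comp (split X)) (ContinuousMap.id _) := by
  -- The rescaling is stretched from the first third to the whole interval. Every intermediate point
  -- stays in the same simplex, and the deformation commutes with simplicial operators, so the paths
  -- glue.
  let φ : ∀ n : SimplexCategory, X.obj (op n) → C(Tsx n, C(unitInterval, SSet.toTop.obj X)) :=
    fun n x => ContinuousMap.curry ⟨fun z => pt x (deform z),
      (continuous_pt x).comp continuous_deform⟩
  have hφ : ∀ {m n : SimplexCategory} (θ : m ⟶ n) (x : X.obj (op n)) (t : Tsx m),
      φ m (X.map θ.op x) t = φ n x (stdSimplex.map θ t) := by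
    intro m n θ x t
    ext s
    change pt (X.map θ.op x) (deform (t, s)) = pt x (deform (stdSimplex.map θ t, s))
    rw [pt_map, deform_map]
  let P := desc φ hφ
  have hP : ∀ {n : SimplexCategory} (x : X.obj (op n)) (t : Tsx n) (s : unitInterval),
      P (pt x t) s = pt x (deform (t, s)) := fun x t s =>
    congrArg (fun γ : C(unitInterval, SSet.toTop.obj X) => γ s) (desc_pt φ hφ x t)
  refine ⟨⟨⟨fun p => P p.2 p.1, by fun_prop⟩, fun z => ?_, fun z => ?_⟩⟩
  · refine DFunLike.congr_fun (f := (⟨fun z => P z 0, by fun_prop⟩ :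
      C(SSet.toTop.obj X, SSet.toTop.obj X))) (hom_ext ?_) z
    intro n x t
    exact (hP x t 0).trans (restrictPart_split_pt x t).symm
  · refine DFunLike.congr_fun (f := (⟨fun z => P z 1, by fun_prop⟩ :
      C(SSet.toTop.obj X, SSet.toTop.obj X))) (hom_ext ?_) z
    intro n x t
    exact (hP x t 1).trans (congrArg _ (deform_one t))

end Split
end Realization

/-! ### Functoriality of the classifying space -/

namespace TwoDiag
open Opposite

/-! ### Diagrams of 1-cells and their whiskering. -/

section Columns
variable {B : Type u} [Bicategory.{w, v} B]

/-- Applied to identities, the hypothesis already determines the values on objects, so no separate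
comparison of objects is needed. -/
theorem functor_eq_of_cell {J : Type u₁} [Category.{v₁} J] {x y : B} {U V : J ⥤ (x ⟶ y)}
    (h : ∀ {i j : J} (f : i ⟶ j), Cell.mk (U.map f) = Cell.mk (V.map f)) : U = V := by
  have hobj : ∀ i, U.obj i = V.obj i := fun i => by
    have := h (𝟙 i)
    rw [U.map_id, V.map_id] at this
    injection this
  exact CategoryTheory.Functor.ext hobj fun i j f => Cell.inj <| (h f).trans <|
    ((Cell.eqToHom_comp _ _).trans (Cell.comp_eqToHom _ _)).symm

theorem Cell.functor_map {J : Type u₁} [Category.{v₁} J] {x y : B} {U V : J ⥤ (x ⟶ y)}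
    (h : U = V) {i j : J} (f : i ⟶ j) : Cell.mk (U.map f) = Cell.mk (V.map f) := by
  rw [h]

theorem Cell.app_eqToHom {J : Type u₁} [Category.{v₁} J] {x y : B} {U U' V V' : J ⥤ (x ⟶ y)}
    (h : U = U') (h' : V' = V) (η : U' ⟶ V') (i : J) :
    Cell.mk ((CategoryTheory.eqToHom h ≫ η ≫ CategoryTheory.eqToHom h').app i) =
      Cell.mk (η.app i) := by
  subst h h'; simp

variable {J : Type} [SmallCategory J]

/-- Whiskering a transformation of diagrams of 1-cells on the left. -/
def hcompLeft {x y z : B} (U : J ⥤ (x ⟶ y)) {S T : J ⥤ (y ⟶ z)} (η : S ⟶ T) :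
    Column.hcomp U S ⟶ Column.hcomp U T where
  app i := U.obj i ◁ η.app i
  naturality i j f := by
    change (U.map f ▷ S.obj i ≫ U.obj j ◁ S.map f) ≫ U.obj j ◁ η.app j =
      U.obj i ◁ η.app i ≫ U.map f ▷ T.obj i ≫ U.obj j ◁ T.map f
    rw [Category.assoc, ← whiskerLeft_comp, η.naturality, whiskerLeft_comp,
      whisker_exchange_assoc]

/-- Whiskering a transformation of diagrams of 1-cells on the right. -/
def hcompRight {x y z : B} {S T : J ⥤ (x ⟶ y)} (η : S ⟶ T) (U : J ⥤ (y ⟶ z)) :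
    Column.hcomp S U ⟶ Column.hcomp T U where
  app i := η.app i ▷ U.obj i
  naturality i j f := by
    change (S.map f ▷ U.obj i ≫ S.obj j ◁ U.map f) ≫ η.app j ▷ U.obj j =
      η.app i ▷ U.obj i ≫ T.map f ▷ U.obj i ≫ T.obj j ◁ U.map f
    rw [Category.assoc, whisker_exchange, ← comp_whiskerRight_assoc, η.naturality,
      comp_whiskerRight_assoc]

end Columns

section Functoriality
variable {A B : Type u} [Bicategory.{w, v} A] [Bicategory.{w, v} B]

theorem mapFunctor_hcomp (F : StrictPseudofunctor A B) {J : Type} [SmallCategory J] {x y z : A}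
    (U : J ⥤ (x ⟶ y)) (V : J ⥤ (y ⟶ z)) :
    Column.hcomp U V ⋙ F.mapFunctor x z =
      Column.hcomp (U ⋙ F.mapFunctor x y) (V ⋙ F.mapFunctor y z) :=
  functor_eq_of_cell fun _ => (Cell.map_comp F _ _).trans
    (Cell.vcomp (Cell.map_right F _ _) (Cell.map_left F _ _))

theorem mapFunctor_const (F : StrictPseudofunctor A B) {J : Type} [SmallCategory J] (x : A) :
    (Functor.const J).obj (𝟙 x) ⋙ F.mapFunctor x x = (Functor.const J).obj (𝟙 (F.obj x)) :=
  functor_eq_of_cell fun _ => (congrArg Cell.mk (F.map₂_id _)).trans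
    (Cell.id (congrArg Arr.mk (F.map_id x)))

variable [Strict A] [Strict B]

/-- The functor on columns induced by a 2-functor. -/
def Column.map (F : StrictPseudofunctor A B) (q : SimplexCategory) : Column A q ⥤ Column B q where
  obj x := ⟨F.obj x.as⟩
  map {x y} U := U ⋙ F.mapFunctor x.as y.as
  map_id x := mapFunctor_const F x.as
  map_comp U V := mapFunctor_hcomp F U V

/-- A simplex of the diagonal, as a string of composable morphisms. -/
abbrev DiagSimplex (B : Type u) [Bicategory.{w, v} B] [Strict B] (n : SimplexCategory) :=
  Fin (n.len + 1) ⥤ Column B n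

/-- Restriction of a diagonal simplex along different maps in the two directions. -/
def DiagSimplex.restrict {m n : SimplexCategory} (σ : DiagSimplex B n) (α β : m ⟶ n) :
    DiagSimplex B m :=
  α.toOrderHom.monotone.functor ⋙ σ ⋙ Column.reindex β

/-- The map of diagonals induced by a 2-functor. -/
def mapDiag (F : StrictPseudofunctor A B) : diagNerve A ⟶ diagNerve B where
  app n := TypeCat.ofHom fun σ : DiagSimplex A n.unop => σ ⋙ Column.map F n.unop
  naturality _ _ _ := rfl

theorem mapDiag_id : mapDiag (StrictPseudofunctor.id A) = 𝟙 (diagNerve A) := rfl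

theorem mapDiag_comp {E : Type u} [Bicategory.{w, v} E] [Strict E]
    (F : StrictPseudofunctor A B) (G : StrictPseudofunctor B E) :
    mapDiag (F.comp G) = mapDiag F ≫ mapDiag G := rfl

end Functoriality
end TwoDiag

/-! ### Lax transformations -/

namespace TwoDiag
open Opposite

theorem whisker_exchange_whiskerLeft {B : Type u} [Bicategory.{w, v} B] {a b c : B} {f g : a ⟶ b}
    {h i k : b ⟶ c} (η : f ⟶ g) (s : h ⟶ i) (t : i ⟶ k) :
    f ◁ s ≫ η ▷ i ≫ g ◁ t = η ▷ h ≫ g ◁ (s ≫ t) := by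
  rw [whisker_exchange_assoc, whiskerLeft_comp]

section Lax
variable {A B : Type u} [Bicategory.{w, v} A] [Bicategory.{w, v} B] [Strict A] [Strict B]

/-- A lax transformation between 2-functors. -/
structure LaxNat (F G : StrictPseudofunctor A B) where
  app : ∀ a : A, F.obj a ⟶ G.obj a
  cell : ∀ {a b : A} (f : a ⟶ b), app a ≫ G.map f ⟶ F.map f ≫ app b
  naturality : ∀ {a b : A} {f g : a ⟶ b} (η : f ⟶ g),
    app a ◁ G.map₂ η ≫ cell g = cell f ≫ F.map₂ η ▷ app b
  cell_id : ∀ a : A, Cell.mk (cell (𝟙 a)) = Cell.mk (𝟙 (app a))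
  cell_comp : ∀ {a b c : A} (f : a ⟶ b) (g : b ⟶ c), Cell.mk (cell (f ≫ g)) =
    Cell.mk (cell f ▷ G.map g ≫ eqToHom (Strict.assoc _ _ _) ≫ F.map f ◁ cell g)

namespace LaxNat
variable {F G : StrictPseudofunctor A B} (θ : LaxNat F G)

/-- The component of a lax transformation, as a constant diagram. -/
abbrev const (J : Type) [SmallCategory J] (x : A) : J ⥤ (F.obj x ⟶ G.obj x) :=
  (Functor.const J).obj (θ.app x)

/-- The cells of a lax transformation at a diagram of 1-cells. -/
def cells {J : Type} [SmallCategory J] {x y : A} (V : J ⥤ (x ⟶ y)) :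
    Column.hcomp (θ.const J x) (V ⋙ G.mapFunctor x y) ⟶
      Column.hcomp (V ⋙ F.mapFunctor x y) (θ.const J y) where
  app i := θ.cell (V.obj i)
  naturality i j f := by
    change (𝟙 (θ.app x) ▷ G.map (V.obj i) ≫ θ.app x ◁ G.map₂ (V.map f)) ≫ θ.cell (V.obj j) =
      θ.cell (V.obj i) ≫ F.map₂ (V.map f) ▷ θ.app y ≫ F.map (V.obj j) ◁ 𝟙 (θ.app y)
    rw [id_whiskerRight, Category.id_comp, whiskerLeft_id, Category.comp_id, θ.naturality]

/-! ### Paths turning from one 2-functor to the other. -/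

section Turning
variable {n : SimplexCategory} (σ : DiagSimplex A n)

/-- The diagram of 1-cells of a diagonal simplex between two of its vertices. -/
abbrev side {i j : Fin (n.len + 1)} (h : i ≤ j) :
    Fin (n.len + 1) ⥤ ((σ.obj i).as ⟶ (σ.obj j).as) :=
  σ.map (homOfLE h)

theorem side_comp {i j k : Fin (n.len + 1)} (h : i ≤ j) (h' : j ≤ k) :
    side σ (h.trans h') = Column.hcomp (side σ h) (side σ h') :=
  σ.map_comp (homOfLE h) (homOfLE h')

theorem side_refl (i : Fin (n.len + 1)) :
    side σ (le_refl i) = (Functor.const _).obj (𝟙 (σ.obj i).as) :=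
  σ.map_id i

/-- The image under `F` of a side of a diagonal simplex. -/
abbrev imageSide (F : StrictPseudofunctor A B) {i j : Fin (n.len + 1)} (h : i ≤ j) :
    Fin (n.len + 1) ⥤ (F.obj (σ.obj i).as ⟶ F.obj (σ.obj j).as) :=
  side σ h ⋙ F.mapFunctor _ _

theorem imageSide_comp (F : StrictPseudofunctor A B) {i j k : Fin (n.len + 1)} (h : i ≤ j)
    (h' : j ≤ k) :
    imageSide σ F (h.trans h') = Column.hcomp (imageSide σ F h) (imageSide σ F h') :=
  (congrArg (· ⋙ F.mapFunctor _ _) (side_comp σ h h')).trans (mapFunctor_hcomp F _ _)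

theorem side_obj_comp {i j k : Fin (n.len + 1)} (h : i ≤ j) (h' : j ≤ k) (l : Fin (n.len + 1)) :
    (side σ (h.trans h')).obj l = (side σ h).obj l ≫ (side σ h').obj l :=
  Functor.congr_obj (side_comp σ h h') l

theorem map_side_obj_comp (F : StrictPseudofunctor A B) {i j k : Fin (n.len + 1)} (h : i ≤ j)
    (h' : j ≤ k) (l : Fin (n.len + 1)) : F.map ((side σ (h.trans h')).obj l) =
      F.map ((side σ h).obj l) ≫ F.map ((side σ h').obj l) := by
  rw [side_obj_comp, F.map_comp]

/-- The path which turns from `F` to `G` at the vertex `p`. -/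
def path {a p c : Fin (n.len + 1)} (ha : a ≤ p) (hc : p ≤ c) :
    Fin (n.len + 1) ⥤ (F.obj (σ.obj a).as ⟶ G.obj (σ.obj c).as) :=
  Column.hcomp (imageSide σ F ha) (Column.hcomp (θ.const _ _) (imageSide σ G hc))

theorem path_left {a a' p c : Fin (n.len + 1)} (h : a ≤ a') (ha : a' ≤ p) (hc : p ≤ c) :
    path θ σ (h.trans ha) hc = Column.hcomp (imageSide σ F h) (path θ σ ha hc) := by
  rw [path, imageSide_comp σ F h ha, Column.hcomp_assoc, path]

theorem path_right {a p c c' : Fin (n.len + 1)} (ha : a ≤ p) (hc : p ≤ c) (h : c ≤ c') :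
    path θ σ ha (hc.trans h) = Column.hcomp (path θ σ ha hc) (imageSide σ G h) := by
  rw [path, imageSide_comp σ G hc h, path, Column.hcomp_assoc, Column.hcomp_assoc]

/-- Moving the turning point. -/
def turn {a p p' c : Fin (n.len + 1)} (ha : a ≤ p) (h : p ≤ p') (hc : p' ≤ c) :
    path θ σ ha (h.trans hc) ⟶ path θ σ (ha.trans h) hc :=
  eqToHom (by rw [path, imageSide_comp σ G h hc, Column.hcomp_assoc]) ≫
    hcompLeft (imageSide σ F ha) (hcompRight (θ.cells (side σ h)) (imageSide σ G hc)) ≫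
    eqToHom (by rw [path, imageSide_comp σ F ha h, Column.hcomp_assoc, Column.hcomp_assoc])

theorem cell_turn {a p p' c : Fin (n.len + 1)} (ha : a ≤ p) (h : p ≤ p') (hc : p' ≤ c)
    (l : Fin (n.len + 1)) : Cell.mk ((turn θ σ ha h hc).app l) =
      Cell.mk (F.map ((side σ ha).obj l) ◁ θ.cell ((side σ h).obj l) ▷
        G.map ((side σ hc).obj l)) :=
  Cell.app_eqToHom _ _ _ l

/-- This is the unit law of the lax transformation, whiskered along the two legs of the path. -/
theorem turn_refl {a p c : Fin (n.len + 1)} (ha : a ≤ p) (hc : p ≤ c) :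
    turn θ σ ha le_rfl hc = 𝟙 (path θ σ ha hc) := by
  ext l
  refine Cell.inj ((cell_turn θ σ ha le_rfl hc l).trans ?_)
  have h₁ : Cell.mk (θ.cell ((side σ (le_refl p)).obj l)) = Cell.mk (𝟙 (θ.app (σ.obj p).as)) := by
    rw [side_refl]
    exact θ.cell_id _
  refine (Cell.left rfl (Cell.right h₁ rfl)).trans ?_
  rw [id_whiskerRight, whiskerLeft_id]
  rfl

/-- This is the composition law of the lax transformation. The legs are regrouped so that the first
2-cell is followed by the `G`-image of the second side and the second is preceded by the `F`-image
of the first. -/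
theorem turn_trans {a p p' p'' c : Fin (n.len + 1)} (ha : a ≤ p) (h : p ≤ p') (h' : p' ≤ p'')
    (hc : p'' ≤ c) : turn θ σ ha (h.trans h') hc =
      turn θ σ ha h (h'.trans hc) ≫ turn θ σ (ha.trans h) h' hc := by
  ext l
  refine Cell.inj ((cell_turn θ σ ha _ hc l).trans ?_)
  have h₁ := θ.cell_comp ((side σ h).obj l) ((side σ h').obj l)
  rw [← side_obj_comp σ h h'] at h₁
  refine (Cell.left rfl (Cell.right h₁ rfl)).trans ?_
  rw [comp_whiskerRight, whiskerLeft_comp, comp_whiskerRight, whiskerLeft_comp]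
  refine Cell.vcomp (Eq.trans (Cell.left rfl ?_) (cell_turn θ σ ha h (h'.trans hc) l).symm)
    (Eq.trans ?_ (cell_turn θ σ (ha.trans h) h' hc l).symm)
  · exact (Cell.right_comp _ _ _).symm.trans
      (Cell.right rfl (congrArg Arr.mk (map_side_obj_comp σ G h' hc l).symm))
  · rw [eqToHom_whiskerRight, whiskerLeft_eqToHom]
    refine (Cell.eqToHom_comp _ _).trans ?_
    refine (Cell.left rfl (Cell.left_right _ _ _)).trans ((Cell.comp_left _ _ _).symm.trans ?_)
    exact Cell.left (congrArg Arr.mk (map_side_obj_comp σ F ha h l).symm) rfl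

/-- The paths with moving turning point. -/
def paths {m : SimplexCategory} (β : m ⟶ n) (a c : Fin (n.len + 1)) (ha : ∀ j, a ≤ β j)
    (hc : ∀ j, β j ≤ c) :
    Fin (m.len + 1) ⥤ Fin (n.len + 1) ⥤ (F.obj (σ.obj a).as ⟶ G.obj (σ.obj c).as) where
  obj j := path θ σ (ha j) (hc j)
  map {j j'} h := turn θ σ (ha j) (β.toOrderHom.monotone (leOfHom h)) (hc j')
  map_id j := turn_refl θ σ (ha j) (hc j)
  map_comp h h' := turn_trans θ σ _ (β.toOrderHom.monotone (leOfHom h))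
    (β.toOrderHom.monotone (leOfHom h')) _

/-- The diagonal of the paths with moving turning point. -/
def diagPath {m : SimplexCategory} (β : m ⟶ n) (a c : Fin (n.len + 1)) (ha : ∀ j, a ≤ β j)
    (hc : ∀ j, β j ≤ c) : Fin (m.len + 1) ⥤ (F.obj (σ.obj a).as ⟶ G.obj (σ.obj c).as) :=
  Functor.prod' (𝟭 _) β.toOrderHom.monotone.functor ⋙
    Functor.uncurry.obj (paths θ σ β a c ha hc)

theorem cell_diagPath {m : SimplexCategory} (β : m ⟶ n) (a c : Fin (n.len + 1))
    (ha : ∀ j, a ≤ β j) (hc : ∀ j, β j ≤ c) {j j' : Fin (m.len + 1)} (h : j ⟶ j') :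
    Cell.mk ((diagPath θ σ β a c ha hc).map h) =
      Cell.mk ((turn θ σ (ha j) (β.toOrderHom.monotone (leOfHom h)) (hc j')).app (β j) ≫
        (path θ σ (ha j') (hc j')).map (β.toOrderHom.monotone.functor.map h)) :=
  rfl

/-- The turning points never lie before `a'`, so starting earlier only prepends the `F`-image of a
side. Its chain of 2-cells and that of the shorter path combine by interchange. -/
theorem diagPath_left {m : SimplexCategory} (β : m ⟶ n) {a a' c : Fin (n.len + 1)} (h : a ≤ a')
    (ha : ∀ j, a' ≤ β j) (hc : ∀ j, β j ≤ c) :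
    diagPath θ σ β a c (fun j => h.trans (ha j)) hc =
      Column.hcomp (β.toOrderHom.monotone.functor ⋙ imageSide σ F h)
        (diagPath θ σ β a' c ha hc) :=
  functor_eq_of_cell fun {j j'} f => by
    refine (cell_diagPath θ σ β a c _ hc f).trans ?_
    refine (Cell.vcomp (η' := F.map ((side σ h).obj (β j)) ◁
        (turn θ σ (ha j) (β.toOrderHom.monotone (leOfHom f)) (hc j')).app (β j))
        ((cell_turn _ _ _ _ _ _).trans ?_)
      (Cell.functor_map (path_left θ σ h (ha j') (hc j')) _)).trans ?_
    · refine Eq.trans ?_ (Cell.left rfl (cell_turn _ _ _ _ _ _).symm)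
      exact (Cell.left (congrArg Arr.mk (map_side_obj_comp σ F h (ha j) _)) rfl).trans
        (Cell.comp_left _ _ _)
    · exact congrArg Cell.mk (whisker_exchange_whiskerLeft _ _ _)

/-- The turning points never lie after `c`, so ending later only appends the `G`-image of a side. -/
theorem diagPath_right {m : SimplexCategory} (β : m ⟶ n) {a c c' : Fin (n.len + 1)}
    (ha : ∀ j, a ≤ β j) (hc : ∀ j, β j ≤ c) (h : c ≤ c') :
    diagPath θ σ β a c' ha (fun j => (hc j).trans h) =
      Column.hcomp (diagPath θ σ β a c ha hc)
        (β.toOrderHom.monotone.functor ⋙ imageSide σ G h) :=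
  functor_eq_of_cell fun {j j'} f => by
    refine (cell_diagPath θ σ β a c' ha _ f).trans ?_
    refine (Cell.vcomp (η' := (turn θ σ (ha j) (β.toOrderHom.monotone (leOfHom f))
        (hc j')).app (β j) ▷ G.map ((side σ h).obj (β j)))
        ((cell_turn _ _ _ _ _ _).trans ?_)
      (Cell.functor_map (path_right θ σ (ha j') (hc j') h) _)).trans ?_
    · refine Eq.trans ?_ (Cell.right (cell_turn _ _ _ _ _ _).symm rfl)
      refine Eq.trans ?_ (Cell.left_right _ _ _).symm
      exact Cell.left rfl ((Cell.right rfl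
        (congrArg Arr.mk (map_side_obj_comp σ G (hc j') h _))).trans (Cell.right_comp _ _ _))
    · exact congrArg Cell.mk (comp_whiskerRight_assoc _ _ _ _).symm

/-- The natural transformation between the images of a diagonal simplex, restricted along
`α ≤ β ≤ γ`. -/
def trans {m : SimplexCategory} (α β γ : m ⟶ n) (hα : ∀ i j, α i ≤ β j) (hγ : ∀ i j, β i ≤ γ j) :
    σ.restrict α β ⋙ Column.map F m ⟶ σ.restrict γ β ⋙ Column.map G m where
  app i := diagPath θ σ β (α i) (γ i) (hα i) (fun j => hγ j i)
  -- Both composites equal the diagonal path from `α i` to `γ i'`. Separating all turning points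
  -- from the values of `α` and `γ` is what makes this strict.
  naturality i i' h :=
    (diagPath_left θ σ β (α.toOrderHom.monotone (leOfHom h)) (hα i') fun j => hγ j i').symm.trans
      (diagPath_right θ σ β (hα i) (fun j => hγ j i) (γ.toOrderHom.monotone (leOfHom h)))

end Turning
end LaxNat
end Lax
end TwoDiag

namespace TwoDiag
open Opposite Realization

/-! ### Simplices of a cylinder between two diagonal simplices. -/

section Cylinder
variable {B : Type u} [Bicategory.{w, v} B] [Strict B]

/-- The simplex which switches from the source to the target of `ν` along `χ`. -/
def switch {n : SimplexCategory} {S T : DiagSimplex B n} (ν : S ⟶ T)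
    (χ : n ⟶ SimplexCategory.mk 1) : DiagSimplex B n :=
  Functor.prod' χ.toOrderHom.monotone.functor (𝟭 _) ⋙
    Functor.uncurry.obj (ComposableArrows.mk₁ ν)

/-- Restriction whiskers the transformation with reindexing functors on both sides, and whiskering
the one-arrow diagram of `ν` gives the one-arrow diagram of the whiskered transformation. -/
theorem switch_restrict {m n : SimplexCategory} {S T : DiagSimplex B n} (ν : S ⟶ T)
    (χ : n ⟶ SimplexCategory.mk 1) (θ : m ⟶ n) : (switch ν χ).restrict θ θ =
      switch (S := S.restrict θ θ) (T := T.restrict θ θ)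
        (Functor.whiskerLeft θ.toOrderHom.monotone.functor
          (Functor.whiskerRight ν (Column.reindex θ))) (θ ≫ χ) := by
  have h : ComposableArrows.mk₁ ν ⋙ (Functor.whiskeringRight _ _ _).obj (Column.reindex θ) ⋙
      (Functor.whiskeringLeft _ _ _).obj θ.toOrderHom.monotone.functor =
      ComposableArrows.mk₁ (Functor.whiskerLeft θ.toOrderHom.monotone.functor
          (Functor.whiskerRight ν (Column.reindex θ))) :=
    ComposableArrows.ext₁ rfl rfl ((Category.id_comp _).trans (Category.comp_id _)).symm
  exact congrArg (fun Ψ => Functor.prod' (θ ≫ χ).toOrderHom.monotone.functor (𝟭 _) ⋙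
    Functor.uncurry.obj Ψ) h

theorem switch_zero {n : SimplexCategory} {S T : DiagSimplex B n} (ν : S ⟶ T)
    (χ : n ⟶ SimplexCategory.mk 1) (h : ∀ i, χ i = 0) : switch ν χ = S := by
  obtain rfl : χ = monoHom (fun _ => 0) (fun _ _ _ => le_rfl) :=
    ConcreteCategory.hom_ext _ _ h
  exact CategoryTheory.Functor.ext (fun _ => rfl) fun i j f =>
    (Category.id_comp (S.map f)).trans
      ((Category.id_comp _).trans (Category.comp_id (S.map f))).symm

theorem switch_one {n : SimplexCategory} {S T : DiagSimplex B n} (ν : S ⟶ T)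
    (χ : n ⟶ SimplexCategory.mk 1) (h : ∀ i, χ i = 1) : switch ν χ = T := by
  obtain rfl : χ = monoHom (fun _ => 1) (fun _ _ _ => le_rfl) :=
    ConcreteCategory.hom_ext _ _ h
  exact CategoryTheory.Functor.ext (fun _ => rfl) fun i j f =>
    (Category.id_comp (T.map f)).trans
      ((Category.id_comp _).trans (Category.comp_id (T.map f))).symm

end Cylinder

/-! ### Homotopies between restrictions to different parts. -/

section Restriction
variable {A : Type u} [Bicategory.{w, v} A] [Strict A]

variable (A) in
/-- Restriction to the part `a` in the first and to the part `b` in the second direction. -/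
def restrictParts (a b : Fin 3) : subdivision (diagNerve A) ⟶ diagNerve A where
  app n := TypeCat.ofHom fun σ : DiagSimplex A (triple.obj n.unop) => σ.restrict (incl a) (incl b)
  naturality n m θ := by
    ext σ
    exact congrArg₂ (DiagSimplex.restrict (n := triple.obj n.unop) σ)
      (incl_triple_map θ.unop a) (incl_triple_map θ.unop b)

/-- The map which switches from the part `a` to the part `a'` along `χ`. -/
def mix {n : SimplexCategory} {a a' : Fin 3} (h : a ≤ a') (χ : n ⟶ SimplexCategory.mk 1) :
    n ⟶ tripleObj n :=
  monoHom (fun i => if χ i = 0 then incl a i else incl a' i) fun i j hij => by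
    have hχ : χ i ≤ χ j := χ.toOrderHom.monotone hij
    have hle : ∀ e : Fin 3, incl e i ≤ incl e j := fun e => (incl e).toOrderHom.monotone hij
    dsimp only
    split_ifs with h₁ h₂ h₂
    · exact hle a
    · rcases h.lt_or_eq with h | rfl
      · exact incl_le_incl h i j
      · exact hle a
    · rw [h₂] at hχ
      exact absurd (Fin.le_zero_iff.mp hχ) h₁
    · exact hle a'

theorem mix_triple_map {m n : SimplexCategory} {a a' : Fin 3} (h : a ≤ a') (θ : m ⟶ n)
    (χ : n ⟶ SimplexCategory.mk 1) : mix h (θ ≫ χ) ≫ triple.map θ = θ ≫ mix h χ := by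
  apply ConcreteCategory.hom_ext
  intro i
  have hi : ∀ e : Fin 3, triple.map θ (incl e i) = incl e (θ i) := fun e =>
    ConcreteCategory.congr_hom (incl_triple_map θ e) i
  change triple.map θ (if χ (θ i) = 0 then incl a i else incl a' i) =
    if χ (θ i) = 0 then incl a (θ i) else incl a' (θ i)
  by_cases hz : χ (θ i) = 0
  · exact (congrArg (triple.map θ) (if_pos hz)).trans ((hi a).trans (if_pos hz).symm)
  · exact (congrArg (triple.map θ) (if_neg hz)).trans ((hi a').trans (if_neg hz).symm)

theorem mix_zero {n : SimplexCategory} {a a' : Fin 3} (h : a ≤ a') (χ : n ⟶ SimplexCategory.mk 1)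
    (hχ : ∀ i, χ i = 0) : mix h χ = incl a :=
  ConcreteCategory.hom_ext _ _ fun i => if_pos (hχ i)

theorem mix_one {n : SimplexCategory} {a a' : Fin 3} (h : a ≤ a') (χ : n ⟶ SimplexCategory.mk 1)
    (hχ : ∀ i, χ i = 1) : mix h χ = incl a' :=
  ConcreteCategory.hom_ext _ _ fun i => if_neg (by rw [hχ i]; decide)

variable (A) in
/-- The homotopy between the restrictions to different parts. -/
def restrictPartsHomotopy {a a' b b' : Fin 3} (ha : a ≤ a') (hb : b ≤ b') :
    SimplicialHomotopy (restrictParts A a b) (restrictParts A a' b') where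
  toFun {n} σ χ := DiagSimplex.restrict (n := triple.obj n) σ (mix ha χ) (mix hb χ)
  map_toFun {_ n} θ σ χ := (congrArg₂ (DiagSimplex.restrict (n := triple.obj n) σ)
    (mix_triple_map ha θ χ) (mix_triple_map hb θ χ)).symm
  toFun_zero {n} σ χ h := congrArg₂ (DiagSimplex.restrict (n := triple.obj n) σ)
    (mix_zero ha χ h) (mix_zero hb χ h)
  toFun_one {n} σ χ h := congrArg₂ (DiagSimplex.restrict (n := triple.obj n) σ)
    (mix_one ha χ h) (mix_one hb χ h)

end Restriction

/-! ### From lax transformations to homotopies. -/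

namespace LaxNat
variable {A B : Type u} [Bicategory.{w, v} A] [Bicategory.{w, v} B] [Strict A] [Strict B]
  {F G : StrictPseudofunctor A B} (θ : LaxNat F G)

/-- A turning path of the restricted simplex sees only the vertices and levels in the image of `t`;
restricting therefore amounts to composing all indices with `t`. -/
theorem diagPath_restrict {l m n : SimplexCategory} (σ : DiagSimplex A n) (t : m ⟶ n) (β : l ⟶ m)
    (a c : Fin (m.len + 1)) (ha : ∀ j, a ≤ β j) (hc : ∀ j, β j ≤ c) :
    diagPath θ (σ.restrict t t) β a c ha hc = diagPath θ σ (β ≫ t) (t a) (t c)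
      (fun j => t.toOrderHom.monotone (ha j)) (fun j => t.toOrderHom.monotone (hc j)) :=
  functor_eq_of_cell fun {j j'} f =>
    Cell.vcomp ((cell_turn θ (σ.restrict t t) (ha j) (β.toOrderHom.monotone (leOfHom f)) (hc j')
        (β j)).trans
      (cell_turn θ σ (t.toOrderHom.monotone (ha j))
        (t.toOrderHom.monotone (β.toOrderHom.monotone (leOfHom f)))
        (t.toOrderHom.monotone (hc j')) (t (β j))).symm) rfl

/-- The switch along the natural transformation of a diagonal simplex. -/
def switchTrans {m n : SimplexCategory} (σ : DiagSimplex A n) (α β γ : m ⟶ n)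
    (hα : ∀ i j, α i ≤ β j) (hγ : ∀ i j, β i ≤ γ j) (χ : m ⟶ SimplexCategory.mk 1) :
    DiagSimplex B m :=
  switch (trans θ σ α β γ hα hγ) χ

theorem switchTrans_restrict {l m n : SimplexCategory} (σ : DiagSimplex A n) (α β γ : m ⟶ n)
    (hα : ∀ i j, α i ≤ β j) (hγ : ∀ i j, β i ≤ γ j) (χ : m ⟶ SimplexCategory.mk 1) (t : l ⟶ m) :
    (switchTrans θ σ α β γ hα hγ χ).restrict t t =
      switchTrans θ σ (t ≫ α) (t ≫ β) (t ≫ γ) (fun i j => hα (t i) (t j))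
        (fun i j => hγ (t i) (t j)) (t ≫ χ) :=
  switch_restrict _ _ _

theorem restrict_switchTrans {l m n : SimplexCategory} (σ : DiagSimplex A n) (t : m ⟶ n)
    (α β γ : l ⟶ m) (hα : ∀ i j, α i ≤ β j) (hγ : ∀ i j, β i ≤ γ j)
    (χ : l ⟶ SimplexCategory.mk 1) : switchTrans θ (σ.restrict t t) α β γ hα hγ χ =
      switchTrans θ σ (α ≫ t) (β ≫ t) (γ ≫ t) (fun i j => t.toOrderHom.monotone (hα i j))
        (fun i j => t.toOrderHom.monotone (hγ i j)) χ := by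
  have h : trans θ (σ.restrict t t) α β γ hα hγ = trans θ σ (α ≫ t) (β ≫ t) (γ ≫ t)
      (fun i j => t.toOrderHom.monotone (hα i j)) (fun i j => t.toOrderHom.monotone (hγ i j)) :=
    NatTrans.ext (funext fun i => diagPath_restrict θ σ t β (α i) (γ i) _ _)
  exact congrArg (switch · χ) h

/-- The simplicial homotopy defined by a lax transformation on the subdivision. -/
def homotopy : SimplicialHomotopy (restrictParts A 0 1 ≫ mapDiag F)
    (restrictParts A 2 1 ≫ mapDiag G) where
  toFun {n} σ χ := switchTrans θ (n := triple.obj n) σ (incl 0) (incl 1) (incl 2)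
    (incl_le_incl (by decide)) (incl_le_incl (by decide)) χ
  map_toFun {m n} t σ χ := by
    refine (switchTrans_restrict θ (n := triple.obj n) σ _ _ _ _ _ χ t).trans ?_
    refine Eq.trans ?_ (restrict_switchTrans θ (m := triple.obj m) (n := triple.obj n) σ
      (triple.map t) _ _ _ _ _ _).symm
    congr 1
    · exact (incl_triple_map t 0).symm
    · exact (incl_triple_map t 1).symm
    · exact (incl_triple_map t 2).symm
  toFun_zero _ χ h := switch_zero _ χ h
  toFun_one _ χ h := switch_one _ χ h

/-- A lax transformation induces a homotopy between classifying spaces. -/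
theorem homotopic (θ : LaxNat F G) : ContinuousMap.Homotopic (SSet.toTop.map (mapDiag F)).hom
    (SSet.toTop.map (mapDiag G)).hom := by
  let r := split (diagNerve A)
  let q (a b : Fin 3) := restrictParts A a b
  have hq : ∀ {a a' b b' : Fin 3} (_ : a ≤ a') (_ : b ≤ b') (K : StrictPseudofunctor A B),
      ContinuousMap.Homotopic ((SSet.toTop.map (q a b ≫ mapDiag K)).hom.comp r)
        ((SSet.toTop.map (q a' b' ≫ mapDiag K)).hom.comp r) := by
    intro a a' b b' ha hb K
    rw [Functor.map_comp, Functor.map_comp]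
    exact (((ContinuousMap.Homotopic.refl _).comp
      (restrictPartsHomotopy A ha hb).homotopic)).comp (ContinuousMap.Homotopic.refl r)
  -- Taking the first part in both directions is the restriction of the subdivision to its first
  -- part, by definition.
  have h₀ : ∀ K : StrictPseudofunctor A B, ContinuousMap.Homotopic
      ((SSet.toTop.map (q 0 0 ≫ mapDiag K)).hom.comp r) (SSet.toTop.map (mapDiag K)).hom := by
    intro K
    rw [Functor.map_comp]
    exact (ContinuousMap.Homotopic.refl (SSet.toTop.map (mapDiag K)).hom).comp
      (restrictPart_split_homotopic (diagNerve A))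
  have h₁ := θ.homotopy.homotopic.comp (ContinuousMap.Homotopic.refl r)
  -- The route goes from `F` on the parts `(0, 0)` to `F` on `(0, 1)`, across the lax homotopy to
  -- `G` on `(2, 1)`, and back to `G` on `(0, 0)`.
  exact (h₀ F).symm.trans <| (hq le_rfl (by decide) F).trans <| h₁.trans <|
    (hq (by decide) (by decide) G).symm.trans (h₀ G)

end LaxNat
end TwoDiag

/-! ### Calculus of cells -/

namespace TwoDiag

/-! ### Cells that are identities up to equality of boundaries. -/

section IdCells
variable {B : Type u} [Bicategory.{w, v} B]

/-- A 2-cell is an identity up to an equality of its source and target. -/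
def IsIdCell {a b : B} {f g : a ⟶ b} (η : f ⟶ g) : Prop :=
  Cell.mk η = Cell.mk (𝟙 f)

theorem IsIdCell.exists_eq {a b : B} {f g : a ⟶ b} {η : f ⟶ g} (h : IsIdCell η) :
    ∃ e : f = g, η = eqToHom e := by
  have e : g = f := by
    injection h
  subst e
  exact ⟨rfl, Cell.inj h⟩

theorem isIdCell_eqToHom {a b : B} {f g : a ⟶ b} (e : f = g) : IsIdCell (eqToHom e) :=
  Cell.eqToHom e

theorem isIdCell_id {a b : B} (f : a ⟶ b) : IsIdCell (𝟙 f) := rfl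

theorem IsIdCell.comp {a b : B} {f g h : a ⟶ b} {η : f ⟶ g} {θ : g ⟶ h} (hη : IsIdCell η)
    (hθ : IsIdCell θ) : IsIdCell (η ≫ θ) := by
  obtain ⟨rfl, rfl⟩ := hη.exists_eq
  obtain ⟨rfl, rfl⟩ := hθ.exists_eq
  simp [IsIdCell]

theorem IsIdCell.left {a b c : B} (f : a ⟶ b) {g h : b ⟶ c} {η : g ⟶ h} (hη : IsIdCell η) :
    IsIdCell (f ◁ η) := by
  obtain ⟨rfl, rfl⟩ := hη.exists_eq
  simp [IsIdCell]

theorem IsIdCell.right {a b c : B} {f g : a ⟶ b} {η : f ⟶ g} (hη : IsIdCell η) (h : b ⟶ c) :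
    IsIdCell (η ▷ h) := by
  obtain ⟨rfl, rfl⟩ := hη.exists_eq
  simp [IsIdCell]

theorem IsIdCell.of_cell {a b a' b' : B} {f g : a ⟶ b} {f' g' : a' ⟶ b'} {η : f ⟶ g}
    {θ : f' ⟶ g'} (hθ : IsIdCell θ) (h : Cell.mk η = Cell.mk θ) : IsIdCell η := by
  cases h
  exact hθ

theorem IsIdCell.congr {a b a' b' : B} {f g : a ⟶ b} {f' g' : a' ⟶ b'} {η : f ⟶ g}
    {θ : f' ⟶ g'} (hη : IsIdCell η) (hθ : IsIdCell θ) (h : Arr.mk f = Arr.mk f') :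
    Cell.mk η = Cell.mk θ :=
  Eq.trans hη ((Cell.id h).trans (Eq.symm hθ))

theorem IsIdCell.comp_cell {a b : B} {f g h : a ⟶ b} {η : f ⟶ g} (hη : IsIdCell η) (θ : g ⟶ h) :
    Cell.mk (η ≫ θ) = Cell.mk θ := by
  obtain ⟨rfl, rfl⟩ := hη.exists_eq
  simp

theorem IsIdCell.cell_comp {a b : B} {f g h : a ⟶ b} (η : f ⟶ g) {θ : g ⟶ h} (hθ : IsIdCell θ) :
    Cell.mk (η ≫ θ) = Cell.mk η := by
  obtain ⟨rfl, rfl⟩ := hθ.exists_eq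
  simp

/-- Bundled equality is converted into the conjugated form in which the whiskering axioms of a
strict 2-functor are stated. -/
theorem eq_conj_of_cell {a b : B} {f g f' g' : a ⟶ b} {η : f ⟶ g} {θ : f' ⟶ g'}
    (h : Cell.mk η = Cell.mk θ) (e : f = f') (e' : g' = g) :
    η = eqToHom e ≫ θ ≫ eqToHom e' := by
  subst e e'
  rw [Cell.inj h]
  simp

end IdCells

section
variable {A : Type u₁} [Bicategory.{w₁, v₁} A] {B : Type u₂} [Bicategory.{w₂, v₂} B]

theorem IsIdCell.map (F : StrictPseudofunctor A B) {a b : A} {f g : a ⟶ b} {η : f ⟶ g}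
    (hη : IsIdCell η) : IsIdCell (F.map₂ η) := by
  obtain ⟨rfl, rfl⟩ := hη.exists_eq
  exact congrArg Cell.mk (F.map₂_id f)

/-- Identity 2-cells recover the action on 1-cells, and identities of identities the action on
objects; agreement on 2-cells is thus enough. -/
theorem strictPseudofunctor_eq_of_cell {F G : StrictPseudofunctor A B}
    (h : ∀ {a b : A} {f g : a ⟶ b} (η : f ⟶ g), Cell.mk (F.map₂ η) = Cell.mk (G.map₂ η)) :
    F = G := by
  apply strictPseudofunctor_ext
  obtain ⟨⟨⟨⟨⟨⟨Fo, Fm⟩, F2⟩, _, _⟩, _, _, _, _, _, _, _⟩, _, _⟩, _, _⟩ := F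
  obtain ⟨⟨⟨⟨⟨⟨Go, Gm⟩, G2⟩, _, _⟩, _, _, _, _, _, _, _⟩, _, _⟩, _, _⟩ := G
  have ho : Fo = Go := funext fun a => congrArg Cell.src (h (𝟙 (𝟙 a)))
  subst ho
  have hm : @Fm = @Gm := by
    funext a b f
    have := h (𝟙 f)
    injection this
  subst hm
  have h2 : @F2 = @G2 := by
    funext a b f g η
    exact Cell.inj (h η)
  subst h2
  rfl

end

/-! ### Comparing cells of the fibres over an object. -/

section OverFibre
variable {A : Type u₁} [Bicategory.{w₁, v₁} A] [Strict A]
  {C : Type u₂} [Bicategory.{w₂, v₂} C] [Strict C] {F : StrictPseudofunctor A C} {c : C}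

theorem OverFibre.hom_eq (X : OverFibre F c) : X.hom = F.map (𝟙 X.base) ≫ X.hom := by
  rw [F.map_id, Strict.id_comp]

theorem OverFibre.isIdCell_cell_id (X : OverFibre F c) : IsIdCell (𝟙 X : X ⟶ X).cell :=
  isIdCell_eqToHom (hom_eq X)

theorem OverFibre.Hom.ext_cell {X Y : OverFibre F c} {f g : X ⟶ Y} (h : f.base = g.base)
    (h' : Cell.mk f.cell = Cell.mk g.cell) : f = g := by
  obtain ⟨f, φ⟩ := f
  obtain ⟨g, ψ⟩ := g
  dsimp only at h h'
  subst h
  rw [Cell.inj h']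

/-- The underlying 2-cell determines the base objects and base 1-cells. The other hypotheses
identify the structure 1-cells and 2-cells, and the condition on a 2-cell is a proposition. -/
theorem OverFibre.cell_ext {X Y X' Y' : OverFibre F c} {f g : X ⟶ Y} {f' g' : X' ⟶ Y'}
    {η : f ⟶ g} {θ : f' ⟶ g'} (h : Cell.mk η.cell = Cell.mk θ.cell)
    (hX : Arr.mk X.hom = Arr.mk X'.hom) (hY : Arr.mk Y.hom = Arr.mk Y'.hom)
    (hf : Cell.mk f.cell = Cell.mk f'.cell) (hg : Cell.mk g.cell = Cell.mk g'.cell) :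
    Cell.mk η = Cell.mk θ := by
  obtain ⟨X, p⟩ := X
  obtain ⟨Y, q⟩ := Y
  obtain ⟨X', p'⟩ := X'
  obtain ⟨Y', q'⟩ := Y'
  obtain ⟨f, φ⟩ := f
  obtain ⟨g, ψ⟩ := g
  obtain ⟨f', φ'⟩ := f'
  obtain ⟨g', ψ'⟩ := g'
  obtain ⟨η, hη⟩ := η
  obtain ⟨θ, hθ⟩ := θ
  dsimp only at *
  cases h
  obtain rfl := Arr.inj hX
  obtain rfl := Arr.inj hY
  obtain rfl := Cell.inj hf
  obtain rfl := Cell.inj hg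
  rfl

theorem OverFibre.cell_congr {X Y : OverFibre F c} {f g f' g' : X ⟶ Y} {η : f ⟶ g} {θ : f' ⟶ g'}
    (hf : f = f') (hg : g = g') (h : Cell.mk η.cell = Cell.mk θ.cell) :
    Cell.mk η = Cell.mk θ := by
  subst hf hg
  exact congrArg Cell.mk (Hom₂.eq_of_cell (Cell.inj h))

end OverFibre

/-! ### Comparing cells of the covariant Grothendieck construction. -/

section Groth
variable {C : Type u₁} [Bicategory.{w₁, v₁} C] [Strict C]
  {D : StrictPseudofunctor C TwoCat.{w, v, u}}

theorem Groth.cell_congr {X Y : Groth D} {f g f' g' : X ⟶ Y} {η : f ⟶ g} {θ : f' ⟶ g'}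
    (hf : f = f') (hg : g = g') (h : Cell.mk η.base = Cell.mk θ.base)
    (h' : Cell.mk η.fiber = Cell.mk θ.fiber) : Cell.mk η = Cell.mk θ := by
  subst hf hg
  exact congrArg Cell.mk (Hom₂.eq_of_cell (Cell.inj h) h')

theorem Groth.base_eqToHom {X Y : Groth D} {f g : X ⟶ Y} (h : f = g) :
    (eqToHom h : f ⟶ g).base = eqToHom (congrArg Hom.base h) := by
  subst h
  rfl

theorem Groth.isIdCell_base_eqToHom {X Y : Groth D} {f g : X ⟶ Y} (h : f = g) :
    IsIdCell (eqToHom h : f ⟶ g).base := by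
  subst h
  rfl

/-- The second fibre component enters a vertical composite only through a whiskering, which is again
an identity cell and drops out. -/
theorem Groth.fiber_comp {X Y : Groth D} {f g h : X ⟶ Y} (η : f ⟶ g) {θ : g ⟶ h}
    (hθ : IsIdCell θ.fiber) : Cell.mk (η ≫ θ).fiber = Cell.mk η.fiber :=
  (cell_vcomp η θ).trans ((hθ.left _).cell_comp _)

theorem Groth.isIdCell_comp {X Y : Groth D} {f g h : X ⟶ Y} {η : f ⟶ g} {θ : g ⟶ h}
    (hη : IsIdCell η.fiber) (hθ : IsIdCell θ.fiber) : IsIdCell (η ≫ θ).fiber :=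
  hη.of_cell (fiber_comp η hθ)

theorem Groth.isIdCell_whiskerLeft {X Y Z : Groth D} (f : X ⟶ Y) {g h : Y ⟶ Z} {η : g ⟶ h}
    (hη : IsIdCell η.fiber) : IsIdCell (f ◁ η).fiber :=
  (hη.left _).of_cell (cell_whiskerL f η)

theorem Groth.isIdCell_whiskerRight {X Y Z : Groth D} {f g : X ⟶ Y} {η : f ⟶ g}
    (hη : IsIdCell η.fiber) (h : Y ⟶ Z) : IsIdCell (η ▷ h).fiber :=
  ((hη.map _).right _).of_cell (cell_whiskerR η h)

theorem Groth.fiber_eqToHom {X Y : Groth D} {f g : X ⟶ Y} (h : f = g) :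
    IsIdCell (eqToHom h : f ⟶ g).fiber := by
  subst h
  exact cell_id₂ f

end Groth

/-! ### Transport along pushforward 2-functors. -/

section Transport
variable {C : Type u₁} [Bicategory.{w₁, v₁} C] (D : StrictPseudofunctor C TwoCat.{w, v, u})
  {a b d c : C} {f : a ⟶ c} {g : b ⟶ c} {k : d ⟶ c} {h h' h'' : a ⟶ b} {l l' : b ⟶ d}

theorem pushCell_eqToHom {a b : C} {f g : a ⟶ b} (e : f = g) (x : D.obj a) :
    pushCell D (eqToHom e) x = eqToHom (by rw [e]) := by
  subst e
  exact pushCell_id D f x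

/-- The 1-cell `f_* x ⟶ g_* (h_* x)` of a 2-cell `f ⟶ h ≫ g`. -/
def shift (α : f ⟶ h ≫ g) (x : D.obj a) :
    (push D f).obj x ⟶ (push D g).obj ((push D h).obj x) :=
  pushCell D α x ≫ eqToHom (push_comp_obj D h g x)

theorem arr_shift (α : f ⟶ h ≫ g) (x : D.obj a) :
    Arr.mk (shift D α x) = Arr.mk (pushCell D α x) :=
  Arr.comp_eqToHom _ _

theorem shift_eqToHom (e : f = h ≫ g) (x : D.obj a) :
    shift D (eqToHom e) x = eqToHom (by rw [e, push_comp_obj]) := by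
  rw [shift, pushCell_eqToHom, eqToHom_trans]

theorem shift_naturality (α : f ⟶ h ≫ g) {x y : D.obj a} (w : x ⟶ y) :
    Arr.mk ((push D f).map w ≫ shift D α y) =
      Arr.mk (shift D α x ≫ (push D g).map ((push D h).map w)) := by
  refine (Arr.assoc _ _ _).symm.trans ((Arr.comp_eqToHom _ _).trans ?_)
  refine (Arr.naturality (D.map₂ α).toNatTrans w).trans ?_
  exact Arr.comp (arr_shift D α x).symm (push_comp_map D h g w)

theorem shift_naturality₂ (α : f ⟶ h ≫ g) {x y : D.obj a} {w w' : x ⟶ y} (ψ : w ⟶ w') :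
    Cell.mk ((push D f).map₂ ψ ▷ shift D α y) =
      Cell.mk (shift D α x ◁ (push D g).map₂ ((push D h).map₂ ψ)) := by
  refine (Cell.right_comp _ _ _).trans ((Cell.right_eqToHom _ _).trans ?_)
  refine (Cell.naturality (D.map₂ α).toNatTrans ψ).trans ?_
  exact Cell.left (arr_shift D α x).symm (push_comp_map₂ D h g ψ)

theorem shift_whiskerRight (α : f ⟶ h ≫ g) (η : h ⟶ h') (x : D.obj a) :
    Arr.mk (shift D (α ≫ η ▷ g) x) =
      Arr.mk (shift D α x ≫ (push D g).map (pushCell D η x)) := by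
  refine (arr_shift D _ x).trans ?_
  rw [pushCell_comp]
  exact Arr.comp (arr_shift D α x).symm (pushCell_right D η g x)

variable [Strict C] in
-- `D` preserves the pasting of `α` with `β`: left whiskering by `h` becomes evaluation at `h_* x`,
-- and the associativity equality contributes an identity.
theorem shift_comp (α : f ⟶ h ≫ g) (β : g ⟶ l ≫ k) (x : D.obj a) :
    Arr.mk (shift D (α ≫ h ◁ β ≫ eqToHom (Strict.assoc h l k).symm) x ≫
        (push D k).map (eqToHom (push_comp_obj D h l x))) =
      Arr.mk (shift D α x ≫ shift D β ((push D h).obj x)) := by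
  rw [map_eqToHom]
  refine (Arr.comp_eqToHom _ _).trans ((arr_shift D _ x).trans ?_)
  rw [pushCell_comp, pushCell_comp, pushCell_eqToHom]
  refine Arr.comp (arr_shift D α x).symm ((Arr.comp_eqToHom _ _).trans ?_)
  exact (pushCell_left D h β x).trans (arr_shift D β _).symm

/-- Transport of a 1-cell along a 2-cell `f ⟶ h ≫ g`. -/
def transport (α : f ⟶ h ≫ g) {x : D.obj a} {y : D.obj b} (w : (push D h).obj x ⟶ y) :
    (push D f).obj x ⟶ (push D g).obj y :=
  shift D α x ≫ (push D g).map w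

theorem transport_id (e : f = 𝟙 a ≫ f) (x : D.obj a) :
    transport D (eqToHom e) (eqToHom (push_id_obj D a x)) = 𝟙 ((push D f).obj x) := by
  apply Arr.inj
  rw [transport, map_eqToHom, shift, pushCell_eqToHom]
  refine (Arr.comp_eqToHom _ _).trans ((Arr.comp_eqToHom _ _).trans ?_)
  exact Arr.eqToHom_eq _ rfl (push_comp_obj D _ _ _ |>.trans (by rw [push_id_obj]))

variable [Strict C] in
-- After `shift_comp` the two sides differ only in the order of the shift along `β` and the pushed
-- 1-cell `w`; naturality of `β_*` exchanges them. This makes `toLocal` preserve composition.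
theorem transport_comp (α : f ⟶ h ≫ g) (β : g ⟶ l ≫ k) {x : D.obj a} {y : D.obj b} {z : D.obj d}
    (w : (push D h).obj x ⟶ y) (w' : (push D l).obj y ⟶ z) :
    transport D (α ≫ h ◁ β ≫ eqToHom (Strict.assoc h l k).symm)
        (eqToHom (push_comp_obj D h l x) ≫ (push D l).map w ≫ w') =
      transport D α w ≫ transport D β w' := by
  apply Arr.inj
  refine (Arr.comp rfl ((Arr.map_comp _ _ _).trans (Arr.comp rfl (Arr.map_comp _ _ _)))).trans ?_
  refine (Arr.assoc _ _ _).symm.trans ((Arr.comp (shift_comp D α β x) rfl).trans ?_)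
  refine (Arr.assoc _ _ _).trans (Eq.trans ?_ (Arr.assoc _ _ _).symm)
  refine Arr.comp rfl ?_
  refine (Arr.assoc _ _ _).symm.trans (Eq.trans ?_ (Arr.assoc _ _ _))
  exact Arr.comp (shift_naturality D β w).symm rfl

theorem transport₂_eq {α : f ⟶ h ≫ g} {β : f ⟶ h' ≫ g} (η : h ⟶ h') (e : α ≫ η ▷ g = β)
    {x : D.obj a} {y : D.obj b} (w : (push D h').obj x ⟶ y) :
    shift D α x ≫ (push D g).map (pushCell D η x ≫ w) = transport D β w := by
  subst e
  apply Arr.inj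
  refine (Arr.comp rfl (Arr.map_comp _ _ _)).trans ((Arr.assoc _ _ _).symm.trans ?_)
  exact Arr.comp (shift_whiskerRight D α η x).symm rfl

/-- Transport of a 2-cell. -/
def transport₂ {α : f ⟶ h ≫ g} {β : f ⟶ h' ≫ g} (η : h ⟶ h') (e : α ≫ η ▷ g = β)
    {x : D.obj a} {y : D.obj b} {w : (push D h).obj x ⟶ y} {w' : (push D h').obj x ⟶ y}
    (ψ : w ⟶ pushCell D η x ≫ w') : transport D α w ⟶ transport D β w' :=
  shift D α x ◁ (push D g).map₂ ψ ≫ eqToHom (transport₂_eq D η e w')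

theorem cell_transport₂ {α : f ⟶ h ≫ g} {β : f ⟶ h' ≫ g} (η : h ⟶ h') (e : α ≫ η ▷ g = β)
    {x : D.obj a} {y : D.obj b} {w : (push D h).obj x ⟶ y} {w' : (push D h').obj x ⟶ y}
    (ψ : w ⟶ pushCell D η x ≫ w') : Cell.mk (transport₂ D η e ψ) =
      Cell.mk (shift D α x ◁ (push D g).map₂ ψ) :=
  Cell.comp_eqToHom _ _

theorem transport₂_isIdCell {α : f ⟶ h ≫ g} {β : f ⟶ h' ≫ g} (η : h ⟶ h') (e : α ≫ η ▷ g = β)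
    {x : D.obj a} {y : D.obj b} {w : (push D h).obj x ⟶ y} {w' : (push D h').obj x ⟶ y}
    {ψ : w ⟶ pushCell D η x ≫ w'} (hψ : IsIdCell ψ) : IsIdCell (transport₂ D η e ψ) :=
  ((hψ.map _).left _).of_cell (cell_transport₂ D η e ψ)

/-- The shift along `β` is the shift along `α` followed by the pushforward of `η_* x`. This absorbs
the whiskering that occurs in vertical composites of `∫_C D`. -/
theorem transport₂_vcomp {α : f ⟶ h ≫ g} {β : f ⟶ h' ≫ g} {γ : f ⟶ h'' ≫ g} (η : h ⟶ h')
    (θ : h' ⟶ h'') (κ : h ⟶ h'') (e : α ≫ η ▷ g = β) (e' : β ≫ θ ▷ g = γ) (e'' : α ≫ κ ▷ g = γ)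
    {x : D.obj a} {y : D.obj b} {w : (push D h).obj x ⟶ y} {w' : (push D h').obj x ⟶ y}
    {w'' : (push D h'').obj x ⟶ y} (ψ : w ⟶ pushCell D η x ≫ w')
    (ψ' : w' ⟶ pushCell D θ x ≫ w'') (ψ'' : w ⟶ pushCell D κ x ≫ w'')
    (hψ : Cell.mk ψ'' = Cell.mk (ψ ≫ pushCell D η x ◁ ψ')) :
    transport₂ D κ e'' ψ'' = transport₂ D η e ψ ≫ transport₂ D θ e' ψ' := by
  apply Cell.inj
  refine (cell_transport₂ D κ e'' ψ'').trans ?_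
  refine (Cell.left rfl ((Cell.map rfl hψ).trans (Cell.map_comp _ _ _))).trans ?_
  rw [whiskerLeft_comp]
  refine Cell.vcomp (cell_transport₂ D η e ψ).symm ?_
  refine (Cell.left rfl (Cell.map_left _ _ _)).trans ((Cell.comp_left _ _ _).symm.trans ?_)
  refine Eq.trans ?_ (cell_transport₂ D θ e' ψ').symm
  subst e
  exact Cell.left (shift_whiskerRight D α η x).symm rfl

variable [Strict C] in
-- As for 1-cells: split the shift along the pasting and move `w` past the shift along `β`. Only
-- 1-cell naturality is needed, since `w` is a 1-cell.
theorem transport₂_whiskerLeft (α : f ⟶ h ≫ g) {β : g ⟶ l ≫ k} {β' : g ⟶ l' ≫ k} (η : l ⟶ l')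
    (e : β ≫ η ▷ k = β')
    {γ : f ⟶ (h ≫ l) ≫ k} {γ' : f ⟶ (h ≫ l') ≫ k} (e' : γ ≫ (h ◁ η) ▷ k = γ')
    (hγ : γ = α ≫ h ◁ β ≫ eqToHom (Strict.assoc h l k).symm)
    {x : D.obj a} {y : D.obj b} {z : D.obj d} (w : (push D h).obj x ⟶ y)
    {v : (push D l).obj y ⟶ z} {v' : (push D l').obj y ⟶ z} (ψ : v ⟶ pushCell D η y ≫ v')
    (ψ' : eqToHom (push_comp_obj D h l x) ≫ (push D l).map w ≫ v ⟶ pushCell D (h ◁ η) x ≫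
      eqToHom (push_comp_obj D h l' x) ≫ (push D l').map w ≫ v')
    (hψ : Cell.mk ψ' = Cell.mk (eqToHom (push_comp_obj D h l x) ◁ (push D l).map w ◁ ψ)) :
    Cell.mk (transport₂ D (h ◁ η) e' ψ') = Cell.mk (transport D α w ◁ transport₂ D η e ψ) := by
  refine (cell_transport₂ D _ e' ψ').trans ?_
  subst hγ
  refine (Cell.left rfl ((Cell.map rfl hψ).trans ((Cell.map_left _ _ _).trans
    (Cell.left rfl (Cell.map_left _ _ _))))).trans ?_
  refine (Cell.comp_left _ _ _).symm.trans ((Cell.left (shift_comp D α β x) rfl).trans ?_)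
  refine Eq.trans ?_ (Cell.left rfl (cell_transport₂ D η e ψ)).symm
  refine (Cell.comp_left _ _ _).trans (Eq.trans ?_ (Cell.comp_left _ _ _).symm)
  refine Cell.left rfl ?_
  refine (Cell.comp_left _ _ _).symm.trans (Eq.trans ?_ (Cell.comp_left _ _ _))
  exact Cell.left (shift_naturality D β w).symm rfl

variable [Strict C] in
-- Here the 2-cell `ψ` has to pass the shift along `β`, so naturality of `β_*` on 2-cells is used.
theorem transport₂_whiskerRight {α : f ⟶ h ≫ g} {α' : f ⟶ h' ≫ g} (η : h ⟶ h')
    (e : α ≫ η ▷ g = α') (β : g ⟶ l ≫ k)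
    {γ : f ⟶ (h ≫ l) ≫ k} {γ' : f ⟶ (h' ≫ l) ≫ k} (e' : γ ≫ (η ▷ l) ▷ k = γ')
    (hγ : γ = α ≫ h ◁ β ≫ eqToHom (Strict.assoc h l k).symm)
    {x : D.obj a} {y : D.obj b} {z : D.obj d} {w : (push D h).obj x ⟶ y}
    {w' : (push D h').obj x ⟶ y} (ψ : w ⟶ pushCell D η x ≫ w') (v : (push D l).obj y ⟶ z)
    (ψ' : eqToHom (push_comp_obj D h l x) ≫ (push D l).map w ≫ v ⟶ pushCell D (η ▷ l) x ≫
      eqToHom (push_comp_obj D h' l x) ≫ (push D l).map w' ≫ v)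
    (hψ : Cell.mk ψ' = Cell.mk (eqToHom (push_comp_obj D h l x) ◁ (push D l).map₂ ψ ▷ v)) :
    Cell.mk (transport₂ D (η ▷ l) e' ψ') = Cell.mk (transport₂ D η e ψ ▷ transport D β v) := by
  refine (cell_transport₂ D _ e' ψ').trans ?_
  subst hγ
  refine (Cell.left rfl ((Cell.map rfl hψ).trans ((Cell.map_left _ _ _).trans
    (Cell.left rfl (Cell.map_right _ _ _))))).trans ?_
  refine (Cell.comp_left _ _ _).symm.trans ((Cell.left (shift_comp D α β x) rfl).trans ?_)
  refine Eq.trans ?_ (Cell.right (cell_transport₂ D η e ψ) rfl).symm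
  refine (Cell.comp_left _ _ _).trans (Eq.trans ?_ (Cell.left_right _ _ _).symm)
  refine Cell.left rfl ?_
  refine Eq.trans ?_ (Cell.right_comp _ _ _).symm
  refine Eq.trans ?_ (Cell.right (shift_naturality₂ D β ψ) rfl).symm
  exact (Cell.left_right _ _ _).symm

end Transport
end TwoDiag

/-! ### Homotopy fibres of the covariant Grothendieck construction -/

namespace TwoDiag

namespace Groth
variable {C : Type u₁} [Bicategory.{w₁, v₁} C] [Strict C]
  {D E : StrictPseudofunctor C TwoCat.{w, v, u}}

/-- Naturality of `Γ` on 2-cells of `C`: it matches the transport performed in `D` with the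
structure cells of the fibre, which live in `E`. -/
theorem component_shift (Γ : TwoNatTrans D E) {a b c : C} {f : a ⟶ c} {g : b ⟶ c} {h : a ⟶ b}
    (α : f ⟶ h ≫ g) (x : D.obj a) : Arr.mk ((component Γ c).map (shift D α x)) =
      Arr.mk (pushCell E α ((component Γ a).obj x)) :=
  (Arr.map rfl (arr_shift D α x)).trans (naturality_pushCell Γ α x).symm

/-! ### The inclusion of a fibre. -/

section Incl
variable (D) (c : C)

theorem inclHom₂_eq {x y : D.obj c} (v : x ⟶ y) :
    eqToHom (push_id_obj D c x) ≫ v =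
      pushCell D (𝟙 (𝟙 c)) x ≫ eqToHom (push_id_obj D c x) ≫ v := by
  rw [pushCell_id, Strict.id_comp]

/-- The action on 1-cells of the inclusion of a fibre. -/
def inclHom {x y : D.obj c} (v : x ⟶ y) : (⟨c, x⟩ : Groth D) ⟶ ⟨c, y⟩ :=
  ⟨𝟙 c, eqToHom (push_id_obj D c x) ≫ v⟩

theorem arr_inclHom {x y : D.obj c} (v : x ⟶ y) : Arr.mk (inclHom D c v).fiber = Arr.mk v :=
  Arr.eqToHom_comp _ _

/-- The action on 2-cells of the inclusion of a fibre. -/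
def inclHom₂ {x y : D.obj c} {v v' : x ⟶ y} (ψ : v ⟶ v') : inclHom D c v ⟶ inclHom D c v' :=
  ⟨𝟙 (𝟙 c), eqToHom (push_id_obj D c x) ◁ ψ ≫ eqToHom (inclHom₂_eq D c v')⟩

theorem cell_inclHom₂ {x y : D.obj c} {v v' : x ⟶ y} (ψ : v ⟶ v') :
    Cell.mk (inclHom₂ D c ψ).fiber = Cell.mk ψ :=
  (Cell.comp_eqToHom _ _).trans (Cell.eqToHom_left _ _)

theorem inclHom_id (x : D.obj c) : inclHom D c (𝟙 x) = 𝟙 (⟨c, x⟩ : Groth D) :=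
  Hom.hext rfl ((arr_inclHom D c (𝟙 x)).trans (Arr.eqToHom_eq rfl (push_id_obj D c x) rfl))

theorem arr_push_inclHom {x y : D.obj c} (v : x ⟶ y) :
    Arr.mk ((push D (𝟙 c)).map (inclHom D c v).fiber) = Arr.mk v :=
  (push_id_map D _).trans (arr_inclHom D c v)

theorem inclHom_comp {x y z : D.obj c} (v : x ⟶ y) (v' : y ⟶ z) :
    inclHom D c (v ≫ v') = inclHom D c v ≫ inclHom D c v' := by
  refine Hom.hext (Strict.id_comp _).symm ((arr_inclHom D c _).trans ?_)
  exact Eq.trans (Arr.comp (arr_push_inclHom D c v).symm (arr_inclHom D c v').symm)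
    (arr_comp (inclHom D c v) (inclHom D c v')).symm

/-- The inclusion of a fibre into the Grothendieck construction. -/
def incl : StrictPseudofunctor (D.obj c) (Groth D) :=
  StrictPseudofunctor.mk''
    { obj := fun x => ⟨c, x⟩
      map := inclHom D c
      map₂ := inclHom₂ D c
      map₂_id := fun v => Hom₂.eq_of_cell rfl <| (cell_inclHom₂ D c _).trans <|
        (Cell.id (arr_inclHom D c v).symm).trans (cell_id₂ _).symm
      map₂_comp := fun {x y v v' v''} ψ ψ' => by
        refine Hom₂.eq_of_cell (Category.id_comp _).symm ((cell_inclHom₂ D c _).trans ?_)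
        refine Eq.trans ?_ (cell_vcomp _ _).symm
        refine Cell.vcomp (cell_inclHom₂ D c ψ).symm ((cell_inclHom₂ D c ψ').symm.trans ?_)
        refine (Cell.eqToHom_left rfl _).symm.trans ?_
        exact Cell.left (congrArg Arr.mk (pushCell_id D (𝟙 c) x).symm) rfl
      map_id := inclHom_id D c
      map_comp := inclHom_comp D c
      map₂_whisker_left := fun {x y z} v {v' v''} ψ => by
        refine eq_conj_of_cell (cell_congr (inclHom_comp D c v v') (inclHom_comp D c v v'') ?_ ?_)
          _ _
        · exact (isIdCell_id _).congr ((isIdCell_id _).left _)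
            (congrArg Arr.mk (Strict.id_comp _).symm)
        · refine (cell_inclHom₂ D c _).trans (Eq.trans ?_ (cell_whiskerL _ _).symm)
          exact Cell.left (arr_push_inclHom D c v).symm (cell_inclHom₂ D c ψ).symm
      map₂_whisker_right := fun {x y z v v'} ψ v'' => by
        refine eq_conj_of_cell (cell_congr (inclHom_comp D c v v'') (inclHom_comp D c v' v'') ?_ ?_)
          _ _
        · exact (isIdCell_id _).congr ((isIdCell_id _).right _)
            (congrArg Arr.mk (Strict.id_comp _).symm)
        · refine (cell_inclHom₂ D c _).trans (Eq.trans ?_ (cell_whiskerR _ _).symm)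
          exact Cell.right ((cell_inclHom₂ D c ψ).symm.trans (push_id_map₂ D _).symm)
            (arr_inclHom D c v'').symm }

end Incl

variable (Γ : TwoNatTrans D E) (c : C) (y : E.obj c)

/-- The homotopy fibre of `∫_C Γ` at `(c, y)`. -/
abbrev TotalFibre := OverFibre (Groth.map Γ) (⟨c, y⟩ : Groth E)

/-- The homotopy fibre of `Γ_c` at `y`. -/
abbrev LocalFibre := OverFibre (component Γ c) y

variable {Γ c y}

/-! ### Structure cells of the total fibre. -/

section Leg

/-- The first component of the structure 1-cell of an object of the total fibre. -/
def leg (X : TotalFibre Γ c y) : X.base.base ⟶ c := X.hom.base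

/-- The second component of the structure 1-cell of an object of the total fibre. -/
def legFiber (X : TotalFibre Γ c y) :
    (push E (leg X)).obj ((component Γ X.base.base).obj X.base.fiber) ⟶ y := X.hom.fiber

variable {X Y Z : TotalFibre Γ c y}

/-- The first component of the structure 2-cell of a 1-cell of the total fibre. -/
def legCell (m : X ⟶ Y) : leg X ⟶ m.base.base ≫ leg Y := m.cell.base

/-- The second component of the structure 2-cell of a 1-cell of the total fibre. -/
def legFiberCell (m : X ⟶ Y) : legFiber X ⟶
    pushCell E (legCell m) ((component Γ X.base.base).obj X.base.fiber) ≫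
      (mapHom Γ m.base ≫ Y.hom).fiber := m.cell.fiber

theorem legCell_id (X : TotalFibre Γ c y) :
    legCell (𝟙 X) = eqToHom (Strict.id_comp (leg X)).symm :=
  base_eqToHom (OverFibre.hom_eq X)

theorem legFiberCell_id (X : TotalFibre Γ c y) : IsIdCell (legFiberCell (𝟙 X)) :=
  fiber_eqToHom (OverFibre.hom_eq X)

theorem legCell_comp (m : X ⟶ Y) (n : Y ⟶ Z) : legCell (m ≫ n) =
    legCell m ≫ m.base.base ◁ legCell n ≫ eqToHom (Strict.assoc _ _ _).symm :=
  congrArg (fun t => legCell m ≫ m.base.base ◁ legCell n ≫ t) (base_eqToHom _)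

/-- The associativity equality closing the structure 2-cell of a composite has an identity fibre
component and disappears. -/
theorem legFiberCell_comp (m : X ⟶ Y) (n : Y ⟶ Z) : Cell.mk (legFiberCell (m ≫ n)) =
    Cell.mk (legFiberCell m ≫ pushCell E (legCell m) _ ◁
      (whiskerL (mapHom Γ m.base) n.cell).fiber) := by
  refine (cell_vcomp _ _).trans (Cell.vcomp rfl (Cell.left rfl ?_))
  exact (cell_vcomp _ _).trans (((fiber_eqToHom _).left _).cell_comp _)

theorem legCell_whiskerRight {m n : X ⟶ Y} (η : m ⟶ n) :
    legCell m ≫ η.cell.base ▷ leg Y = legCell n :=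
  congrArg Hom₂.base η.w

theorem legFiberCell_whiskerRight {m n : X ⟶ Y} (η : m ⟶ n) :
    Cell.mk (legFiberCell m ≫ pushCell E (legCell m) _ ◁
      (whiskerR (mapHom₂ Γ η.cell) Y.hom).fiber) = Cell.mk (legFiberCell n) := by
  refine (cell_vcomp _ _).symm.trans ?_
  exact congrArg (fun t : X.hom ⟶ (mapHom Γ n.base ≫ Y.hom) => Cell.mk t.fiber) η.w

end Leg

/-! ### Pushing the total fibre forward to the local fibre. -/

section ToLocal
variable {X Y Z : TotalFibre Γ c y}

/-- The action on objects of the comparison of the total fibre with the local fibre. -/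
def toLocalObj (X : TotalFibre Γ c y) : LocalFibre Γ c y :=
  ⟨(push D (leg X)).obj X.base.fiber,
    eqToHom (naturality_obj Γ (leg X) X.base.fiber).symm ≫ legFiber X⟩

theorem arr_toLocalObj (X : TotalFibre Γ c y) : Arr.mk (toLocalObj X).hom = Arr.mk (legFiber X) :=
  Arr.eqToHom_comp _ _

/-- Naturality of `Γ` at the 2-cell `legCell m` and on the fibre component of `m` shows that the
structure 2-cell of `m` already has the target demanded by the local fibre. -/
theorem toLocalHom_eq (m : X ⟶ Y) :
    eqToHom (naturality_obj Γ (leg X) X.base.fiber).symm ≫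
      pushCell E (legCell m) ((component Γ X.base.base).obj X.base.fiber) ≫
      (mapHom Γ m.base ≫ Y.hom).fiber =
    (component Γ c).map (transport D (legCell m) m.base.fiber) ≫ (toLocalObj Y).hom := by
  apply Arr.inj
  refine (Arr.eqToHom_comp _ _).trans (Eq.trans ?_ (Arr.comp (Arr.map_comp _ _ _) rfl).symm)
  refine Eq.trans ?_ (Arr.assoc _ _ _).symm
  refine Arr.comp (component_shift Γ _ _).symm ((arr_comp _ _).trans ?_)
  refine Arr.comp ?_ (arr_toLocalObj Y).symm
  exact (Arr.map rfl (arr_mapHom Γ m.base)).trans (naturality_map Γ _ _)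

/-- The action on 1-cells of the comparison of the total fibre with the local fibre. -/
def toLocalHom (m : X ⟶ Y) : toLocalObj X ⟶ toLocalObj Y :=
  ⟨transport D (legCell m) m.base.fiber,
    eqToHom (naturality_obj Γ (leg X) X.base.fiber).symm ◁ legFiberCell m ≫
      eqToHom (toLocalHom_eq m)⟩

theorem cell_toLocalHom (m : X ⟶ Y) : Cell.mk (toLocalHom m).cell = Cell.mk (legFiberCell m) :=
  (Cell.comp_eqToHom _ _).trans (Cell.eqToHom_left _ _)

/-- The action on 2-cells of the comparison of the total fibre with the local fibre. -/
def toLocalHom₂ {m n : X ⟶ Y} (η : m ⟶ n) : toLocalHom m ⟶ toLocalHom n :=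
  ⟨transport₂ D η.cell.base (legCell_whiskerRight η) η.cell.fiber, by
    -- The condition is the fibre component of the condition on `η`, rewritten by naturality of `Γ`.
    refine Cell.inj (Eq.trans ?_ (cell_toLocalHom n).symm)
    refine Eq.trans ?_ (legFiberCell_whiskerRight η)
    refine Cell.vcomp (cell_toLocalHom m) ?_
    refine (Cell.right ((Cell.map rfl (cell_transport₂ D _ _ _)).trans (Cell.map_left _ _ _))
      rfl).trans ((Cell.left_right _ _ _).trans ?_)
    refine Cell.left (component_shift Γ _ _) (Eq.trans ?_
      (cell_whiskerR (mapHom₂ Γ η.cell) Y.hom).symm)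
    refine Cell.right ?_ (arr_toLocalObj Y)
    exact (naturality_map₂ Γ _ _).symm.trans (Cell.map rfl (cell_mapHom₂ Γ η.cell).symm)⟩

theorem toLocalHom_id (X : TotalFibre Γ c y) : toLocalHom (𝟙 X) = 𝟙 (toLocalObj X) := by
  refine OverFibre.Hom.ext_cell ?_ ?_
  · refine Eq.trans ?_ (transport_id D (Strict.id_comp (leg X)).symm X.base.fiber)
    exact congrArg (fun α => transport D α (eqToHom (push_id_obj D X.base.base X.base.fiber)))
      (legCell_id X)
  · exact ((legFiberCell_id X).of_cell (cell_toLocalHom _)).congr (OverFibre.isIdCell_cell_id _) rfl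

/-- The base 1-cells agree by the pasting law for transport, the structure 2-cells by
`legFiberCell_comp` and naturality of `Γ`. -/
theorem toLocalHom_comp (m : X ⟶ Y) (n : Y ⟶ Z) :
    toLocalHom (m ≫ n) = toLocalHom m ≫ toLocalHom n := by
  refine OverFibre.Hom.ext_cell ?_ ?_
  · refine Eq.trans ?_ (transport_comp D (legCell m) (legCell n) m.base.fiber n.base.fiber)
    exact congrArg (fun α => transport D α (m.base ≫ n.base).fiber) (legCell_comp m n)
  · refine (cell_toLocalHom _).trans ((legFiberCell_comp m n).trans ?_)
    refine Cell.vcomp (cell_toLocalHom m).symm (Eq.trans ?_ (Cell.comp_eqToHom _ _).symm)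
    refine Eq.trans ?_ (Cell.left (Arr.map_comp _ _ _) rfl).symm
    refine Eq.trans ?_ (Cell.comp_left _ _ _).symm
    refine Cell.left (component_shift Γ _ _).symm ((cell_whiskerL _ _).trans ?_)
    refine Cell.left ?_ (cell_toLocalHom n).symm
    exact (Arr.map rfl (arr_mapHom Γ m.base)).trans (naturality_map Γ _ _)

variable (Γ c y) in
/-- The comparison of the total fibre with the local fibre. -/
def toLocal : StrictPseudofunctor (TotalFibre Γ c y) (LocalFibre Γ c y) :=
  StrictPseudofunctor.mk''
    { obj := toLocalObj
      map := toLocalHom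
      map₂ := toLocalHom₂
      map₂_id := fun m => OverFibre.Hom₂.eq_of_cell <| Cell.inj <|
        (transport₂_isIdCell D _ (legCell_whiskerRight (𝟙 m)) (cell_id₂ m.base)).congr (isIdCell_id _) rfl
      map₂_comp := fun η θ => OverFibre.Hom₂.eq_of_cell <|
        transport₂_vcomp D _ _ _ (legCell_whiskerRight η) (legCell_whiskerRight θ)
          (legCell_whiskerRight (η ≫ θ)) _ _ _ (cell_vcomp η.cell θ.cell)
      map_id := toLocalHom_id
      map_comp := toLocalHom_comp
      map₂_whisker_left := fun {X Y Z} m {n n'} η => by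
        refine eq_conj_of_cell (OverFibre.cell_congr (toLocalHom_comp m n) (toLocalHom_comp m n')
          ?_) _ _
        exact transport₂_whiskerLeft D (legCell m) η.cell.base (legCell_whiskerRight η)
          (legCell_whiskerRight (m ◁ η)) (legCell_comp m n) m.base.fiber η.cell.fiber _
          (Cell.comp_eqToHom _ _)
      map₂_whisker_right := fun {X Y Z m m'} η n => by
        refine eq_conj_of_cell (OverFibre.cell_congr (toLocalHom_comp m n) (toLocalHom_comp m' n)
          ?_) _ _
        exact transport₂_whiskerRight D η.cell.base (legCell_whiskerRight η) (legCell n)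
          (legCell_whiskerRight (η ▷ n)) (legCell_comp m n) η.cell.fiber n.base.fiber _
          (Cell.comp_eqToHom _ _) }

end ToLocal

/-! ### Including the local fibre into the total fibre. -/

section OfLocal
variable {P Q R : LocalFibre Γ c y}

/-- The action on objects of the comparison of the local fibre with the total fibre. -/
def ofLocalObj (P : LocalFibre Γ c y) : TotalFibre Γ c y :=
  ⟨⟨c, P.base⟩, inclHom E c P.hom⟩

theorem ofLocalHom_eq (m : P ⟶ Q) : inclHom E c ((component Γ c).map m.base ≫ Q.hom) =
    mapHom Γ (inclHom D c m.base) ≫ inclHom E c Q.hom := by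
  rw [inclHom_comp]
  refine congrArg (· ≫ inclHom E c Q.hom) (Hom.hext rfl ?_)
  exact (arr_inclHom E c _).trans
    (Eq.symm ((arr_mapHom Γ _).trans (Arr.map rfl (arr_inclHom D c m.base))))

/-- The action on 1-cells of the comparison of the local fibre with the total fibre. -/
def ofLocalHom (m : P ⟶ Q) : ofLocalObj P ⟶ ofLocalObj Q :=
  ⟨inclHom D c m.base, inclHom₂ E c m.cell ≫ eqToHom (ofLocalHom_eq m)⟩

theorem cell_ofLocalHom (m : P ⟶ Q) :
    Cell.mk (ofLocalHom m).cell = Cell.mk (inclHom₂ E c m.cell) :=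
  Cell.comp_eqToHom _ _

theorem mapHom_inclHom (Γ : TwoNatTrans D E) {x y : D.obj c} (v : x ⟶ y) :
    mapHom Γ (inclHom D c v) = inclHom E c ((component Γ c).map v) :=
  Hom.hext rfl (((arr_mapHom Γ _).trans (Arr.map rfl (arr_inclHom D c v))).trans
    (arr_inclHom E c _).symm)

theorem cell_mapHom₂_inclHom₂ (Γ : TwoNatTrans D E) {x y : D.obj c} {v v' : x ⟶ y} (ψ : v ⟶ v') :
    Cell.mk (B := Groth E) (dom := mapHom Γ (inclHom D c v)) (cod := mapHom Γ (inclHom D c v'))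
      (mapHom₂ Γ (inclHom₂ D c ψ)) = Cell.mk (inclHom₂ E c ((component Γ c).map₂ ψ)) :=
  cell_congr (mapHom_inclHom Γ v) (mapHom_inclHom Γ v') rfl
    (((cell_mapHom₂ Γ _).trans (Cell.map rfl (cell_inclHom₂ D c ψ))).trans
      (cell_inclHom₂ E c _).symm)

/-- The action on 2-cells of the comparison of the local fibre with the total fibre. -/
def ofLocalHom₂ {m n : P ⟶ Q} (ψ : m ⟶ n) : ofLocalHom m ⟶ ofLocalHom n :=
  ⟨inclHom₂ D c ψ.cell, by
    refine Cell.inj (Eq.trans ?_ (cell_ofLocalHom n).symm)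
    refine Eq.trans ?_ (congrArg (fun t => Cell.mk (inclHom₂ E c t)) ψ.w)
    refine Eq.trans ?_ (Cell.map_comp (incl E c) _ _).symm
    refine Cell.vcomp (cell_ofLocalHom m) (Eq.trans ?_ (Cell.map_right (incl E c) _ _).symm)
    exact Cell.right (cell_mapHom₂_inclHom₂ Γ ψ.cell) rfl⟩

theorem ofLocalHom_id (P : LocalFibre Γ c y) : ofLocalHom (𝟙 P) = 𝟙 (ofLocalObj P) :=
  OverFibre.Hom.ext_cell (inclHom_id D c P.base) <|
    (((OverFibre.isIdCell_cell_id P).map (incl E c)).of_cell (cell_ofLocalHom _)).congr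
      (OverFibre.isIdCell_cell_id _) rfl

theorem ofLocalHom_comp (m : P ⟶ Q) (n : Q ⟶ R) :
    ofLocalHom (m ≫ n) = ofLocalHom m ≫ ofLocalHom n := by
  refine OverFibre.Hom.ext_cell (inclHom_comp D c m.base n.base) ((cell_ofLocalHom _).trans ?_)
  refine (Cell.map_comp (incl E c) _ _).trans (Cell.vcomp (cell_ofLocalHom m).symm ?_)
  refine Eq.trans ?_ (Cell.comp_eqToHom _ _).symm
  refine (Cell.map rfl (Cell.comp_eqToHom _ _)).trans ((Cell.map_left (incl E c) _ _).trans ?_)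
  exact Cell.left (congrArg Arr.mk (mapHom_inclHom Γ m.base).symm) (cell_ofLocalHom n).symm

variable (Γ c y) in
/-- The comparison of the local fibre with the total fibre. -/
def ofLocal : StrictPseudofunctor (LocalFibre Γ c y) (TotalFibre Γ c y) :=
  StrictPseudofunctor.mk''
    { obj := ofLocalObj
      map := ofLocalHom
      map₂ := ofLocalHom₂
      map₂_id := fun m => OverFibre.Hom₂.eq_of_cell ((incl D c).map₂_id m.base)
      map₂_comp := fun ψ ψ' => OverFibre.Hom₂.eq_of_cell ((incl D c).map₂_comp ψ.cell ψ'.cell)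
      map_id := ofLocalHom_id
      map_comp := ofLocalHom_comp
      map₂_whisker_left := fun {_ _ _} m {n n'} ψ => eq_conj_of_cell
        (OverFibre.cell_congr (ofLocalHom_comp m n) (ofLocalHom_comp m n')
          (Cell.map_left (incl D c) m.base ψ.cell)) _ _
      map₂_whisker_right := fun {_ _ _ m m'} ψ n => eq_conj_of_cell
        (OverFibre.cell_congr (ofLocalHom_comp m n) (ofLocalHom_comp m' n)
          (Cell.map_right (incl D c) ψ.cell n.base)) _ _ }

theorem legCell_ofLocalHom (m : P ⟶ Q) :
    legCell (ofLocalHom m) = eqToHom (Strict.id_comp (𝟙 c)).symm :=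
  (congrArg (𝟙 (𝟙 c) ≫ ·) (base_eqToHom (ofLocalHom_eq m))).trans (Category.id_comp _)

theorem cell_toLocalHom_ofLocalHom (m : P ⟶ Q) :
    Cell.mk (toLocalHom (ofLocalHom m)).cell = Cell.mk m.cell :=
  (cell_toLocalHom _).trans <| (fiber_comp (inclHom₂ E c m.cell)
    (fiber_eqToHom (ofLocalHom_eq m))).trans (cell_inclHom₂ E c m.cell)

theorem arr_toLocalObj_ofLocalObj (P : LocalFibre Γ c y) :
    Arr.mk (toLocalObj (ofLocalObj P)).hom = Arr.mk P.hom :=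
  (arr_toLocalObj _).trans (arr_inclHom E c P.hom)

theorem arr_shift_ofLocalHom (m : P ⟶ Q) :
    Arr.mk (shift D (legCell (ofLocalHom m)) P.base) = Arr.mk (𝟙 P.base) :=
  (congrArg (fun α => Arr.mk (shift D α P.base)) (legCell_ofLocalHom m)).trans <|
    (congrArg Arr.mk (shift_eqToHom D (Strict.id_comp (𝟙 c)).symm P.base)).trans <|
      Arr.eqToHom_eq _ rfl ((push_id_obj D c _).trans (push_id_obj D c _))

variable (Γ c y) in
-- The leg of an included object is the identity of `c`, along which pushing forward does nothing,
-- and the shifts involved are identities. The equality is strict, so one half of the homotopy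
-- equivalence is free.
theorem ofLocal_comp_toLocal :
    (ofLocal Γ c y).comp (toLocal Γ c y) = StrictPseudofunctor.id (LocalFibre Γ c y) :=
  strictPseudofunctor_eq_of_cell fun {P Q m n} ψ => by
    refine OverFibre.cell_ext (f' := m) (g' := n) (θ := ψ) ?_ (arr_toLocalObj_ofLocalObj P)
      (arr_toLocalObj_ofLocalObj Q) (cell_toLocalHom_ofLocalHom m) (cell_toLocalHom_ofLocalHom n)
    refine (cell_transport₂ D _ (legCell_whiskerRight (ofLocalHom₂ ψ)) _).trans ?_
    exact (Cell.left (arr_shift_ofLocalHom m) ((push_id_map₂ D _).trans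
      (cell_inclHom₂ D c ψ.cell))).trans (Cell.eqToHom_left rfl _)

end OfLocal

/-! ### The cocartesian 1-cells as a lax transformation. -/

section Unit
variable {X Y Z : TotalFibre Γ c y}

/-- The cocartesian 1-cell over the structure 1-cell of an object of the total fibre. -/
def legHom (X : TotalFibre Γ c y) : X.base ⟶ (⟨c, (toLocalObj X).base⟩ : Groth D) :=
  ⟨leg X, 𝟙 _⟩

theorem arr_push_mapHom_legHom (X : TotalFibre Γ c y) :
    Arr.mk ((push E (𝟙 c)).map (mapHom Γ (legHom X)).fiber) =
      Arr.mk (𝟙 ((component Γ c).obj (toLocalObj X).base)) :=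
  (push_id_map E _).trans ((arr_mapHom Γ (legHom X)).trans
    (congrArg Arr.mk ((component Γ c).map_id _)))

/-- The factorization of `(f, u)` as the cocartesian `(f, 1)` followed by the vertical `(1, u)`. It
allows the component of the unit to carry an identity structure 2-cell. -/
theorem legHom_eq (X : TotalFibre Γ c y) :
    X.hom = mapHom Γ (legHom X) ≫ inclHom E c (toLocalObj X).hom := by
  refine Hom.hext (Strict.comp_id (leg X)).symm ?_
  refine Eq.trans ?_ (arr_comp (mapHom Γ (legHom X)) (inclHom E c (toLocalObj X).hom)).symm
  refine Eq.trans ?_ (Arr.comp (arr_push_mapHom_legHom X)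
    ((arr_inclHom E c (toLocalObj X).hom))).symm
  exact (arr_toLocalObj X).symm.trans (congrArg Arr.mk (Strict.id_comp _).symm)

/-- The component of the unit. -/
def unitApp (X : TotalFibre Γ c y) : X ⟶ ofLocalObj (toLocalObj X) :=
  ⟨legHom X, eqToHom (legHom_eq X)⟩

theorem arr_push_legHom (X : TotalFibre Γ c y) :
    Arr.mk ((push D (𝟙 c)).map (legHom X).fiber) = Arr.mk (𝟙 (toLocalObj X).base) :=
  push_id_map D _

theorem arr_comp_legHom {W : Groth D} (f : W ⟶ X.base) :
    Arr.mk (f ≫ legHom X).fiber = Arr.mk ((push D (leg X)).map f.fiber) :=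
  (arr_comp f (legHom X)).trans (congrArg Arr.mk (Strict.comp_id _))

theorem arr_pushCell_eqToHom_comp {a b : C} {f g h : a ⟶ b} (e : f = g) (α : g ⟶ h)
    (x : D.obj a) : Arr.mk (pushCell D (eqToHom e ≫ α) x) = Arr.mk (pushCell D α x) := by
  subst e
  rw [eqToHom_refl, Category.id_comp]

/-- Both sides are the shift of `x` along `legCell m` followed by a pushforward of the fibre
component of `m`. The 2-cell of the unit can therefore have identity fibre component, all its
content being `legCell m`. -/
theorem unitCell_eq (m : X ⟶ Y) :
    (legHom X ≫ inclHom D c (toLocalHom m).base).fiber =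
      pushCell D (eqToHom (Strict.comp_id (leg X)) ≫ legCell m) X.base.fiber ≫
        (m.base ≫ legHom Y).fiber := by
  apply Arr.inj
  refine (arr_comp (legHom X) (inclHom D c (toLocalHom m).base)).trans ?_
  refine (Arr.comp (arr_push_legHom X) (arr_inclHom D c (toLocalHom m).base)).trans ?_
  refine (congrArg Arr.mk (Strict.id_comp (toLocalHom m).base)).trans ?_
  refine Arr.comp ?_ (arr_comp_legHom m.base).symm
  exact (arr_shift D _ _).trans (arr_pushCell_eqToHom_comp _ _ _).symm

/-- The 2-cell of the unit, in the Grothendieck construction. -/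
def unitBase (m : X ⟶ Y) : legHom X ≫ inclHom D c (toLocalHom m).base ⟶ m.base ≫ legHom Y :=
  ⟨eqToHom (Strict.comp_id (leg X)) ≫ legCell m, eqToHom (unitCell_eq m)⟩

theorem isIdCell_unitBase (m : X ⟶ Y) : IsIdCell (unitBase m).fiber :=
  isIdCell_eqToHom (unitCell_eq m)

theorem cell_unitBase (m : X ⟶ Y) : Cell.mk (unitBase m).base = Cell.mk (legCell m) :=
  Cell.eqToHom_comp _ _

theorem isIdCell_ofLocalHom_cell_base {P Q : LocalFibre Γ c y} (m : P ⟶ Q) :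
    IsIdCell (ofLocalHom m).cell.base :=
  (isIdCell_eqToHom _).of_cell (congrArg Cell.mk (legCell_ofLocalHom m))

theorem cell_ofLocalHom_fiber {P Q : LocalFibre Γ c y} (m : P ⟶ Q) :
    Cell.mk (ofLocalHom m).cell.fiber = Cell.mk m.cell :=
  (fiber_comp (inclHom₂ E c m.cell) (fiber_eqToHom (ofLocalHom_eq m))).trans
    (cell_inclHom₂ E c m.cell)

theorem comp_cell_base {W : TotalFibre Γ c y} (m : W ⟶ X) (n : X ⟶ Y) :
    Cell.mk (m ≫ n).cell.base = Cell.mk (m.cell.base ≫ m.base.base ◁ n.cell.base) :=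
  (congrArg Cell.mk (legCell_comp m n)).trans (Cell.vcomp rfl (Cell.comp_eqToHom _ _))

theorem legCell_unitApp (X : TotalFibre Γ c y) :
    legCell (unitApp X) = eqToHom (Strict.comp_id (leg X)).symm :=
  base_eqToHom (legHom_eq X)

theorem cell_whiskerL_ofLocalHom {Q : LocalFibre Γ c y} (n : toLocalObj X ⟶ Q) :
    Cell.mk (pushCell E (legCell (unitApp X)) ((component Γ X.base.base).obj X.base.fiber) ◁
      (whiskerL (mapHom Γ (legHom X)) (ofLocalHom n).cell).fiber) = Cell.mk n.cell := by
  refine (Cell.left (congrArg Arr.mk ((congrArg (pushCell E · _) (legCell_unitApp X)).trans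
    (pushCell_eqToHom E (Strict.comp_id (leg X)).symm _))) rfl).trans ?_
  refine (Cell.eqToHom_left _ _).trans ((cell_whiskerL _ _).trans ?_)
  exact (Cell.left (arr_push_mapHom_legHom X) (cell_ofLocalHom_fiber n)).trans
    (Cell.eqToHom_left rfl _)

theorem isIdCell_mapHom₂ (Γ : TwoNatTrans D E) {V W : Groth D} {f g : V ⟶ W} {η : f ⟶ g}
    (hη : IsIdCell η.fiber) : IsIdCell (mapHom₂ Γ η).fiber :=
  (hη.map _).of_cell (cell_mapHom₂ Γ η)

theorem legFiberCell_unitApp_comp {Q : LocalFibre Γ c y} (n : toLocalObj X ⟶ Q) :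
    Cell.mk (legFiberCell (unitApp X ≫ ofLocalHom n)) = Cell.mk n.cell :=
  (legFiberCell_comp (unitApp X) (ofLocalHom n)).trans <|
    (IsIdCell.comp_cell (fiber_eqToHom (legHom_eq X)) _).trans (cell_whiskerL_ofLocalHom n)

theorem legFiberCell_comp_unitApp (m : X ⟶ Y) :
    Cell.mk (legFiberCell (m ≫ unitApp Y)) = Cell.mk (legFiberCell m) :=
  have h : IsIdCell (unitApp Y).cell.fiber := fiber_eqToHom (legHom_eq Y)
  (legFiberCell_comp m (unitApp Y)).trans <| IsIdCell.cell_comp _ <|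
    ((h.left _).of_cell (cell_whiskerL (mapHom Γ m.base) (unitApp Y).cell)).left _

theorem legCell_comp_unitApp (m : X ⟶ Y) :
    Cell.mk (legCell (m ≫ unitApp Y)) = Cell.mk (legCell m) :=
  (comp_cell_base m (unitApp Y)).trans
    (((isIdCell_base_eqToHom (legHom_eq Y)).left _).cell_comp _)

theorem isIdCell_legCell_unitApp_comp {Q : LocalFibre Γ c y} (n : toLocalObj X ⟶ Q) :
    IsIdCell (legCell (unitApp X ≫ ofLocalHom n)) :=
  ((isIdCell_base_eqToHom (legHom_eq X)).comp
    ((isIdCell_ofLocalHom_cell_base n).left (leg X))).of_cell (comp_cell_base _ _)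

/-- The unit components and the inclusion contribute identity cells. What is left on either side is
`legCell m` in the base and `legFiberCell m` in the fibre. -/
theorem unitCell_w (m : X ⟶ Y) :
    (unitApp X ≫ ofLocalHom (toLocalHom m)).cell ≫
      mapHom₂ Γ (unitBase m) ▷ inclHom E c (toLocalObj Y).hom = (m ≫ unitApp Y).cell := by
  refine Hom₂.eq_of_cell (Cell.inj ?_) ?_
  · refine ((isIdCell_legCell_unitApp_comp (toLocalHom m)).comp_cell _).trans ?_
    exact ((Cell.right_eqToHom rfl _).trans (cell_unitBase m)).trans
      (legCell_comp_unitApp m).symm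
  · refine (fiber_comp _ (isIdCell_whiskerRight (isIdCell_mapHom₂ Γ (isIdCell_unitBase m))
      _)).trans ?_
    exact (legFiberCell_unitApp_comp (toLocalHom m)).trans
      ((cell_toLocalHom m).trans (legFiberCell_comp_unitApp m).symm)

/-- The 2-cell of the unit. -/
def unitCell (m : X ⟶ Y) : unitApp X ≫ ofLocalHom (toLocalHom m) ⟶ m ≫ unitApp Y :=
  ⟨unitBase m, unitCell_w m⟩

/-- In the base this is the base component of the condition on `η`. In the fibre both sides are the
pushed fibre component of `η`, whiskered by the shift along `legCell m`. -/
theorem unitBase_naturality {m n : X ⟶ Y} (η : m ⟶ n) :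
    legHom X ◁ inclHom₂ D c (toLocalHom₂ η).cell ≫ unitBase n =
      unitBase m ≫ η.cell ▷ legHom Y := by
  refine Hom₂.eq_of_cell (Cell.inj ?_) ?_
  · refine (IsIdCell.comp_cell ((isIdCell_id (𝟙 c)).left (leg X)) _).trans ?_
    refine (cell_unitBase n).trans (Eq.trans ?_ (Cell.vcomp (cell_unitBase m) rfl).symm)
    exact congrArg Cell.mk (legCell_whiskerRight η).symm
  · refine (fiber_comp _ (isIdCell_unitBase n)).trans ?_
    refine Eq.trans ?_ ((cell_vcomp (unitBase m) _).trans
      ((isIdCell_unitBase m).comp_cell _)).symm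
    refine (cell_whiskerL _ _).trans ?_
    refine (Cell.left (arr_push_legHom X) (cell_inclHom₂ D c _)).trans
      ((Cell.eqToHom_left rfl _).trans
        ((cell_transport₂ D _ (legCell_whiskerRight η) _).trans ?_))
    refine Cell.left ((arr_shift D _ _).trans (arr_pushCell_eqToHom_comp _ _ _).symm) ?_
    exact Eq.symm ((cell_whiskerR η.cell (legHom Y)).trans (Cell.right_eqToHom rfl _))

theorem unitApp_comp_id (X : TotalFibre Γ c y) :
    unitApp X ≫ ofLocalHom (toLocalHom (𝟙 X)) = unitApp X := by
  rw [toLocalHom_id, ofLocalHom_id, Strict.comp_id]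

theorem unitApp_comp_comp (m : X ⟶ Y) (n : Y ⟶ Z) :
    unitApp X ≫ ofLocalHom (toLocalHom (m ≫ n)) =
      (unitApp X ≫ ofLocalHom (toLocalHom m)) ≫ ofLocalHom (toLocalHom n) := by
  rw [toLocalHom_comp, ofLocalHom_comp, Strict.assoc]

theorem isIdCell_cell_base_eqToHom {m n : X ⟶ Y} (h : m = n) :
    IsIdCell (eqToHom h : m ⟶ n).cell.base := by
  subst h
  rfl

theorem isIdCell_cell_fiber_eqToHom {m n : X ⟶ Y} (h : m = n) :
    IsIdCell (eqToHom h : m ⟶ n).cell.fiber := by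
  subst h
  exact cell_id₂ m.base

variable (Γ c y) in
/-- The unit of the comparison between the total fibre and the local fibre. -/
def unit : LaxNat (StrictPseudofunctor.id (TotalFibre Γ c y))
    ((toLocal Γ c y).comp (ofLocal Γ c y)) where
  app := unitApp
  cell := unitCell
  naturality η := OverFibre.Hom₂.eq_of_cell (unitBase_naturality η)
  cell_id X := by
    have h := unitApp_comp_id X
    refine OverFibre.cell_congr h (Strict.id_comp _) (cell_congr (congrArg OverFibre.Hom.base h)
      (congrArg OverFibre.Hom.base (Strict.id_comp (unitApp X))) ?_ ?_)
    · exact ((isIdCell_eqToHom _).of_cell ((cell_unitBase _).trans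
        (congrArg Cell.mk (legCell_id X)))).congr (isIdCell_id _)
        (congrArg Arr.mk (Strict.comp_id _))
    · exact (isIdCell_unitBase _).congr (cell_id₂ _)
        (congrArg (fun t : X ⟶ _ => Arr.mk t.base.fiber) h)
  cell_comp {X Y Z} m n := by
    have h := unitApp_comp_comp m n
    refine OverFibre.cell_congr h (Strict.assoc _ _ _) (cell_congr (congrArg OverFibre.Hom.base h)
      (congrArg OverFibre.Hom.base (Strict.assoc m n (unitApp Z))) ?_ ?_)
    -- In the base the composition law is the formula for `legCell` of a composite, the
    -- associativity equality contributing an identity.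
    · refine (cell_unitBase _).trans ((congrArg Cell.mk (legCell_comp m n)).trans ?_)
      refine Cell.vcomp ((cell_unitBase m).symm.trans (Cell.right_eqToHom rfl _).symm) ?_
      refine (Cell.comp_eqToHom _ _).trans (Eq.trans ?_ (IsIdCell.comp_cell ?_ _).symm)
      · exact Cell.left rfl (cell_unitBase n).symm
      · exact isIdCell_cell_base_eqToHom _
    -- In the fibre both sides are identity cells, so comparing their sources suffices.
    · refine (isIdCell_unitBase _).congr ?_
        (congrArg (fun t : X ⟶ _ => Arr.mk t.base.fiber) h)
      exact isIdCell_comp (isIdCell_whiskerRight (isIdCell_unitBase m) _)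
        (isIdCell_comp (isIdCell_cell_fiber_eqToHom _)
          (isIdCell_whiskerLeft _ (isIdCell_unitBase n)))

end Unit
end Groth
end TwoDiag

/-! ### Comparing the classifying spaces of the fibres. -/

namespace TwoDiag

/-- A strict equality on one side and a homotopy on the other make `L` and `J` realize to inverse
homotopy equivalences, along which contractibility passes both ways. -/
theorem weaklyContractible_iff_of_homotopic {A B : Type u} [Bicategory.{w, v} A] [Bicategory.{w, v} B]
    [Strict A] [Strict B] (L : StrictPseudofunctor A B) (J : StrictPseudofunctor B A)
    (h : J.comp L = StrictPseudofunctor.id B)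
    (h' : ContinuousMap.Homotopic (SSet.toTop.map (mapDiag (L.comp J))).hom
      (SSet.toTop.map (mapDiag (StrictPseudofunctor.id A))).hom) :
    WeaklyContractible A ↔ WeaklyContractible B := by
  let e : ContinuousMap.HomotopyEquiv (classifyingSpace A) (classifyingSpace B) :=
    { toFun := (SSet.toTop.map (mapDiag L)).hom
      invFun := (SSet.toTop.map (mapDiag J)).hom
      left_inv := by
        rw [mapDiag_comp, mapDiag_id, CategoryTheory.Functor.map_comp, CategoryTheory.Functor.map_id] at h'
        exact h'
      right_inv := by
        have h₁ := congrArg (fun F => (SSet.toTop.map (mapDiag F)).hom) h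
        rw [mapDiag_comp, mapDiag_id, CategoryTheory.Functor.map_comp, CategoryTheory.Functor.map_id] at h₁
        exact (congrArg (fun φ => ContinuousMap.Homotopic φ (ContinuousMap.id _)) h₁).mpr
          (ContinuousMap.Homotopic.refl _) }
  exact ⟨fun (_ : ContractibleSpace _) => e.symm.contractibleSpace,
    fun (_ : ContractibleSpace _) => e.contractibleSpace⟩

/-- Theorem A for covariant diagrams. -/
theorem Groth.homotopyLeftCofinal_map_iff {C : Type u} [Bicategory.{u, u} C] [Strict C]
    {D E : StrictPseudofunctor C TwoCat.{u, u, u}} (Γ : TwoNatTrans D E) :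
    HomotopyLeftCofinal (Groth.map Γ) ↔ ∀ c : C, HomotopyLeftCofinal (Γ.app c).toFunctor := by
  have h : ∀ (c : C) (y : E.obj c),
      WeaklyContractible (TotalFibre Γ c y) ↔ WeaklyContractible (LocalFibre Γ c y) := fun c y =>
    weaklyContractible_iff_of_homotopic (toLocal Γ c y) (ofLocal Γ c y)
      -- The unit starts at the identity, so its homotopy is reversed.
      (ofLocal_comp_toLocal Γ c y) (unit Γ c y).homotopic.symm
  -- An object of the Grothendieck construction is exactly a pair `(c, y)`, so the two
  -- quantifications match.
  exact ⟨fun H c y => (h c y).mp (H ⟨c, y⟩), fun H X => (h X.base X.fiber).mpr (H X.base X.fiber)⟩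

end TwoDiag

/-! ### Calculus of cells for contravariant diagrams -/

namespace TwoDiag
open Opposite Bicategory.Opposite

/-- Source and target of an identity cell coincide. The version through targets suits the
contravariant case, where composites accumulate in the source. -/
theorem IsIdCell.congr_cod {B : Type u} [Bicategory.{w, v} B] {a b a' b' : B} {f g : a ⟶ b}
    {f' g' : a' ⟶ b'} {η : f ⟶ g} {θ : f' ⟶ g'} (hη : IsIdCell η) (hθ : IsIdCell θ)
    (h : Arr.mk g = Arr.mk g') : Cell.mk η = Cell.mk θ := by
  obtain ⟨rfl, _⟩ := hη.exists_eq
  obtain ⟨rfl, _⟩ := hθ.exists_eq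
  exact hη.congr hθ h

/-! ### Comparing cells of the fibres under an object. -/

section UnderFibre
variable {A : Type u₁} [Bicategory.{w₁, v₁} A] [Strict A]
  {C : Type u₂} [Bicategory.{w₂, v₂} C] [Strict C] {F : StrictPseudofunctor A C} {c : C}

theorem UnderFibre.hom_eq (X : UnderFibre c F) : X.hom ≫ F.map (𝟙 X.base) = X.hom := by
  rw [F.map_id, Strict.comp_id]

theorem UnderFibre.isIdCell_cell_id (X : UnderFibre c F) : IsIdCell (𝟙 X : X ⟶ X).cell :=
  isIdCell_eqToHom (hom_eq X)

theorem UnderFibre.Hom.ext_cell {X Y : UnderFibre c F} {f g : X ⟶ Y} (h : f.base = g.base)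
    (h' : Cell.mk f.cell = Cell.mk g.cell) : f = g := by
  obtain ⟨f, φ⟩ := f
  obtain ⟨g, ψ⟩ := g
  dsimp only at h h'
  subst h
  rw [Cell.inj h']

theorem UnderFibre.cell_ext {X Y X' Y' : UnderFibre c F} {f g : X ⟶ Y} {f' g' : X' ⟶ Y'}
    {η : f ⟶ g} {θ : f' ⟶ g'} (h : Cell.mk η.cell = Cell.mk θ.cell)
    (hX : Arr.mk X.hom = Arr.mk X'.hom) (hY : Arr.mk Y.hom = Arr.mk Y'.hom)
    (hf : Cell.mk f.cell = Cell.mk f'.cell) (hg : Cell.mk g.cell = Cell.mk g'.cell) :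
    Cell.mk η = Cell.mk θ := by
  obtain ⟨X, p⟩ := X
  obtain ⟨Y, q⟩ := Y
  obtain ⟨X', p'⟩ := X'
  obtain ⟨Y', q'⟩ := Y'
  obtain ⟨f, φ⟩ := f
  obtain ⟨g, ψ⟩ := g
  obtain ⟨f', φ'⟩ := f'
  obtain ⟨g', ψ'⟩ := g'
  obtain ⟨η, hη⟩ := η
  obtain ⟨θ, hθ⟩ := θ
  dsimp only at *
  cases h
  obtain rfl := Arr.inj hX
  obtain rfl := Arr.inj hY
  obtain rfl := Cell.inj hf
  obtain rfl := Cell.inj hg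
  rfl

theorem UnderFibre.cell_congr {X Y : UnderFibre c F} {f g f' g' : X ⟶ Y} {η : f ⟶ g}
    {θ : f' ⟶ g'} (hf : f = f') (hg : g = g') (h : Cell.mk η.cell = Cell.mk θ.cell) :
    Cell.mk η = Cell.mk θ := by
  subst hf hg
  exact congrArg Cell.mk (Hom₂.eq_of_cell (Cell.inj h))

end UnderFibre

/-! ### Comparing cells of the contravariant Grothendieck construction. -/

section GrothOp
variable {C : Type u₁} [Bicategory.{w₁, v₁} C] [Strict C]
  {D : StrictPseudofunctor Cᵒᵖ TwoCat.{w, v, u}}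

theorem GrothOp.cell_congr {X Y : GrothOp D} {f g f' g' : X ⟶ Y} {η : f ⟶ g} {θ : f' ⟶ g'}
    (hf : f = f') (hg : g = g') (h : Cell.mk η.base = Cell.mk θ.base)
    (h' : Cell.mk η.fiber = Cell.mk θ.fiber) : Cell.mk η = Cell.mk θ := by
  subst hf hg
  exact congrArg Cell.mk (Hom₂.eq_of_cell (Cell.inj h) h')

theorem GrothOp.base_eqToHom {X Y : GrothOp D} {f g : X ⟶ Y} (h : f = g) :
    (eqToHom h : f ⟶ g).base = eqToHom (congrArg Hom.base h) := by
  subst h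
  rfl

theorem GrothOp.isIdCell_base_eqToHom {X Y : GrothOp D} {f g : X ⟶ Y} (h : f = g) :
    IsIdCell (eqToHom h : f ⟶ g).base := by
  subst h
  rfl

theorem GrothOp.isIdCell_fiber_id {X Y : GrothOp D} (f : X ⟶ Y) : IsIdCell (𝟙 f : f ⟶ f).fiber :=
  isIdCell_eqToHom (id₂_eq f)

theorem GrothOp.fiber_eqToHom {X Y : GrothOp D} {f g : X ⟶ Y} (h : f = g) :
    IsIdCell (eqToHom h : f ⟶ g).fiber := by
  subst h
  exact isIdCell_fiber_id f

theorem GrothOp.fiber_comp {X Y : GrothOp D} {f g h : X ⟶ Y} {η : f ⟶ g} (θ : g ⟶ h)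
    (hη : IsIdCell η.fiber) : Cell.mk (η ≫ θ).fiber = Cell.mk θ.fiber :=
  (cell_vcomp η θ).trans ((hη.right _).comp_cell _)

theorem GrothOp.isIdCell_comp {X Y : GrothOp D} {f g h : X ⟶ Y} {η : f ⟶ g} {θ : g ⟶ h}
    (hη : IsIdCell η.fiber) (hθ : IsIdCell θ.fiber) : IsIdCell (η ≫ θ).fiber :=
  hθ.of_cell (fiber_comp θ hη)

theorem GrothOp.isIdCell_whiskerLeft {X Y Z : GrothOp D} (f : X ⟶ Y) {g h : Y ⟶ Z} {η : g ⟶ h}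
    (hη : IsIdCell η.fiber) : IsIdCell (f ◁ η).fiber :=
  ((hη.map _).left _).of_cell (cell_whiskerL f η)

theorem GrothOp.isIdCell_whiskerRight {X Y Z : GrothOp D} {f g : X ⟶ Y} {η : f ⟶ g}
    (hη : IsIdCell η.fiber) (h : Y ⟶ Z) : IsIdCell (η ▷ h).fiber :=
  (hη.right _).of_cell (cell_whiskerR η h)

end GrothOp

/-! ### Transport along pullback 2-functors. -/

section PullTransport
variable {C : Type u₁} [Bicategory.{w₁, v₁} C] (D : StrictPseudofunctor Cᵒᵖ TwoCat.{w, v, u})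
  {a b d c : C} {f : c ⟶ a} {g : c ⟶ b} {k : c ⟶ d} {h h' h'' : a ⟶ b} {l l' : b ⟶ d}

theorem pullCell_eqToHom {a b : C} {f g : a ⟶ b} (e : f = g) (x : D.obj (op b)) :
    pullCell D (eqToHom e) x = eqToHom (by rw [e]) := by
  subst e
  exact pullCell_id D f x

/-- The 1-cell `f^* (h^* x) ⟶ g^* x` of a 2-cell `f ≫ h ⟶ g`. -/
def pullShift (α : f ≫ h ⟶ g) (x : D.obj (op b)) :
    (pull D f).obj ((pull D h).obj x) ⟶ (pull D g).obj x :=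
  eqToHom (pull_comp_obj D f h x) ≫ pullCell D α x

theorem arr_pullShift (α : f ≫ h ⟶ g) (x : D.obj (op b)) :
    Arr.mk (pullShift D α x) = Arr.mk (pullCell D α x) :=
  Arr.eqToHom_comp _ _

theorem pullShift_eqToHom (e : f ≫ h = g) (x : D.obj (op b)) :
    pullShift D (eqToHom e) x = eqToHom (by rw [← e, pull_comp_obj]) := by
  rw [pullShift, pullCell_eqToHom, eqToHom_trans]

theorem pullShift_naturality (α : f ≫ h ⟶ g) {x y : D.obj (op b)} (w : x ⟶ y) :
    Arr.mk ((pull D f).map ((pull D h).map w) ≫ pullShift D α y) =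
      Arr.mk (pullShift D α x ≫ (pull D g).map w) := by
  refine Eq.trans ?_ (Arr.comp (arr_pullShift D α x) rfl).symm
  refine Eq.trans ?_ (Arr.naturality (D.map₂ (op2 α)).toNatTrans w)
  exact Arr.comp (pull_comp_map D f h w).symm (arr_pullShift D α y)

theorem pullShift_naturality₂ (α : f ≫ h ⟶ g) {x y : D.obj (op b)} {w w' : x ⟶ y} (ψ : w ⟶ w') :
    Cell.mk ((pull D f).map₂ ((pull D h).map₂ ψ) ▷ pullShift D α y) =
      Cell.mk (pullShift D α x ◁ (pull D g).map₂ ψ) := by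
  refine Eq.trans ?_ (Cell.left (arr_pullShift D α x) rfl).symm
  refine Eq.trans ?_ (Cell.naturality (D.map₂ (op2 α)).toNatTrans ψ)
  exact Cell.right (pull_comp_map₂ D f h ψ).symm (arr_pullShift D α y)

theorem pullShift_whiskerLeft (η : h ⟶ h') (α : f ≫ h' ⟶ g) (x : D.obj (op b)) :
    Arr.mk (pullShift D (f ◁ η ≫ α) x) =
      Arr.mk ((pull D f).map (pullCell D η x) ≫ pullShift D α x) := by
  refine (arr_pullShift D _ x).trans ?_
  rw [pullCell_comp]
  exact Arr.comp (pullCell_left D f η x) (arr_pullShift D α x).symm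

variable [Strict C] in
-- Preservation of pasting again; under pullback it is right whiskering by `l` that becomes
-- evaluation, at `l^* z`.
theorem pullShift_comp (α : f ≫ h ⟶ g) (β : g ≫ l ⟶ k) (z : D.obj (op d)) :
    Arr.mk ((pull D f).map (eqToHom (pull_comp_obj D h l z)) ≫
        pullShift D (eqToHom (Strict.assoc f h l).symm ≫ α ▷ l ≫ β) z) =
      Arr.mk (pullShift D α ((pull D l).obj z) ≫ pullShift D β z) := by
  rw [map_eqToHom]
  refine (Arr.eqToHom_comp _ _).trans ((arr_pullShift D _ z).trans ?_)
  rw [pullCell_comp, pullCell_comp, pullCell_eqToHom]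
  refine (Arr.eqToHom_comp _ _).trans ?_
  refine Arr.comp ?_ (arr_pullShift D β z).symm
  exact (pullCell_right D α l z).trans (arr_pullShift D α _).symm

/-- Transport of a 1-cell along a 2-cell `f ≫ h ⟶ g`. -/
def pullTransport (α : f ≫ h ⟶ g) {x : D.obj (op a)} {y : D.obj (op b)}
    (w : x ⟶ (pull D h).obj y) : (pull D f).obj x ⟶ (pull D g).obj y :=
  (pull D f).map w ≫ pullShift D α y

theorem pullTransport_id (e : f ≫ 𝟙 a = f) (x : D.obj (op a)) :
    pullTransport D (eqToHom e) (eqToHom (pull_id_obj D a x)) = 𝟙 ((pull D f).obj x) := by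
  apply Arr.inj
  rw [pullTransport, map_eqToHom, pullShift_eqToHom]
  refine (Arr.comp_eqToHom _ _).trans ?_
  exact Arr.eqToHom_eq _ rfl (by rw [← pull_id_obj])

variable [Strict C] in
-- The part of the pasting law that does not involve `w`: naturality of the shift along `α` moves it
-- past `w'`. It serves both composition of 1-cells and right whiskering.
theorem pullShift_comp_map (α : f ≫ h ⟶ g) (β : g ≫ l ⟶ k) {y : D.obj (op b)} {z : D.obj (op d)}
    (w' : y ⟶ (pull D l).obj z) :
    Arr.mk ((pull D f).map ((pull D h).map w' ≫ eqToHom (pull_comp_obj D h l z)) ≫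
        pullShift D (eqToHom (Strict.assoc f h l).symm ≫ α ▷ l ≫ β) z) =
      Arr.mk (pullShift D α y ≫ pullTransport D β w') := by
  refine (Arr.comp (Arr.map_comp _ _ _) rfl).trans ((Arr.assoc _ _ _).trans ?_)
  refine (Arr.comp rfl (pullShift_comp D α β z)).trans ?_
  refine (Arr.assoc _ _ _).symm.trans (Eq.trans ?_ (Arr.assoc _ _ _))
  exact Arr.comp (pullShift_naturality D α w') rfl

variable [Strict C] in
theorem pullTransport_comp (α : f ≫ h ⟶ g) (β : g ≫ l ⟶ k) {x : D.obj (op a)} {y : D.obj (op b)}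
    {z : D.obj (op d)} (w : x ⟶ (pull D h).obj y) (w' : y ⟶ (pull D l).obj z) :
    pullTransport D (eqToHom (Strict.assoc f h l).symm ≫ α ▷ l ≫ β)
        (w ≫ (pull D h).map w' ≫ eqToHom (pull_comp_obj D h l z)) =
      pullTransport D α w ≫ pullTransport D β w' := by
  apply Arr.inj
  refine (Arr.comp (Arr.map_comp _ _ _) rfl).trans ((Arr.assoc _ _ _).trans ?_)
  exact (Arr.comp rfl (pullShift_comp_map D α β w')).trans (Arr.assoc _ _ _).symm

theorem pullTransport₂_eq {α : f ≫ h ⟶ g} {β : f ≫ h' ⟶ g} (η : h ⟶ h') (e : f ◁ η ≫ β = α)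
    {x : D.obj (op a)} {y : D.obj (op b)} (w : x ⟶ (pull D h).obj y) :
    pullTransport D α w = (pull D f).map (w ≫ pullCell D η y) ≫ pullShift D β y := by
  subst e
  apply Arr.inj
  refine Eq.trans ?_ (Arr.comp (Arr.map_comp _ _ _) rfl).symm
  exact (Arr.comp rfl (pullShift_whiskerLeft D η β y)).trans (Arr.assoc _ _ _).symm

/-- Transport of a 2-cell. -/
def pullTransport₂ {α : f ≫ h ⟶ g} {β : f ≫ h' ⟶ g} (η : h ⟶ h') (e : f ◁ η ≫ β = α)
    {x : D.obj (op a)} {y : D.obj (op b)} {w : x ⟶ (pull D h).obj y} {w' : x ⟶ (pull D h').obj y}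
    (ψ : w ≫ pullCell D η y ⟶ w') : pullTransport D α w ⟶ pullTransport D β w' :=
  eqToHom (pullTransport₂_eq D η e w) ≫ (pull D f).map₂ ψ ▷ pullShift D β y

theorem cell_pullTransport₂ {α : f ≫ h ⟶ g} {β : f ≫ h' ⟶ g} (η : h ⟶ h') (e : f ◁ η ≫ β = α)
    {x : D.obj (op a)} {y : D.obj (op b)} {w : x ⟶ (pull D h).obj y} {w' : x ⟶ (pull D h').obj y}
    (ψ : w ≫ pullCell D η y ⟶ w') : Cell.mk (pullTransport₂ D η e ψ) =
      Cell.mk ((pull D f).map₂ ψ ▷ pullShift D β y) :=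
  Cell.eqToHom_comp _ _

theorem pullTransport₂_isIdCell {α : f ≫ h ⟶ g} {β : f ≫ h' ⟶ g} (η : h ⟶ h')
    (e : f ◁ η ≫ β = α) {x : D.obj (op a)} {y : D.obj (op b)} {w : x ⟶ (pull D h).obj y}
    {w' : x ⟶ (pull D h').obj y} {ψ : w ≫ pullCell D η y ⟶ w'} (hψ : IsIdCell ψ) :
    IsIdCell (pullTransport₂ D η e ψ) :=
  ((hψ.map _).right _).of_cell (cell_pullTransport₂ D η e ψ)

/-- The shift along `β` is the pullback of `θ^* y` followed by the shift along `γ`, which absorbs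
the whiskering in vertical composites. -/
theorem pullTransport₂_vcomp {α : f ≫ h ⟶ g} {β : f ≫ h' ⟶ g} {γ : f ≫ h'' ⟶ g} (η : h ⟶ h')
    (θ : h' ⟶ h'') (κ : h ⟶ h'') (e : f ◁ η ≫ β = α) (e' : f ◁ θ ≫ γ = β) (e'' : f ◁ κ ≫ γ = α)
    {x : D.obj (op a)} {y : D.obj (op b)} {w : x ⟶ (pull D h).obj y} {w' : x ⟶ (pull D h').obj y}
    {w'' : x ⟶ (pull D h'').obj y} (ψ : w ≫ pullCell D η y ⟶ w')
    (ψ' : w' ≫ pullCell D θ y ⟶ w'') (ψ'' : w ≫ pullCell D κ y ⟶ w'')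
    (hψ : Cell.mk ψ'' = Cell.mk (ψ ▷ pullCell D θ y ≫ ψ')) :
    pullTransport₂ D κ e'' ψ'' = pullTransport₂ D η e ψ ≫ pullTransport₂ D θ e' ψ' := by
  apply Cell.inj
  refine (cell_pullTransport₂ D κ e'' ψ'').trans ?_
  refine (Cell.right ((Cell.map rfl hψ).trans (Cell.map_comp _ _ _)) rfl).trans ?_
  rw [comp_whiskerRight]
  refine Cell.vcomp ?_ (cell_pullTransport₂ D θ e' ψ').symm
  refine (Cell.right (Cell.map_right _ _ _) rfl).trans ((Cell.right_comp _ _ _).symm.trans ?_)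
  refine Eq.trans ?_ (cell_pullTransport₂ D η e ψ).symm
  subst e'
  exact Cell.right rfl (pullShift_whiskerLeft D θ γ y).symm

variable [Strict C] in
-- Compared with the covariant case the roles are exchanged: it is now left whiskering that moves a
-- 2-cell past a shift and needs naturality on 2-cells.
theorem pullTransport₂_whiskerLeft (α : f ≫ h ⟶ g) {β : g ≫ l ⟶ k} {β' : g ≫ l' ⟶ k} (η : l ⟶ l')
    (e : g ◁ η ≫ β' = β)
    {γ : f ≫ h ≫ l ⟶ k} {γ' : f ≫ h ≫ l' ⟶ k} (e' : f ◁ h ◁ η ≫ γ' = γ)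
    (hγ : γ' = eqToHom (Strict.assoc f h l').symm ≫ α ▷ l' ≫ β')
    {x : D.obj (op a)} {y : D.obj (op b)} {z : D.obj (op d)} (w : x ⟶ (pull D h).obj y)
    {v : y ⟶ (pull D l).obj z} {v' : y ⟶ (pull D l').obj z} (ψ : v ≫ pullCell D η z ⟶ v')
    (ψ' : (w ≫ (pull D h).map v ≫ eqToHom (pull_comp_obj D h l z)) ≫ pullCell D (h ◁ η) z ⟶
      w ≫ (pull D h).map v' ≫ eqToHom (pull_comp_obj D h l' z))
    (hψ : Cell.mk ψ' =
      Cell.mk (w ◁ (pull D h).map₂ ψ ▷ eqToHom (pull_comp_obj D h l' z))) :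
    Cell.mk (pullTransport₂ D (h ◁ η) e' ψ') =
      Cell.mk (pullTransport D α w ◁ pullTransport₂ D η e ψ) := by
  refine (cell_pullTransport₂ D _ e' ψ').trans ?_
  subst hγ
  refine (Cell.right ((Cell.map rfl hψ).trans ((Cell.map_left _ _ _).trans
    (Cell.left rfl (Cell.map_right _ _ _)))) rfl).trans ?_
  refine (Cell.left_right _ _ _).trans ?_
  refine Eq.trans ?_ (Cell.left rfl (cell_pullTransport₂ D η e ψ)).symm
  refine Eq.trans ?_ (Cell.comp_left _ _ _).symm
  refine Cell.left rfl ?_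
  refine (Cell.right_comp _ _ _).symm.trans ((Cell.right rfl (pullShift_comp D α β' z)).trans ?_)
  refine (Cell.right_comp _ _ _).trans ((Cell.right (pullShift_naturality₂ D α ψ) rfl).trans ?_)
  exact Cell.left_right _ _ _

variable [Strict C] in
-- Only the 1-cell `v` is moved past a shift, so `pullShift_comp_map` suffices.
theorem pullTransport₂_whiskerRight {α : f ≫ h ⟶ g} {α' : f ≫ h' ⟶ g} (η : h ⟶ h')
    (e : f ◁ η ≫ α' = α) (β : g ≫ l ⟶ k)
    {γ : f ≫ h ≫ l ⟶ k} {γ' : f ≫ h' ≫ l ⟶ k} (e' : f ◁ η ▷ l ≫ γ' = γ)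
    (hγ : γ' = eqToHom (Strict.assoc f h' l).symm ≫ α' ▷ l ≫ β)
    {x : D.obj (op a)} {y : D.obj (op b)} {z : D.obj (op d)} {w : x ⟶ (pull D h).obj y}
    {w' : x ⟶ (pull D h').obj y} (ψ : w ≫ pullCell D η y ⟶ w') (v : y ⟶ (pull D l).obj z)
    (ψ' : (w ≫ (pull D h).map v ≫ eqToHom (pull_comp_obj D h l z)) ≫ pullCell D (η ▷ l) z ⟶
      w' ≫ (pull D h').map v ≫ eqToHom (pull_comp_obj D h' l z))
    (hψ : Cell.mk ψ' =
      Cell.mk (ψ ▷ ((pull D h').map v ≫ eqToHom (pull_comp_obj D h' l z)))) :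
    Cell.mk (pullTransport₂ D (η ▷ l) e' ψ') =
      Cell.mk (pullTransport₂ D η e ψ ▷ pullTransport D β v) := by
  refine (cell_pullTransport₂ D _ e' ψ').trans ?_
  subst hγ
  refine (Cell.right ((Cell.map rfl hψ).trans (Cell.map_right _ _ _)) rfl).trans ?_
  refine (Cell.right_comp _ _ _).symm.trans ?_
  refine (Cell.right rfl (pullShift_comp_map D α' β v)).trans ?_
  refine (Cell.right_comp _ _ _).trans ?_
  exact Cell.right (cell_pullTransport₂ D η e ψ).symm rfl

end PullTransport
end TwoDiag

/-! ### Homotopy fibres of the contravariant Grothendieck construction -/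

namespace TwoDiag

namespace GrothOp
open Opposite Bicategory.Opposite
variable {C : Type u₁} [Bicategory.{w₁, v₁} C] [Strict C]
  {D E : StrictPseudofunctor Cᵒᵖ TwoCat.{w, v, u}}

/-- Naturality of `Γ` on 2-cells of `C`, in the form that compares transport in `D` with structure
cells in `E`. -/
theorem component_pullShift (Γ : TwoNatTrans D E) {a b c : C} {f : c ⟶ a} {g : c ⟶ b} {h : a ⟶ b}
    (α : f ≫ h ⟶ g) (x : D.obj (op b)) : Arr.mk ((component Γ c).map (pullShift D α x)) =
      Arr.mk (pullCell E α ((component Γ b).obj x)) :=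
  (Arr.map rfl (arr_pullShift D α x)).trans (naturality_pullCell Γ α x)

theorem isIdCell_mapHom₂ (Γ : TwoNatTrans D E) {V W : GrothOp D} {f g : V ⟶ W} {η : f ⟶ g}
    (hη : IsIdCell η.fiber) : IsIdCell (mapHom₂ Γ η).fiber :=
  (hη.map _).of_cell (cell_mapHom₂ Γ η)

theorem arr_pullCell_comp_eqToHom {a b : C} {f g h : a ⟶ b} (α : f ⟶ g) (e : g = h)
    (x : D.obj (op b)) : Arr.mk (pullCell D (α ≫ eqToHom e) x) = Arr.mk (pullCell D α x) := by
  subst e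
  rw [eqToHom_refl, Category.comp_id]

/-! ### The inclusion of a fibre, contravariantly. -/

section Incl
variable (D) (c : C)

theorem inclHom₂_eq {x y : D.obj (op c)} (v : x ⟶ y) :
    (v ≫ eqToHom (pull_id_obj D c y)) ≫ pullCell D (𝟙 (𝟙 c)) y =
      v ≫ eqToHom (pull_id_obj D c y) := by
  rw [pullCell_id, Strict.comp_id]

/-- The action on 1-cells of the inclusion of a fibre. -/
def inclHom {x y : D.obj (op c)} (v : x ⟶ y) : (⟨c, x⟩ : GrothOp D) ⟶ ⟨c, y⟩ :=
  ⟨𝟙 c, v ≫ eqToHom (pull_id_obj D c y)⟩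

theorem arr_inclHom {x y : D.obj (op c)} (v : x ⟶ y) :
    Arr.mk (inclHom D c v).fiber = Arr.mk v :=
  Arr.comp_eqToHom _ _

/-- The action on 2-cells of the inclusion of a fibre. -/
def inclHom₂ {x y : D.obj (op c)} {v v' : x ⟶ y} (ψ : v ⟶ v') :
    inclHom D c v ⟶ inclHom D c v' :=
  ⟨𝟙 (𝟙 c), eqToHom (inclHom₂_eq D c v) ≫ ψ ▷ eqToHom (pull_id_obj D c y)⟩

theorem cell_inclHom₂ {x y : D.obj (op c)} {v v' : x ⟶ y} (ψ : v ⟶ v') :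
    Cell.mk (inclHom₂ D c ψ).fiber = Cell.mk ψ :=
  (Cell.eqToHom_comp _ _).trans (Cell.right_eqToHom _ _)

theorem inclHom_id (x : D.obj (op c)) : inclHom D c (𝟙 x) = 𝟙 (⟨c, x⟩ : GrothOp D) :=
  Hom.hext rfl ((arr_inclHom D c (𝟙 x)).trans
    (Arr.eqToHom_eq rfl (pull_id_obj D c x) (pull_id_obj D c x)))

theorem arr_pull_inclHom {x y : D.obj (op c)} (v : x ⟶ y) :
    Arr.mk ((pull D (𝟙 c)).map (inclHom D c v).fiber) = Arr.mk v :=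
  (pull_id_map D _).trans (arr_inclHom D c v)

theorem inclHom_comp {x y z : D.obj (op c)} (v : x ⟶ y) (v' : y ⟶ z) :
    inclHom D c (v ≫ v') = inclHom D c v ≫ inclHom D c v' := by
  refine Hom.hext (Strict.id_comp _).symm ((arr_inclHom D c _).trans ?_)
  exact Eq.trans (Arr.comp (arr_inclHom D c v).symm (arr_pull_inclHom D c v').symm)
    (arr_comp (inclHom D c v) (inclHom D c v')).symm

/-- The inclusion of a fibre into the Grothendieck construction. -/
def incl : StrictPseudofunctor (D.obj (op c)) (GrothOp D) :=
  StrictPseudofunctor.mk''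
    { obj := fun x => ⟨c, x⟩
      map := inclHom D c
      map₂ := inclHom₂ D c
      map₂_id := fun v => Hom₂.eq_of_cell rfl <| (cell_inclHom₂ D c _).trans <|
        (Cell.id (arr_inclHom D c v).symm).trans (cell_id₂ _).symm
      map₂_comp := fun {x y v v' v''} ψ ψ' => by
        refine Hom₂.eq_of_cell (Category.id_comp _).symm ((cell_inclHom₂ D c _).trans ?_)
        refine Eq.trans ?_ (cell_vcomp _ _).symm
        refine Cell.vcomp ((cell_inclHom₂ D c ψ).symm.trans ?_) (cell_inclHom₂ D c ψ').symm
        refine (Cell.right_eqToHom rfl _).symm.trans ?_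
        exact Cell.right rfl (congrArg Arr.mk (pullCell_id D (𝟙 c) y).symm)
      map_id := inclHom_id D c
      map_comp := inclHom_comp D c
      map₂_whisker_left := fun {x y z} v {v' v''} ψ => by
        refine eq_conj_of_cell (cell_congr (inclHom_comp D c v v') (inclHom_comp D c v v'') ?_ ?_)
          _ _
        · exact (isIdCell_id _).congr ((isIdCell_id _).left _)
            (congrArg Arr.mk (Strict.id_comp _).symm)
        · refine (cell_inclHom₂ D c _).trans (Eq.trans ?_ (cell_whiskerL _ _).symm)
          exact Cell.left (arr_inclHom D c v).symm
            ((cell_inclHom₂ D c ψ).symm.trans (pull_id_map₂ D _).symm)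
      map₂_whisker_right := fun {x y z v v'} ψ v'' => by
        refine eq_conj_of_cell (cell_congr (inclHom_comp D c v v'') (inclHom_comp D c v' v'') ?_ ?_)
          _ _
        · exact (isIdCell_id _).congr ((isIdCell_id _).right _)
            (congrArg Arr.mk (Strict.id_comp _).symm)
        · refine (cell_inclHom₂ D c _).trans (Eq.trans ?_ (cell_whiskerR _ _).symm)
          exact Cell.right (cell_inclHom₂ D c ψ).symm (arr_pull_inclHom D c v'').symm }

end Incl

variable (Γ : TwoNatTrans D E) (c : C) (y : E.obj (op c))

/-- The homotopy fibre of `∫_C Γ` at `(c, y)`. -/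
abbrev TotalFibre := UnderFibre (⟨c, y⟩ : GrothOp E) (GrothOp.map Γ)

/-- The homotopy fibre of `Γ_c` at `y`. -/
abbrev LocalFibre := UnderFibre y (component Γ c)

variable {Γ c y}

/-! ### Structure cells of the contravariant total fibre. -/

section Leg

/-- The first component of the structure 1-cell of an object of the total fibre. -/
def leg (X : TotalFibre Γ c y) : c ⟶ X.base.base := X.hom.base

/-- The second component of the structure 1-cell of an object of the total fibre. -/
def legFiber (X : TotalFibre Γ c y) :
    y ⟶ (pull E (leg X)).obj ((component Γ X.base.base).obj X.base.fiber) := X.hom.fiber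

variable {X Y Z : TotalFibre Γ c y}

/-- The first component of the structure 2-cell of a 1-cell of the total fibre. -/
def legCell (m : X ⟶ Y) : leg X ≫ m.base.base ⟶ leg Y := m.cell.base

/-- The second component of the structure 2-cell of a 1-cell of the total fibre. -/
def legFiberCell (m : X ⟶ Y) : (X.hom ≫ mapHom Γ m.base).fiber ≫
    pullCell E (legCell m) ((component Γ Y.base.base).obj Y.base.fiber) ⟶ legFiber Y :=
  m.cell.fiber

theorem legCell_id (X : TotalFibre Γ c y) :
    legCell (𝟙 X) = eqToHom (Strict.comp_id (leg X)) :=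
  base_eqToHom (UnderFibre.hom_eq X)

theorem legFiberCell_id (X : TotalFibre Γ c y) : IsIdCell (legFiberCell (𝟙 X)) :=
  fiber_eqToHom (UnderFibre.hom_eq X)

theorem legCell_comp (m : X ⟶ Y) (n : Y ⟶ Z) : legCell (m ≫ n) =
    eqToHom (Strict.assoc _ _ _).symm ≫ legCell m ▷ n.base.base ≫ legCell n :=
  congrArg (fun t => t ≫ legCell m ▷ n.base.base ≫ legCell n) (base_eqToHom _)

theorem legFiberCell_comp (m : X ⟶ Y) (n : Y ⟶ Z) : Cell.mk (legFiberCell (m ≫ n)) =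
    Cell.mk ((whiskerR m.cell (mapHom Γ n.base)).fiber ▷ pullCell E (legCell n) _ ≫
      legFiberCell n) := by
  refine (cell_vcomp _ _).trans ((((fiber_eqToHom _).right _).comp_cell _).trans ?_)
  exact cell_vcomp _ _

theorem legCell_whiskerLeft {m n : X ⟶ Y} (η : m ⟶ n) :
    leg X ◁ η.cell.base ≫ legCell n = legCell m :=
  congrArg Hom₂.base η.w

theorem legFiberCell_whiskerLeft {m n : X ⟶ Y} (η : m ⟶ n) :
    Cell.mk ((whiskerL X.hom (mapHom₂ Γ η.cell)).fiber ▷ pullCell E (legCell n) _ ≫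
      legFiberCell n) = Cell.mk (legFiberCell m) := by
  refine (cell_vcomp _ _).symm.trans ?_
  exact congrArg (fun t : (X.hom ≫ mapHom Γ m.base) ⟶ Y.hom => Cell.mk t.fiber) η.w

end Leg

/-! ### Pulling the total fibre back to the local fibre. -/

section ToLocal
variable {X Y Z : TotalFibre Γ c y}

/-- The action on objects of the comparison of the total fibre with the local fibre. -/
def toLocalObj (X : TotalFibre Γ c y) : LocalFibre Γ c y :=
  ⟨(pull D (leg X)).obj X.base.fiber,
    legFiber X ≫ eqToHom (naturality_obj Γ (leg X) X.base.fiber).symm⟩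

theorem arr_toLocalObj (X : TotalFibre Γ c y) : Arr.mk (toLocalObj X).hom = Arr.mk (legFiber X) :=
  Arr.comp_eqToHom _ _

/-- Naturality of `Γ` identifies the sources of the structure 2-cells in the two fibres. -/
theorem toLocalHom_eq (m : X ⟶ Y) :
    (toLocalObj X).hom ≫ (component Γ c).map (pullTransport D (legCell m) m.base.fiber) =
      ((X.hom ≫ mapHom Γ m.base).fiber ≫
        pullCell E (legCell m) ((component Γ Y.base.base).obj Y.base.fiber)) ≫
      eqToHom (naturality_obj Γ (leg Y) Y.base.fiber).symm := by
  apply Arr.inj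
  refine Eq.trans ?_ (Arr.comp_eqToHom _ _).symm
  refine (Arr.comp rfl (Arr.map_comp _ _ _)).trans ((Arr.assoc _ _ _).symm.trans ?_)
  refine Arr.comp ?_ (component_pullShift Γ _ _)
  refine Eq.trans ?_ (arr_comp X.hom (mapHom Γ m.base)).symm
  refine Arr.comp (arr_toLocalObj X) ?_
  exact (naturality_map Γ _ _).trans (Arr.map rfl (arr_mapHom Γ m.base).symm)

/-- The action on 1-cells of the comparison of the total fibre with the local fibre. -/
def toLocalHom (m : X ⟶ Y) : toLocalObj X ⟶ toLocalObj Y :=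
  ⟨pullTransport D (legCell m) m.base.fiber, eqToHom (toLocalHom_eq m) ≫
    legFiberCell m ▷ eqToHom (naturality_obj Γ (leg Y) Y.base.fiber).symm⟩

theorem cell_toLocalHom (m : X ⟶ Y) : Cell.mk (toLocalHom m).cell = Cell.mk (legFiberCell m) :=
  (Cell.eqToHom_comp _ _).trans (Cell.right_eqToHom _ _)

/-- The action on 2-cells of the comparison of the total fibre with the local fibre. -/
def toLocalHom₂ {m n : X ⟶ Y} (η : m ⟶ n) : toLocalHom m ⟶ toLocalHom n :=
  ⟨pullTransport₂ D η.cell.base (legCell_whiskerLeft η) η.cell.fiber, by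
    -- The condition is the fibre component of the condition on `η`; the structure 2-cell of `m` is
    -- recovered from that of `n`.
    refine Cell.inj (Eq.trans ?_ (cell_toLocalHom m).symm)
    refine Eq.trans ?_ (legFiberCell_whiskerLeft η)
    refine Cell.vcomp ?_ (cell_toLocalHom n)
    refine (Cell.left rfl ((Cell.map rfl (cell_pullTransport₂ D _ _ _)).trans
      (Cell.map_right _ _ _))).trans ((Cell.left_right _ _ _).symm.trans ?_)
    refine Cell.right (Eq.trans ?_ (cell_whiskerL X.hom (mapHom₂ Γ η.cell)).symm)
      (component_pullShift Γ _ _)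
    refine Cell.left (arr_toLocalObj X) ?_
    exact (naturality_map₂ Γ _ _).trans (Cell.map rfl (cell_mapHom₂ Γ η.cell).symm)⟩

theorem toLocalHom_id (X : TotalFibre Γ c y) : toLocalHom (𝟙 X) = 𝟙 (toLocalObj X) := by
  refine UnderFibre.Hom.ext_cell ?_ ?_
  · refine Eq.trans ?_ (pullTransport_id D (Strict.comp_id (leg X)) X.base.fiber)
    exact congrArg (fun α => pullTransport D α (eqToHom (pull_id_obj D X.base.base X.base.fiber)))
      (legCell_id X)
  · exact ((legFiberCell_id X).of_cell (cell_toLocalHom _)).congr_cod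
      (UnderFibre.isIdCell_cell_id _) rfl

theorem toLocalHom_comp (m : X ⟶ Y) (n : Y ⟶ Z) :
    toLocalHom (m ≫ n) = toLocalHom m ≫ toLocalHom n := by
  refine UnderFibre.Hom.ext_cell ?_ ?_
  · refine Eq.trans ?_ (pullTransport_comp D (legCell m) (legCell n) m.base.fiber n.base.fiber)
    exact congrArg (fun α => pullTransport D α (m.base ≫ n.base).fiber) (legCell_comp m n)
  · refine (cell_toLocalHom _).trans ((legFiberCell_comp m n).trans ?_)
    refine Eq.trans ?_ (Cell.eqToHom_comp _ _).symm
    refine Cell.vcomp ?_ (cell_toLocalHom n).symm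
    refine Eq.trans ?_ (Cell.right rfl (Arr.map_comp _ _ _)).symm
    refine Eq.trans ?_ (Cell.right_comp _ _ _).symm
    refine Cell.right ((cell_whiskerR _ _).trans ?_) (component_pullShift Γ _ _).symm
    refine Cell.right (cell_toLocalHom m).symm ?_
    exact (Arr.map rfl (arr_mapHom Γ n.base)).trans (naturality_map Γ _ _).symm

variable (Γ c y) in
/-- The comparison of the total fibre with the local fibre. -/
def toLocal : StrictPseudofunctor (TotalFibre Γ c y) (LocalFibre Γ c y) :=
  StrictPseudofunctor.mk''
    { obj := toLocalObj
      map := toLocalHom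
      map₂ := toLocalHom₂
      map₂_id := fun m => UnderFibre.Hom₂.eq_of_cell <| Cell.inj <|
        (pullTransport₂_isIdCell D _ (legCell_whiskerLeft (𝟙 m))
          (isIdCell_fiber_id m.base)).congr (isIdCell_id _) rfl
      map₂_comp := fun η θ => UnderFibre.Hom₂.eq_of_cell <|
        pullTransport₂_vcomp D _ _ _ (legCell_whiskerLeft η) (legCell_whiskerLeft θ)
          (legCell_whiskerLeft (η ≫ θ)) _ _ _ (cell_vcomp η.cell θ.cell)
      map_id := toLocalHom_id
      map_comp := toLocalHom_comp
      map₂_whisker_left := fun {X Y Z} m {n n'} η => by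
        refine eq_conj_of_cell (UnderFibre.cell_congr (toLocalHom_comp m n) (toLocalHom_comp m n')
          ?_) _ _
        exact pullTransport₂_whiskerLeft D (legCell m) η.cell.base (legCell_whiskerLeft η)
          (legCell_whiskerLeft (m ◁ η)) (legCell_comp m n') m.base.fiber η.cell.fiber _
          (Cell.eqToHom_comp _ _)
      map₂_whisker_right := fun {X Y Z m m'} η n => by
        refine eq_conj_of_cell (UnderFibre.cell_congr (toLocalHom_comp m n) (toLocalHom_comp m' n)
          ?_) _ _
        exact pullTransport₂_whiskerRight D η.cell.base (legCell_whiskerLeft η) (legCell n)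
          (legCell_whiskerLeft (η ▷ n)) (legCell_comp m' n) η.cell.fiber n.base.fiber _
          (Cell.eqToHom_comp _ _) }

end ToLocal

/-! ### Including the local fibre, contravariantly. -/

section OfLocal
variable {P Q R : LocalFibre Γ c y}

/-- The action on objects of the comparison of the local fibre with the total fibre. -/
def ofLocalObj (P : LocalFibre Γ c y) : TotalFibre Γ c y :=
  ⟨⟨c, P.base⟩, inclHom E c P.hom⟩

theorem mapHom_inclHom (Γ : TwoNatTrans D E) {x y : D.obj (op c)} (v : x ⟶ y) :
    mapHom Γ (inclHom D c v) = inclHom E c ((component Γ c).map v) :=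
  Hom.hext rfl (((arr_mapHom Γ _).trans (Arr.map rfl (arr_inclHom D c v))).trans
    (arr_inclHom E c _).symm)

theorem ofLocalHom_eq (m : P ⟶ Q) : inclHom E c P.hom ≫ mapHom Γ (inclHom D c m.base) =
    inclHom E c (P.hom ≫ (component Γ c).map m.base) :=
  (congrArg (inclHom E c P.hom ≫ ·) (mapHom_inclHom Γ m.base)).trans (inclHom_comp E c _ _).symm

/-- The action on 1-cells of the comparison of the local fibre with the total fibre. -/
def ofLocalHom (m : P ⟶ Q) : ofLocalObj P ⟶ ofLocalObj Q :=
  ⟨inclHom D c m.base, eqToHom (ofLocalHom_eq m) ≫ inclHom₂ E c m.cell⟩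

theorem cell_ofLocalHom (m : P ⟶ Q) :
    Cell.mk (ofLocalHom m).cell = Cell.mk (inclHom₂ E c m.cell) :=
  Cell.eqToHom_comp _ _

theorem cell_mapHom₂_inclHom₂ (Γ : TwoNatTrans D E) {x y : D.obj (op c)} {v v' : x ⟶ y}
    (ψ : v ⟶ v') :
    Cell.mk (B := GrothOp E) (dom := mapHom Γ (inclHom D c v)) (cod := mapHom Γ (inclHom D c v'))
      (mapHom₂ Γ (inclHom₂ D c ψ)) = Cell.mk (inclHom₂ E c ((component Γ c).map₂ ψ)) :=
  cell_congr (mapHom_inclHom Γ v) (mapHom_inclHom Γ v') rfl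
    (((cell_mapHom₂ Γ _).trans (Cell.map rfl (cell_inclHom₂ D c ψ))).trans
      (cell_inclHom₂ E c _).symm)

/-- The action on 2-cells of the comparison of the local fibre with the total fibre. -/
def ofLocalHom₂ {m n : P ⟶ Q} (ψ : m ⟶ n) : ofLocalHom m ⟶ ofLocalHom n :=
  ⟨inclHom₂ D c ψ.cell, by
    refine Cell.inj (Eq.trans ?_ (cell_ofLocalHom m).symm)
    refine Eq.trans ?_ (congrArg (fun t => Cell.mk (inclHom₂ E c t)) ψ.w)
    refine Eq.trans ?_ (Cell.map_comp (incl E c) _ _).symm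
    refine Cell.vcomp (Eq.trans ?_ (Cell.map_left (incl E c) _ _).symm) (cell_ofLocalHom n)
    exact Cell.left rfl (cell_mapHom₂_inclHom₂ Γ ψ.cell)⟩

theorem ofLocalHom_id (P : LocalFibre Γ c y) : ofLocalHom (𝟙 P) = 𝟙 (ofLocalObj P) :=
  UnderFibre.Hom.ext_cell (inclHom_id D c P.base) <|
    (((UnderFibre.isIdCell_cell_id P).map (incl E c)).of_cell (cell_ofLocalHom _)).congr_cod
      (UnderFibre.isIdCell_cell_id _) rfl

theorem ofLocalHom_comp (m : P ⟶ Q) (n : Q ⟶ R) :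
    ofLocalHom (m ≫ n) = ofLocalHom m ≫ ofLocalHom n := by
  refine UnderFibre.Hom.ext_cell (inclHom_comp D c m.base n.base) ((cell_ofLocalHom _).trans ?_)
  refine Eq.trans ?_ (Cell.eqToHom_comp _ _).symm
  refine (Cell.map (F := incl E c) rfl (Cell.eqToHom_comp _ _)).trans ?_
  refine (Cell.map_comp (incl E c) _ _).trans (Cell.vcomp ?_ (cell_ofLocalHom n).symm)
  refine (Cell.map_right (incl E c) _ _).trans ?_
  exact Cell.right (cell_ofLocalHom m).symm (congrArg Arr.mk (mapHom_inclHom Γ n.base).symm)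

variable (Γ c y) in
/-- The comparison of the local fibre with the total fibre. -/
def ofLocal : StrictPseudofunctor (LocalFibre Γ c y) (TotalFibre Γ c y) :=
  StrictPseudofunctor.mk''
    { obj := ofLocalObj
      map := ofLocalHom
      map₂ := ofLocalHom₂
      map₂_id := fun m => UnderFibre.Hom₂.eq_of_cell ((incl D c).map₂_id m.base)
      map₂_comp := fun ψ ψ' => UnderFibre.Hom₂.eq_of_cell ((incl D c).map₂_comp ψ.cell ψ'.cell)
      map_id := ofLocalHom_id
      map_comp := ofLocalHom_comp
      map₂_whisker_left := fun {_ _ _} m {n n'} ψ => eq_conj_of_cell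
        (UnderFibre.cell_congr (ofLocalHom_comp m n) (ofLocalHom_comp m n')
          (Cell.map_left (incl D c) m.base ψ.cell)) _ _
      map₂_whisker_right := fun {_ _ _ m m'} ψ n => eq_conj_of_cell
        (UnderFibre.cell_congr (ofLocalHom_comp m n) (ofLocalHom_comp m' n)
          (Cell.map_right (incl D c) ψ.cell n.base)) _ _ }

theorem legCell_ofLocalHom (m : P ⟶ Q) :
    legCell (ofLocalHom m) = eqToHom (Strict.comp_id (𝟙 c)) :=
  (congrArg (· ≫ 𝟙 (𝟙 c)) (base_eqToHom (ofLocalHom_eq m))).trans (Category.comp_id _)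

theorem cell_ofLocalHom_fiber (m : P ⟶ Q) :
    Cell.mk (ofLocalHom m).cell.fiber = Cell.mk m.cell :=
  (fiber_comp (inclHom₂ E c m.cell) (fiber_eqToHom (ofLocalHom_eq m))).trans
    (cell_inclHom₂ E c m.cell)

theorem cell_toLocalHom_ofLocalHom (m : P ⟶ Q) :
    Cell.mk (toLocalHom (ofLocalHom m)).cell = Cell.mk m.cell :=
  (cell_toLocalHom _).trans (cell_ofLocalHom_fiber m)

theorem arr_toLocalObj_ofLocalObj (P : LocalFibre Γ c y) :
    Arr.mk (toLocalObj (ofLocalObj P)).hom = Arr.mk P.hom :=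
  (arr_toLocalObj _).trans (arr_inclHom E c P.hom)

theorem arr_pullShift_ofLocalHom (m : P ⟶ Q) :
    Arr.mk (pullShift D (legCell (ofLocalHom m)) Q.base) = Arr.mk (𝟙 Q.base) :=
  (congrArg (fun α => Arr.mk (pullShift D α Q.base)) (legCell_ofLocalHom m)).trans <|
    (congrArg Arr.mk (pullShift_eqToHom D (Strict.comp_id (𝟙 c)) Q.base)).trans <|
      Arr.eqToHom_eq _ rfl (pull_id_obj D c _).symm

variable (Γ c y) in
-- Pulling back along the identity leg of an included object changes nothing, so the equality is
-- again strict.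
theorem ofLocal_comp_toLocal :
    (ofLocal Γ c y).comp (toLocal Γ c y) = StrictPseudofunctor.id (LocalFibre Γ c y) :=
  strictPseudofunctor_eq_of_cell fun {P Q m n} ψ => by
    refine UnderFibre.cell_ext (f' := m) (g' := n) (θ := ψ) ?_ (arr_toLocalObj_ofLocalObj P)
      (arr_toLocalObj_ofLocalObj Q) (cell_toLocalHom_ofLocalHom m) (cell_toLocalHom_ofLocalHom n)
    refine (cell_pullTransport₂ D _ (legCell_whiskerLeft (ofLocalHom₂ ψ)) _).trans ?_
    exact (Cell.right ((pull_id_map₂ D _).trans (cell_inclHom₂ D c ψ.cell))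
      (arr_pullShift_ofLocalHom n)).trans (Cell.right_eqToHom rfl _)

end OfLocal

/-! ### The cartesian 1-cells as a lax transformation. -/

section Counit
variable {X Y Z : TotalFibre Γ c y}

/-- The cartesian 1-cell over the structure 1-cell of an object of the total fibre. -/
def legHom (X : TotalFibre Γ c y) : (⟨c, (toLocalObj X).base⟩ : GrothOp D) ⟶ X.base :=
  ⟨leg X, 𝟙 _⟩

theorem arr_pull_mapHom_legHom (X : TotalFibre Γ c y) :
    Arr.mk ((pull E (𝟙 c)).map (mapHom Γ (legHom X)).fiber) =
      Arr.mk (𝟙 ((component Γ c).obj (toLocalObj X).base)) :=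
  (pull_id_map E _).trans ((arr_mapHom Γ (legHom X)).trans
    (congrArg Arr.mk ((component Γ c).map_id _)))

/-- The factorization of a 1-cell as a vertical one followed by a cartesian one. -/
theorem legHom_eq (X : TotalFibre Γ c y) :
    inclHom E c (toLocalObj X).hom ≫ mapHom Γ (legHom X) = X.hom := by
  refine Hom.hext (Strict.id_comp (leg X)) ?_
  refine (arr_comp (inclHom E c (toLocalObj X).hom) (mapHom Γ (legHom X))).trans ?_
  refine (Arr.comp (arr_inclHom E c (toLocalObj X).hom) (arr_pull_mapHom_legHom X)).trans ?_
  exact (congrArg Arr.mk (Strict.comp_id _)).trans (arr_toLocalObj X)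

/-- The component of the counit. -/
def counitApp (X : TotalFibre Γ c y) : ofLocalObj (toLocalObj X) ⟶ X :=
  ⟨legHom X, eqToHom (legHom_eq X)⟩

theorem arr_pull_legHom (X : TotalFibre Γ c y) :
    Arr.mk ((pull D (𝟙 c)).map (legHom X).fiber) = Arr.mk (𝟙 (toLocalObj X).base) :=
  pull_id_map D _

theorem arr_legHom_comp {W : GrothOp D} (f : X.base ⟶ W) :
    Arr.mk (legHom X ≫ f).fiber = Arr.mk ((pull D (leg X)).map f.fiber) :=
  (arr_comp (legHom X) f).trans (congrArg Arr.mk (Strict.id_comp _))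

/-- Both sides are the pullback of the fibre component of `m` followed by the shift along `legCell
m`. The 2-cell of the counit thus has identity fibre component, and it points from the cartesian
1-cell composed with `m`, as a lax transformation to the identity requires. -/
theorem counitCell_eq (m : X ⟶ Y) :
    (legHom X ≫ m.base).fiber ≫
        pullCell D (legCell m ≫ eqToHom (Strict.id_comp (leg Y)).symm) Y.base.fiber =
      (inclHom D c (toLocalHom m).base ≫ legHom Y).fiber := by
  apply Arr.inj
  refine Eq.trans ?_ (arr_comp (inclHom D c (toLocalHom m).base) (legHom Y)).symm
  refine Eq.trans ?_ (Arr.comp (arr_inclHom D c (toLocalHom m).base) (arr_pull_legHom Y)).symm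
  refine Eq.trans ?_ (congrArg Arr.mk (Strict.comp_id (toLocalHom m).base)).symm
  refine Arr.comp (arr_legHom_comp m.base) ?_
  exact (arr_pullCell_comp_eqToHom _ _ _).trans (arr_pullShift D _ _).symm

/-- The 2-cell of the counit, in the Grothendieck construction. -/
def counitBase (m : X ⟶ Y) : legHom X ≫ m.base ⟶ inclHom D c (toLocalHom m).base ≫ legHom Y :=
  ⟨legCell m ≫ eqToHom (Strict.id_comp (leg Y)).symm, eqToHom (counitCell_eq m)⟩

theorem isIdCell_counitBase (m : X ⟶ Y) : IsIdCell (counitBase m).fiber :=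
  isIdCell_eqToHom (counitCell_eq m)

theorem cell_counitBase (m : X ⟶ Y) : Cell.mk (counitBase m).base = Cell.mk (legCell m) :=
  Cell.comp_eqToHom _ _

theorem isIdCell_ofLocalHom_cell_base {P Q : LocalFibre Γ c y} (m : P ⟶ Q) :
    IsIdCell (ofLocalHom m).cell.base :=
  (isIdCell_eqToHom _).of_cell (congrArg Cell.mk (legCell_ofLocalHom m))

theorem comp_cell_base {W : TotalFibre Γ c y} (m : W ⟶ X) (n : X ⟶ Y) :
    Cell.mk (m ≫ n).cell.base = Cell.mk (m.cell.base ▷ n.base.base ≫ n.cell.base) :=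
  (congrArg Cell.mk (legCell_comp m n)).trans (Cell.eqToHom_comp _ _)

theorem legCell_counitApp (X : TotalFibre Γ c y) :
    legCell (counitApp X) = eqToHom (Strict.id_comp (leg X)) :=
  base_eqToHom (legHom_eq X)

theorem cell_whiskerR_ofLocalHom {P : LocalFibre Γ c y} (n : P ⟶ toLocalObj Y) :
    Cell.mk ((whiskerR (ofLocalHom n).cell (mapHom Γ (legHom Y))).fiber ▷
      pullCell E (legCell (counitApp Y)) ((component Γ Y.base.base).obj Y.base.fiber)) =
        Cell.mk n.cell := by
  refine (Cell.right rfl (congrArg Arr.mk ((congrArg (pullCell E · _) (legCell_counitApp Y)).trans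
    (pullCell_eqToHom E (Strict.id_comp (leg Y)) _)))).trans ?_
  refine (Cell.right_eqToHom _ _).trans ((cell_whiskerR _ _).trans ?_)
  exact (Cell.right (cell_ofLocalHom_fiber n) (arr_pull_mapHom_legHom Y)).trans
    (Cell.right_eqToHom rfl _)

theorem legFiberCell_comp_counitApp {P : LocalFibre Γ c y} (n : P ⟶ toLocalObj Y) :
    Cell.mk (legFiberCell (ofLocalHom n ≫ counitApp Y)) = Cell.mk n.cell :=
  (legFiberCell_comp (ofLocalHom n) (counitApp Y)).trans <|
    (IsIdCell.cell_comp _ (fiber_eqToHom (legHom_eq Y))).trans (cell_whiskerR_ofLocalHom n)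

theorem legFiberCell_counitApp_comp (m : X ⟶ Y) :
    Cell.mk (legFiberCell (counitApp X ≫ m)) = Cell.mk (legFiberCell m) :=
  have h : IsIdCell (counitApp X).cell.fiber := fiber_eqToHom (legHom_eq X)
  (legFiberCell_comp (counitApp X) m).trans <| IsIdCell.comp_cell
    (((h.right _).of_cell (cell_whiskerR (counitApp X).cell (mapHom Γ m.base))).right _) _

theorem legCell_counitApp_comp (m : X ⟶ Y) :
    Cell.mk (legCell (counitApp X ≫ m)) = Cell.mk (legCell m) :=
  (comp_cell_base (counitApp X) m).trans
    (((isIdCell_base_eqToHom (legHom_eq X)).right _).comp_cell _)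

theorem isIdCell_legCell_comp_counitApp {P : LocalFibre Γ c y} (n : P ⟶ toLocalObj Y) :
    IsIdCell (legCell (ofLocalHom n ≫ counitApp Y)) :=
  (((isIdCell_ofLocalHom_cell_base n).right (leg Y)).comp
    (isIdCell_base_eqToHom (legHom_eq Y))).of_cell (comp_cell_base _ _)

/-- Removing identity cells leaves `legCell m` in the base and `legFiberCell m` in the fibre of both
sides. -/
theorem counitCell_w (m : X ⟶ Y) :
    inclHom E c (toLocalObj X).hom ◁ mapHom₂ Γ (counitBase m) ≫
      (ofLocalHom (toLocalHom m) ≫ counitApp Y).cell = (counitApp X ≫ m).cell := by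
  refine Hom₂.eq_of_cell (Cell.inj ?_) ?_
  · refine (IsIdCell.cell_comp _ (isIdCell_legCell_comp_counitApp (toLocalHom m))).trans ?_
    exact ((Cell.eqToHom_left rfl _).trans (cell_counitBase m)).trans
      (legCell_counitApp_comp m).symm
  · refine (fiber_comp _ (isIdCell_whiskerLeft _ (isIdCell_mapHom₂ Γ
      (isIdCell_counitBase m)))).trans ?_
    exact (legFiberCell_comp_counitApp (toLocalHom m)).trans
      ((cell_toLocalHom m).trans (legFiberCell_counitApp_comp m).symm)

/-- The 2-cell of the counit. -/
def counitCell (m : X ⟶ Y) : counitApp X ≫ m ⟶ ofLocalHom (toLocalHom m) ≫ counitApp Y :=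
  ⟨counitBase m, counitCell_w m⟩

/-- The base component is that of the condition on `η`; in the fibre both sides are the pulled back
fibre component of `η`, whiskered by the shift along `legCell n`. -/
theorem counitBase_naturality {m n : X ⟶ Y} (η : m ⟶ n) :
    legHom X ◁ η.cell ≫ counitBase n =
      counitBase m ≫ inclHom₂ D c (toLocalHom₂ η).cell ▷ legHom Y := by
  refine Hom₂.eq_of_cell (Cell.inj ?_) ?_
  · refine Eq.trans ?_ (IsIdCell.cell_comp _ ((isIdCell_id (𝟙 c)).right (leg Y))).symm
    refine Eq.trans ?_ (cell_counitBase m).symm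
    refine (Cell.vcomp rfl (cell_counitBase n)).trans ?_
    exact congrArg Cell.mk (legCell_whiskerLeft η)
  · refine Eq.trans ?_ (fiber_comp _ (isIdCell_counitBase m)).symm
    refine ((cell_vcomp _ (counitBase n)).trans
      (IsIdCell.cell_comp _ (isIdCell_counitBase n))).trans ?_
    refine Eq.trans ?_ (cell_whiskerR _ _).symm
    refine Eq.trans ?_ ((Cell.right (cell_inclHom₂ D c _) (arr_pull_legHom Y)).trans
      ((Cell.right_eqToHom rfl _).trans
        (cell_pullTransport₂ D _ (legCell_whiskerLeft η) _))).symm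
    refine Cell.right ?_ ((arr_pullCell_comp_eqToHom _ _ _).trans (arr_pullShift D _ _).symm)
    exact (cell_whiskerL (legHom X) η.cell).trans (Cell.eqToHom_left rfl _)

theorem comp_counitApp_id (X : TotalFibre Γ c y) :
    ofLocalHom (toLocalHom (𝟙 X)) ≫ counitApp X = counitApp X := by
  rw [toLocalHom_id, ofLocalHom_id, Strict.id_comp]

theorem comp_counitApp_comp (m : X ⟶ Y) (n : Y ⟶ Z) :
    ofLocalHom (toLocalHom (m ≫ n)) ≫ counitApp Z =
      ofLocalHom (toLocalHom m) ≫ ofLocalHom (toLocalHom n) ≫ counitApp Z := by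
  rw [toLocalHom_comp, ofLocalHom_comp, Strict.assoc]

theorem isIdCell_cell_base_eqToHom {m n : X ⟶ Y} (h : m = n) :
    IsIdCell (eqToHom h : m ⟶ n).cell.base := by
  subst h
  rfl

theorem isIdCell_cell_fiber_eqToHom {m n : X ⟶ Y} (h : m = n) :
    IsIdCell (eqToHom h : m ⟶ n).cell.fiber := by
  subst h
  exact isIdCell_fiber_id m.base

variable (Γ c y) in
/-- The counit of the comparison between the total fibre and the local fibre. -/
def counit : LaxNat ((toLocal Γ c y).comp (ofLocal Γ c y))
    (StrictPseudofunctor.id (TotalFibre Γ c y)) where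
  app := counitApp
  cell := counitCell
  naturality η := UnderFibre.Hom₂.eq_of_cell (counitBase_naturality η)
  cell_id X := by
    have h := comp_counitApp_id X
    refine UnderFibre.cell_congr (Strict.comp_id _) h (cell_congr
      (congrArg UnderFibre.Hom.base (Strict.comp_id (counitApp X)))
      (congrArg UnderFibre.Hom.base h) ?_ ?_)
    · exact ((isIdCell_eqToHom _).of_cell ((cell_counitBase _).trans
        (congrArg Cell.mk (legCell_id X)))).congr_cod (isIdCell_id _)
        (congrArg Arr.mk (Strict.id_comp _))
    · exact (isIdCell_counitBase _).congr_cod (isIdCell_fiber_id _)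
        (congrArg (fun t : _ ⟶ X => Arr.mk t.base.fiber) h)
  cell_comp {X Y Z} m n := by
    have h := comp_counitApp_comp m n
    refine UnderFibre.cell_congr (Strict.assoc _ _ _).symm h (cell_congr
      (congrArg UnderFibre.Hom.base (Strict.assoc (counitApp X) m n).symm)
      (congrArg UnderFibre.Hom.base h) ?_ ?_)
    -- As for the unit, the base part of the composition law is the formula for `legCell` of a
    -- composite.
    · refine (cell_counitBase _).trans ((congrArg Cell.mk (legCell_comp m n)).trans ?_)
      refine (Cell.eqToHom_comp _ _).trans ?_
      refine Cell.vcomp (Cell.right (cell_counitBase m).symm rfl) ?_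
      refine Eq.trans ?_ (IsIdCell.comp_cell ?_ _).symm
      · exact (cell_counitBase n).symm.trans (Cell.eqToHom_left rfl _).symm
      · exact isIdCell_cell_base_eqToHom _
    -- Both fibre components are identity cells; their targets are compared.
    · refine (isIdCell_counitBase _).congr_cod ?_
        (congrArg (fun t : _ ⟶ Z => Arr.mk t.base.fiber) h)
      exact isIdCell_comp (isIdCell_whiskerRight (isIdCell_counitBase m) _)
        (isIdCell_comp (isIdCell_cell_fiber_eqToHom _)
          (isIdCell_whiskerLeft _ (isIdCell_counitBase n)))

end Counit

/-- Theorem A for contravariant diagrams. -/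
theorem homotopyRightCofinal_map_iff {C : Type u} [Bicategory.{u, u} C] [Strict C]
    {D E : StrictPseudofunctor Cᵒᵖ TwoCat.{u, u, u}} (Γ : TwoNatTrans D E) :
    HomotopyRightCofinal (GrothOp.map Γ) ↔
      ∀ c : C, HomotopyRightCofinal (Γ.app (op c)).toFunctor := by
  have h : ∀ (c : C) (y : E.obj (op c)),
      WeaklyContractible (TotalFibre Γ c y) ↔ WeaklyContractible (LocalFibre Γ c y) := fun c y =>
    weaklyContractible_iff_of_homotopic (toLocal Γ c y) (ofLocal Γ c y)
      -- The counit ends at the identity, so its homotopy already has the required direction.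
      (ofLocal_comp_toLocal Γ c y) (counit Γ c y).homotopic
  exact ⟨fun H c y => (h c y).mp (H ⟨c, y⟩), fun H X => (h X.base X.fiber).mpr (H X.base X.fiber)⟩

end GrothOp
end TwoDiag

theorem mainTheorem11 {C : Type u} [Bicategory.{u, u} C] [Bicategory.Strict C] :
    (∀ (D E : StrictPseudofunctor C TwoDiag.TwoCat.{u, u, u}) (Γ : TwoDiag.TwoNatTrans D E),
      TwoDiag.HomotopyLeftCofinal (TwoDiag.Groth.map Γ) ↔
        ∀ c : C, TwoDiag.HomotopyLeftCofinal (Γ.app c).toFunctor) ∧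
    (∀ (D E : StrictPseudofunctor Cᵒᵖ TwoDiag.TwoCat.{u, u, u}) (Γ : TwoDiag.TwoNatTrans D E),
      TwoDiag.HomotopyRightCofinal (TwoDiag.GrothOp.map Γ) ↔
        ∀ c : C, TwoDiag.HomotopyRightCofinal (Γ.app (Opposite.op c)).toFunctor) :=
  ⟨fun _ _ Γ => TwoDiag.Groth.homotopyLeftCofinal_map_iff Γ,
    fun _ _ Γ => TwoDiag.GrothOp.homotopyRightCofinal_map_iff Γ⟩
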